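/- **Setting.** Let $V_0$ be a finite-dimensional real vector space, let $(R, V_0, R^\vee, V_0^\vee)$ be a reduced real root datum with $R$ finite (not necessarily crystallographic, and $R$ need not span $V_0$), let $\Pi\subset R$ be a set of simple roots and let $W$ be the finite reflection group generated by the reflections $s_\alpha$ ($\alpha\in R$), with longest element $w_0$ and sign character $\mathrm{sgn}=\det$. Put $V=\mathbb C\otimes_{\mathbb R}V_0$ and $n=\dim_{\mathbb C} V$. Let $k:\Pi\to\mathbb C$, $\alpha\mapsto k_\alpha$, be a function with $k_\alpha=k_\beta$ whenever $\alpha,\beta\in\Pi$ are $W$-conjugate. The graded affine Hecke algebra $\mathbb H$ is the associative unital $\mathbb C$-algebra generated by symbols $t_w$ ($w\in W$) and $v\in V$, with the relations: $w\mapsto t_w$ is multiplicative and unital, $v\mapsto v$ is $\mathbb C$-linear with commuting values, and $$t_{s_\alpha}v-s_\alpha(v)t_{s_\alpha}=k_\alpha\langle v,\alpha^\vee\rangle\qquad(\alpha\in\Pi,\ v\in V).$$ Let $*$ and $\bullet$ be the $\mathbb C$-linear anti-involutions of $\mathbb H$ with $t_w^*=t_w^\bullet=t_w^{-1}$, $v^*=-t_{w_0}w_0(v)t_{w_0}^{-1}$,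 $v^\bullet=v$, and let $\iota$ be the involution with $\iota(t_w)=\mathrm{sgn}(w)t_w$, $\iota(v)=-v$. For an $\mathbb H$-module $X$, let $X^*$ and $X^\bullet$ be the space of linear functionals on $X$ with the actions $(hf)(x)=f(h^*x)$ and $(hf)(x)=f(h^\bullet x)$ respectively, let $\iota(X)$ be $X$ with $h$ acting through $\iota(h)$, and put $\mathbb D(X)=\iota(X^\bullet)^*$. **Cochains.** For $\mathbb H$-modules $X,Y$, $\mathrm{Ext}^i_{\mathbb H}(X,Y)$ is computed by the complex of $W$-equivariant maps $\eta:X\otimes\wedge^iV\to Y$ that arises from the Koszul resolution $\mathbb H\otimes_{\mathbb C[W]}(X\otimes\wedge^\bullet V)\to X$, with differential $$(d\eta)(x;v_0,\dots,v_i)=\sum_{a=0}^{i}(-1)^a\bigl(v_a\,\eta(x;v_0,\dots,\widehat{v_a},\dots,v_i)-\eta(v_ax;v_0,\dots,\widehat{v_a},\dots,v_i)\bigr).$$ Fix a basis $e_1,\dots,e_n$ of $V$. For finite-dimensional $X,Y$ and $i+j=n$, the *duality pairing* $$\langle\ ,\ \rangle:\ \mathrm{Ext}^i_{\mathbb H}(X,Y)\times\mathrm{Ext}^{j}_{\mathbb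 H}(X^*,\iota(Y)^\bullet)\to\mathbb C$$ is the non-degenerate pairing induced by the following pairing of cocycles: $$\langle\eta,\eta'\rangle=\sum_r\sum_{L}\varepsilon(L)\;\eta'(x_r^*;e_{L^c})\bigl(\eta(x_r;e_L)\bigr),$$ where $(x_r)$ is a basis of $X$ with dual basis $(x_r^*)$, $L$ runs over the $i$-element subsets of $\{1,\dots,n\}$, $e_L$ is the increasing sequence of the $e_l$ with $l\in L$, and $\varepsilon(L)$ is the sign of the permutation $(L,L^c)$. The *identification* $\tau:\mathrm{Ext}^{j}_{\mathbb H}(Y,\mathbb D(X))\cong\mathrm{Ext}^{j}_{\mathbb H}(X^*,\iota(Y)^\bullet)$ is the linear isomorphism induced by $\eta\mapsto\eta'$, $\eta'(f;v)(y)=\eta(y;v)(f)$, for linear functionals $f$ on $X$ and $y\in Y$. **Theorem.** Let $X$ be a finite-dimensional $\mathbb H$-module. 1. If $X\neq0$, then $\mathrm{Ext}^n_{\mathbb H}(X,\mathbb D(X))\neq0$. 2. For every finite-dimensional $\mathbb H$-module $Y$ and all $i,j\ge 0$ with $i+j=n$, the Yoneda product $$\mathscr Y_i:\ \mathrm{Ext}^{n-i}_{\mathbb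 H}(Y,\mathbb D(X))\otimes\mathrm{Ext}^i_{\mathbb H}(X,Y)\to\mathrm{Ext}^n_{\mathbb H}(X,\mathbb D(X))$$ is non-degenerate: a class in either factor whose product with every class in the other factor vanishes is zero. 3. For every basis $e_1,\dots,e_n$ of $V$ there is a linear functional $\mathscr D_X:\mathrm{Ext}^n_{\mathbb H}(X,\mathbb D(X))\to\mathbb C$ such that, for every finite-dimensional $\mathbb H$-module $Y$ and all $i,j\ge0$ with $i+j=n$, the duality pairing and the identification $\tau$ are well defined (the pairing being non-degenerate and $\tau$ a linear isomorphism) and $$\mathscr D_X(\mathscr Y_i(b\otimes a))=\langle a,\tau(b)\rangle\qquad\text{for all }a\in\mathrm{Ext}^i_{\mathbb H}(X,Y),\ b\in\mathrm{Ext}^{n-i}_{\mathbb H}(Y,\mathbb D(X)).$$ -/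

import Mathlib

open scoped TensorProduct NNReal ModuleCat
open CategoryTheory

universe u

noncomputable section

/-- The data defining a graded affine Hecke algebra: a reduced (not necessarily crystallographic,
not necessarily spanning) root datum `P = (R, V₀, R^∨, V₀^∨)` over the real numbers, a set `Δ` of
simple roots (linearly independent, and every root is a nonnegative or a nonpositive real
combination of them), and a parameter function `k : Δ → ℂ` which takes the same value on simple
roots that are conjugate under the reflection group. -/
structure HeckeDatum (ι V₀ N : Type u) [AddCommGroup V₀] [Module ℝ V₀]
    [AddCommGroup N] [Module ℝ N] where
  P : RootPairing ι ℝ V₀ N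
  isReduced : P.IsReduced
  Δ : Set ι
  linearIndepOn : LinearIndepOn ℝ P.root Δ
  mem_or_neg_mem : ∀ i, P.root i ∈ Submodule.span ℝ≥0 (P.root '' Δ) ∨
    -P.root i ∈ Submodule.span ℝ≥0 (P.root '' Δ)
  k : Δ → ℂ
  k_eq : ∀ a b : Δ, (∃ w : P.weylGroup, w • P.root a = P.root b) → k a = k b

namespace HeckeDatum

variable {ι V₀ N : Type u} [AddCommGroup V₀] [Module ℝ V₀] [AddCommGroup N] [Module ℝ N]
  (D : HeckeDatum ι V₀ N)

/-- The finite reflection group `W`. -/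
abbrev W : Type u := D.P.weylGroup

/-- The complexification `V = ℂ ⊗ V₀`. -/
abbrev VC (_ : HeckeDatum ι V₀ N) : Type u := ℂ ⊗[ℝ] V₀

/-- The reflection in the `i`-th root. -/
def s (i : ι) : D.W := RootPairing.weylGroup.ofIdx D.P i

/-- The action of `W` on `V`. -/
def act (w : D.W) : D.VC →ₗ[ℂ] D.VC := (D.P.weylGroupRootRep w).baseChange ℂ

/-- The pairing `v ↦ ⟨v, α^∨⟩` of `V` with the coroot of the `i`-th root. -/
def cpair (i : ι) : D.VC →ₗ[ℂ] ℂ := (D.P.coroot' i).baseChange ℂ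

/-- The sign character of `W`: the determinant of `w` on `V₀`. -/
def sgn (w : D.W) : ℂ := ((LinearMap.det (D.P.weylGroupRootRep w) : ℝ) : ℂ)

/-- The `i`-th root is positive. -/
def IsPos (i : ι) : Prop := D.P.root i ∈ Submodule.span ℝ≥0 (D.P.root '' D.Δ)

lemma root_perm (w : D.W) (i : ι) :
    D.P.root (D.P.weylGroupToPerm w i) = D.P.weylGroupRootRep w (D.P.root i) :=
  (D.P.weylGroup_apply_root w i).symm

lemma coroot_act (w : D.W) (i : ι) (x : V₀) :
    D.P.coroot' (D.P.weylGroupToPerm w i) (D.P.weylGroupRootRep w x) = D.P.coroot' i x := by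
  have h1 := LinearMap.congr_fun (RootPairing.Hom.weight_coweight_transpose_apply D.P D.P
    (D.P.coroot (D.P.weylGroupToPerm w i)) (w : D.P.Aut).toHom) x
  have h2 := RootPairing.Hom.coroot_coweightMap_apply D.P D.P (D.P.weylGroupToPerm w i)
    (w : D.P.Aut).toHom
  rw [h2] at h1
  have h3 : (w : D.P.Aut).toHom.indexEquiv.symm (D.P.weylGroupToPerm w i) = i :=
    (w : D.P.Aut).toHom.indexEquiv.symm_apply_apply i
  rw [h3] at h1
  exact h1

lemma s_conj (w : D.W) (i : ι) : w * D.s i = D.s (D.P.weylGroupToPerm w i) * w := by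
  apply Subtype.ext
  apply RootPairing.Equiv.weightHom_injective
  apply LinearEquiv.ext
  intro x
  have e1 : ∀ (a : D.W) (y : V₀), RootPairing.Equiv.weightHom D.P (a : D.P.Aut) y =
    D.P.weylGroupRootRep a y := fun _ _ => rfl
  have e2 : ∀ (j : ι) (y : V₀), D.P.weylGroupRootRep (D.s j) y = D.P.reflection j y :=
    fun _ _ => rfl
  rw [e1, e1, map_mul, map_mul, Module.End.mul_apply, Module.End.mul_apply, e2, e2,
    RootPairing.reflection_apply, RootPairing.reflection_apply, map_sub, map_smul, coroot_act,
    root_perm]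

lemma exists_coef (c : D.Δ) : ∃ φ : V₀ →ₗ[ℝ] ℝ, φ (D.P.root c) = 1 ∧
    ∀ d : D.Δ, d ≠ c → φ (D.P.root d) = 0 := by
  have h := D.linearIndepOn
  have hli : LinearIndependent ℝ (fun d : D.Δ => D.P.root d) := h
  let b := Module.Basis.span hli
  obtain ⟨φ, hφ⟩ := LinearMap.exists_extend (b.coord c)
  have key : ∀ d : D.Δ, φ (D.P.root d) = b.coord c (b d) := by
    intro d
    rw [← hφ]
    simp [b, Module.Basis.span_apply]
  refine ⟨φ, ?_, ?_⟩
  · rw [key]; simp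
  · intro d hd
    rw [key]; simp [hd]

/-- A linear form taking the value `1` on the simple root `c` and `0` on the other ones. -/
def coef (c : D.Δ) : V₀ →ₗ[ℝ] ℝ := (D.exists_coef c).choose

lemma coef_self (c : D.Δ) : D.coef c (D.P.root c) = 1 := (D.exists_coef c).choose_spec.1

lemma coef_ne (c d : D.Δ) (h : d ≠ c) : D.coef c (D.P.root d) = 0 :=
  (D.exists_coef c).choose_spec.2 d h

lemma coef_nonneg {x : V₀} (hx : x ∈ Submodule.span ℝ≥0 (D.P.root '' D.Δ)) (c : D.Δ) :
    0 ≤ D.coef c x := by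
  induction hx using Submodule.span_induction with
  | mem x h =>
    obtain ⟨d, hd, rfl⟩ := h
    by_cases hc : (⟨d, hd⟩ : D.Δ) = c
    · have := D.coef_self c
      rw [← hc] at this ⊢
      simp [this]
    · rw [D.coef_ne c ⟨d, hd⟩ hc]
  | zero => simp
  | add x y _ _ hx hy => rw [map_add]; exact add_nonneg hx hy
  | smul a x _ hx =>
    rw [NNReal.smul_def, map_smul, smul_eq_mul]
    exact mul_nonneg a.2 hx

lemma eq_sum [Fintype D.Δ] {x : V₀} (hx : x ∈ Submodule.span ℝ≥0 (D.P.root '' D.Δ)) :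
    x = ∑ c : D.Δ, D.coef c x • D.P.root c := by
  classical
  induction hx using Submodule.span_induction with
  | mem x h =>
    obtain ⟨d, hd, rfl⟩ := h
    rw [Finset.sum_eq_single (⟨d, hd⟩ : D.Δ)]
    · have := D.coef_self ⟨d, hd⟩
      simp [this]
    · intro c _ hc
      rw [D.coef_ne c ⟨d, hd⟩ hc.symm, zero_smul]
    · simp
  | zero => simp
  | add x y _ _ hx hy =>
    conv_lhs => rw [hx, hy]
    simp [add_smul, Finset.sum_add_distrib]
  | smul a x _ hx =>
    conv_lhs => rw [hx]
    simp [NNReal.smul_def, Finset.smul_sum, smul_smul]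


section Longest

variable [Finite ι]

lemma eq_smul_simple (b : D.Δ) {x : V₀} (hx : x ∈ Submodule.span ℝ≥0 (D.P.root '' D.Δ))
    (h : ∀ c : D.Δ, c ≠ b → D.coef c x = 0) : x = D.coef b x • D.P.root b := by
  classical
  have := Fintype.ofFinite D.Δ
  conv_lhs => rw [D.eq_sum hx]
  rw [Finset.sum_eq_single b]
  · intro c _ hc
    rw [h c hc, zero_smul]
  · simp

lemma not_pos_neg (i : ι) (h : D.P.root i ∈ Submodule.span ℝ≥0 (D.P.root '' D.Δ))
    (h' : -D.P.root i ∈ Submodule.span ℝ≥0 (D.P.root '' D.Δ)) : False := by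
  have := Fintype.ofFinite D.Δ
  apply D.P.ne_zero i
  rw [D.eq_sum h]
  refine Finset.sum_eq_zero fun c _ => ?_
  have h1 := D.coef_nonneg h c
  have h2 := D.coef_nonneg h' c
  rw [map_neg] at h2
  rw [show D.coef c (D.P.root i) = 0 by linarith, zero_smul]

/-- A positive root which is a multiple of a simple root is that simple root. -/
lemma eq_simple (b : D.Δ) {i : ι} (hi : D.IsPos i)
    (h : ∀ c : D.Δ, c ≠ b → D.coef c (D.P.root i) = 0) : i = b := by
  have h1 := D.eq_smul_simple b hi h
  have hnl : ¬ LinearIndependent ℝ ![D.P.root i, D.P.root b] := by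
    intro hl
    rw [LinearIndependent.pair_iff] at hl
    have := hl (-1) (D.coef b (D.P.root i)) (by
      rw [← h1]; simp)
    simp at this
  have hb : D.P.root b ∈ Submodule.span ℝ≥0 (D.P.root '' D.Δ) :=
    Submodule.subset_span ⟨b, b.2, rfl⟩
  rcases D.isReduced.eq_or_eq_neg _ _ hnl with h2 | h2
  · exact D.P.root.injective h2
  · exfalso
    refine D.not_pos_neg b hb ?_
    rw [← h2]; exact hi

/-- A simple reflection permutes the positive roots other than its own root. -/
lemma pos_reflection (b : D.Δ) {i : ι} (hi : D.IsPos i) (hib : i ≠ b) :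
    D.IsPos (D.P.reflectionPerm b i) := by
  have : ∃ c : D.Δ, c ≠ b ∧ D.coef c (D.P.root i) ≠ 0 := by
    by_contra hcon
    push Not at hcon
    exact hib (D.eq_simple b hi hcon)
  obtain ⟨c, hcb, hc⟩ := this
  rcases D.mem_or_neg_mem (D.P.reflectionPerm b i) with h | h
  · exact h
  · exfalso
    have h2 := D.coef_nonneg h c
    have h3 := D.coef_nonneg hi c
    rw [map_neg, RootPairing.root_reflectionPerm, RootPairing.reflection_apply, map_sub, map_smul,
      D.coef_ne c b hcb.symm] at h2
    simp at h2
    exact hc (le_antisymm h2 h3)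

lemma exists_longest : ∃ w : D.W, ∀ i, D.IsPos i → ¬ D.IsPos (D.P.weylGroupToPerm w i) := by
  classical
  have := Fintype.ofFinite ι
  let M : D.W → Finset ι := fun w =>
    Finset.univ.filter fun i => D.IsPos i ∧ ¬ D.IsPos (D.P.weylGroupToPerm w i)
  have hbd : BddAbove (Set.range fun w => (M w).card) :=
    ⟨Fintype.card ι, by rintro _ ⟨w, rfl⟩; exact Finset.card_le_univ _⟩
  obtain ⟨w, hw⟩ := Nat.sSup_mem (Set.range_nonempty fun w : D.W => (M w).card) hbd
  have hmax : ∀ w', (M w').card ≤ (M w).card := fun w' => by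
    have : (M w').card ≤ sSup (Set.range fun w => (M w).card) := le_csSup hbd ⟨w', rfl⟩
    simpa [← hw] using this
  have hroot : ∀ (g : D.W) (i : ι), D.P.root (D.P.weylGroupToPerm g i) = g • D.P.root i :=
    fun g i => (D.P.weylGroup_apply_root g i).symm
  have hs : ∀ (b i : ι), D.P.weylGroupToPerm (D.s b) i = D.P.reflectionPerm b i := by
    intro b i
    apply D.P.root.injective
    rw [hroot, RootPairing.root_reflectionPerm]
    rfl
  have hneg : ∀ b : D.Δ, ¬ D.IsPos (D.P.weylGroupToPerm w b) := by
    intro b hb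
    have hbpos : D.IsPos (b : ι) := Submodule.subset_span ⟨b, b.2, rfl⟩
    have hsub : insert (b : ι) ((M w).image (D.P.reflectionPerm b)) ⊆ M (w * D.s b) := by
      intro i hi
      rw [Finset.mem_insert, Finset.mem_image] at hi
      rcases hi with rfl | ⟨j, hj, rfl⟩
      · refine Finset.mem_filter.2 ⟨Finset.mem_univ _, hbpos, fun h => ?_⟩
        refine D.not_pos_neg _ hb ?_
        unfold IsPos at h
        rw [hroot, mul_smul] at h
        have : D.s (b : ι) • D.P.root b = - D.P.root b := D.P.reflection_apply_self b
        rw [this, smul_neg, ← hroot] at h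
        exact h
      · rw [Finset.mem_filter] at hj
        have hjb : j ≠ b := by
          rintro rfl
          exact hj.2.2 hb
        refine Finset.mem_filter.2 ⟨Finset.mem_univ _, D.pos_reflection b hj.2.1 hjb, ?_⟩
        rw [map_mul, Equiv.Perm.mul_apply, hs, RootPairing.reflectionPerm_self]
        exact hj.2.2
    have hnot : (b : ι) ∉ (M w).image (D.P.reflectionPerm b) := by
      intro h
      obtain ⟨j, hj, hjb⟩ := Finset.mem_image.1 h
      rw [Finset.mem_filter] at hj
      have : D.P.root j = - D.P.root b := by
        have := congrArg (D.P.reflection b) (congrArg D.P.root hjb)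
        rwa [RootPairing.root_reflectionPerm, RootPairing.reflection_same,
          RootPairing.reflection_apply_self] at this
      refine D.not_pos_neg b hbpos ?_
      rw [← this]; exact hj.2.1
    have := Finset.card_le_card hsub
    rw [Finset.card_insert_of_notMem hnot,
      Finset.card_image_of_injective _ (D.P.reflectionPerm b).injective] at this
    have := hmax (w * D.s b)
    omega
  refine ⟨w, fun i hi hpos => ?_⟩
  have key : ∀ x ∈ Submodule.span ℝ≥0 (D.P.root '' D.Δ),
      -(w • x) ∈ Submodule.span ℝ≥0 (D.P.root '' D.Δ) := by
    intro x hx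
    induction hx using Submodule.span_induction with
    | mem x h =>
      obtain ⟨d, hd, rfl⟩ := h
      rw [← hroot]
      exact (D.mem_or_neg_mem _).resolve_left (hneg ⟨d, hd⟩)
    | zero => simp
    | add x y _ _ hx hy => rw [smul_add, neg_add]; exact add_mem hx hy
    | smul a x _ hx =>
      have : w • (a • x) = a • (w • x) := by
        rw [NNReal.smul_def, NNReal.smul_def]
        exact smul_comm (w : D.P.Aut) (a : ℝ) x
      rw [this, ← smul_neg]
      exact Submodule.smul_mem _ a hx
  refine D.not_pos_neg _ hpos ?_
  rw [hroot]
  exact key _ hi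

/-- The longest element of `W`: it sends every positive root to a negative one. -/
def w₀ : D.W := D.exists_longest.choose

lemma w₀_neg (i : ι) (hi : D.IsPos i) : ¬ D.IsPos (D.P.weylGroupToPerm D.w₀ i) :=
  D.exists_longest.choose_spec i hi

/-- `-w₀` permutes the simple roots. -/
lemma exists_w₀_simple (b : D.Δ) :
    ∃ c : D.Δ, D.P.root c = - D.P.weylGroupRootRep D.w₀ (D.P.root b) := by
  classical
  have := Fintype.ofFinite D.Δ
  set w := D.w₀ with hw
  have hbpos : D.IsPos (b : ι) := Submodule.subset_span ⟨b, b.2, rfl⟩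
  have hinv : ∀ x : V₀, D.P.weylGroupRootRep w (D.P.weylGroupRootRep w⁻¹ x) = x := by
    intro x
    rw [← Module.End.mul_apply, ← map_mul, mul_inv_cancel, map_one, Module.End.one_apply]
  have hinv' : ∀ x : V₀, D.P.weylGroupRootRep w⁻¹ (D.P.weylGroupRootRep w x) = x := by
    intro x
    rw [← Module.End.mul_apply, ← map_mul, inv_mul_cancel, map_one, Module.End.one_apply]
  have hj : -D.P.weylGroupRootRep w (D.P.root b) ∈ Submodule.span ℝ≥0 (D.P.root '' D.Δ) := by
    rw [← root_perm]
    exact (D.mem_or_neg_mem _).resolve_left (D.w₀_neg b hbpos)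
  have hinvneg : ∀ c : D.Δ,
      -D.P.weylGroupRootRep w⁻¹ (D.P.root c) ∈ Submodule.span ℝ≥0 (D.P.root '' D.Δ) := by
    intro c
    rw [← root_perm]
    refine (D.mem_or_neg_mem _).resolve_left fun h => D.w₀_neg _ h ?_
    unfold IsPos
    rw [root_perm, root_perm, ← hw, hinv]
    exact Submodule.subset_span ⟨c, c.2, rfl⟩
  have hsum := D.eq_sum hj
  have hne : ∃ c : D.Δ, D.coef c (-D.P.weylGroupRootRep w (D.P.root b)) ≠ 0 := by
    by_contra hcon
    push Not at hcon
    apply D.P.ne_zero (b : ι)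
    rw [Finset.sum_eq_zero (fun c _ => by rw [hcon c, zero_smul])] at hsum
    rw [← hinv' (D.P.root b), neg_eq_zero.1 hsum, map_zero]
  obtain ⟨c, hc⟩ := hne
  refine ⟨c, ?_⟩
  have hb : D.P.root b = ∑ c : D.Δ, D.coef c (-D.P.weylGroupRootRep w (D.P.root b)) •
      (-D.P.weylGroupRootRep w⁻¹ (D.P.root c)) := by
    have := congrArg (fun x => -D.P.weylGroupRootRep w⁻¹ x) hsum
    simp only [map_neg, neg_neg, hinv', map_sum, map_smul] at this
    refine this.trans ?_
    simp [Finset.sum_neg_distrib]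
  have hzero : ∀ d : D.Δ, d ≠ b → D.coef d (-D.P.weylGroupRootRep w⁻¹ (D.P.root c)) = 0 := by
    intro d hd
    have h0 := congrArg (D.coef d) hb
    rw [D.coef_ne d b hd.symm, map_sum] at h0
    have h1 := (Finset.sum_eq_zero_iff_of_nonneg (fun e _ => by
      rw [map_smul, smul_eq_mul]
      exact mul_nonneg (D.coef_nonneg hj e) (D.coef_nonneg (hinvneg e) d))).1 h0.symm c
      (Finset.mem_univ _)
    rw [map_smul, smul_eq_mul] at h1
    exact (mul_eq_zero.1 h1).resolve_left hc
  have hidx : ∃ i, D.P.root i = -D.P.weylGroupRootRep w⁻¹ (D.P.root c) :=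
    ⟨D.P.reflectionPerm (D.P.weylGroupToPerm w⁻¹ c) (D.P.weylGroupToPerm w⁻¹ c), by
      rw [RootPairing.root_reflectionPerm, RootPairing.reflection_apply_self, root_perm]⟩
  obtain ⟨i, hi⟩ := hidx
  have hib : i = b := D.eq_simple b (by unfold IsPos; rw [hi]; exact hinvneg c)
    (by rw [hi]; exact hzero)
  rw [← hib, hi, map_neg, hinv, neg_neg]

end Longest


section Algebra
/-- The defining relations of the graded affine Hecke algebra in the generators `t_w` (`w ∈ W`) and
`v ∈ V`: the `t_w` multiply as in `W`, the map `V → ℍ` is linear with commuting values, and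
`t_{s_α} v - s_α(v) t_{s_α} = k_α ⟨v, α^∨⟩` for every simple root `α`. -/
inductive Rel : FreeAlgebra ℂ (D.W ⊕ D.VC) → FreeAlgebra ℂ (D.W ⊕ D.VC) → Prop
  | t_one : Rel (FreeAlgebra.ι ℂ (Sum.inl 1)) 1
  | t_mul (w w' : D.W) : Rel (FreeAlgebra.ι ℂ (Sum.inl (w * w')))
      (FreeAlgebra.ι ℂ (Sum.inl w) * FreeAlgebra.ι ℂ (Sum.inl w'))
  | f_add (v v' : D.VC) : Rel (FreeAlgebra.ι ℂ (Sum.inr (v + v')))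
      (FreeAlgebra.ι ℂ (Sum.inr v) + FreeAlgebra.ι ℂ (Sum.inr v'))
  | f_smul (c : ℂ) (v : D.VC) : Rel (FreeAlgebra.ι ℂ (Sum.inr (c • v)))
      (c • FreeAlgebra.ι ℂ (Sum.inr v))
  | f_comm (v v' : D.VC) : Rel (FreeAlgebra.ι ℂ (Sum.inr v) * FreeAlgebra.ι ℂ (Sum.inr v'))
      (FreeAlgebra.ι ℂ (Sum.inr v') * FreeAlgebra.ι ℂ (Sum.inr v))
  | cross (a : D.Δ) (v : D.VC) : Rel
      (FreeAlgebra.ι ℂ (Sum.inl (D.s a)) * FreeAlgebra.ι ℂ (Sum.inr v) -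
        FreeAlgebra.ι ℂ (Sum.inr (D.act (D.s a) v)) * FreeAlgebra.ι ℂ (Sum.inl (D.s a)))
      (algebraMap ℂ _ (D.k a * D.cpair a v))

/-- The graded affine Hecke algebra `ℍ` over `ℂ`. -/
def H : Type u := RingQuot D.Rel

instance : Ring D.H := inferInstanceAs (Ring (RingQuot D.Rel))
instance : Algebra ℂ D.H := inferInstanceAs (Algebra ℂ (RingQuot D.Rel))

/-- The projection from the free algebra. -/
def toH : FreeAlgebra ℂ (D.W ⊕ D.VC) →ₐ[ℂ] D.H := RingQuot.mkAlgHom ℂ D.Rel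

/-- The generator `t_w`. -/
def t (w : D.W) : D.H := D.toH (FreeAlgebra.ι ℂ (Sum.inl w))

lemma t_one : D.t 1 = 1 := by
  have := RingQuot.mkAlgHom_rel ℂ (Rel.t_one (D := D))
  rwa [map_one] at this

lemma t_mul (w w' : D.W) : D.t (w * w') = D.t w * D.t w' := by
  have := RingQuot.mkAlgHom_rel ℂ (Rel.t_mul (D := D) w w')
  rwa [map_mul] at this

/-- The generators `v ∈ V`. -/
def f : D.VC →ₗ[ℂ] D.H where
  toFun v := D.toH (FreeAlgebra.ι ℂ (Sum.inr v))
  map_add' v v' := by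
    have := RingQuot.mkAlgHom_rel ℂ (Rel.f_add (D := D) v v')
    rwa [map_add] at this
  map_smul' c v := by
    have := RingQuot.mkAlgHom_rel ℂ (Rel.f_smul (D := D) c v)
    rw [map_smul] at this
    exact this

lemma f_comm (v v' : D.VC) : D.f v * D.f v' = D.f v' * D.f v := by
  have := RingQuot.mkAlgHom_rel ℂ (Rel.f_comm (D := D) v v')
  rwa [map_mul, map_mul] at this

lemma cross (a : D.Δ) (v : D.VC) :
    D.t (D.s a) * D.f v - D.f (D.act (D.s a) v) * D.t (D.s a) =
      algebraMap ℂ D.H (D.k a * D.cpair a v) := by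
  have := RingQuot.mkAlgHom_rel ℂ (Rel.cross (D := D) a v)
  rw [map_sub, map_mul, map_mul, AlgHom.commutes] at this
  exact this

variable {D} in
/-- The universal property of `ℍ`. -/
def lift {A : Type*} [Ring A] [Algebra ℂ A] (T : D.W → A) (F : D.VC →ₗ[ℂ] A)
    (h1 : T 1 = 1) (hmul : ∀ w w', T (w * w') = T w * T w')
    (hcomm : ∀ v v', F v * F v' = F v' * F v)
    (hcross : ∀ (a : D.Δ) (v : D.VC), T (D.s a) * F v - F (D.act (D.s a) v) * T (D.s a) =
      algebraMap ℂ A (D.k a * D.cpair a v)) : D.H →ₐ[ℂ] A :=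
  RingQuot.liftAlgHom ℂ ⟨FreeAlgebra.lift ℂ (Sum.elim T F), by
    intro x y h
    induction h with
    | t_one => simpa using h1
    | t_mul w w' => simpa using hmul w w'
    | f_add v v' => simp
    | f_smul c v => simp
    | f_comm v v' => simpa using hcomm v v'
    | cross a v =>
      rw [AlgHom.commutes, map_sub, map_mul, map_mul]
      simpa using hcross a v⟩

variable {D} in
lemma lift_t {A : Type*} [Ring A] [Algebra ℂ A] (T : D.W → A) (F : D.VC →ₗ[ℂ] A)
    (h1 hmul hcomm hcross) (w : D.W) :
    lift T F h1 hmul hcomm hcross (D.t w) = T w := by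
  exact (RingQuot.liftAlgHom_mkAlgHom_apply ℂ _ _ _).trans (by simp)

variable {D} in
lemma lift_f {A : Type*} [Ring A] [Algebra ℂ A] (T : D.W → A) (F : D.VC →ₗ[ℂ] A)
    (h1 hmul hcomm hcross) (v : D.VC) :
    lift T F h1 hmul hcomm hcross (D.f v) = F v := by
  exact (RingQuot.liftAlgHom_mkAlgHom_apply ℂ _ _ _).trans (by simp)

lemma act_mul (w w' : D.W) (v : D.VC) : D.act (w * w') v = D.act w (D.act w' v) := by
  unfold act
  rw [map_mul, Module.End.mul_eq_comp, LinearMap.baseChange_comp]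
  rfl

lemma act_one (v : D.VC) : D.act 1 v = v := by
  unfold act
  rw [map_one, Module.End.one_eq_id, LinearMap.baseChange_id]
  rfl

lemma s_mul_s (i : ι) : D.s i * D.s i = 1 := by
  apply Subtype.ext
  have := RootPairing.Equiv.reflection_inv D.P i
  rw [inv_eq_iff_mul_eq_one] at this
  exact this

lemma s_inv (i : ι) : (D.s i)⁻¹ = D.s i := inv_eq_of_mul_eq_one_right (D.s_mul_s i)

lemma cpair_act (w : D.W) (i : ι) (v : D.VC) :
    D.cpair (D.P.weylGroupToPerm w i) (D.act w v) = D.cpair i v := by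
  induction v using TensorProduct.induction_on with
  | zero => simp
  | add x y hx hy => simp only [map_add, hx, hy]
  | tmul c x =>
    simp only [cpair, act, LinearMap.baseChange_tmul, Module.Dual.baseChange_apply_tmul]
    rw [coroot_act]

lemma cpair_s (i : ι) (v : D.VC) : D.cpair i (D.act (D.s i) v) = - D.cpair i v := by
  induction v using TensorProduct.induction_on with
  | zero => simp
  | add x y hx hy => simp only [map_add, hx, hy, neg_add]
  | tmul c x =>
    simp only [cpair, act, LinearMap.baseChange_tmul, Module.Dual.baseChange_apply_tmul]
    have : D.P.weylGroupRootRep (D.s i) x = D.P.reflection i x := rfl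
    rw [this, RootPairing.reflection_apply, map_sub, map_smul]
    simp
    ring

lemma sgn_s (i : ι) [FiniteDimensional ℝ V₀] : D.sgn (D.s i) = -1 := by
  have : D.P.weylGroupRootRep (D.s i) = LinearMap.transvection (-(D.P.coroot' i)) (D.P.root i) := by
    ext x
    have : D.P.weylGroupRootRep (D.s i) x = D.P.reflection i x := rfl
    rw [this, RootPairing.reflection_apply, LinearMap.transvection.apply]
    simp [sub_eq_add_neg]
  rw [sgn, this, LinearMap.transvection.det]
  simp
  norm_num

variable [FiniteDimensional ℝ V₀]

/-- The Iwahori–Matsumoto involution `ι` of `ℍ`: `t_w ↦ sgn(w) t_w` and `v ↦ -v`. -/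
def imInv : D.H →ₐ[ℂ] D.H :=
  lift (fun w => D.sgn w • D.t w) (-D.f)
    (by simp [sgn, t_one])
    (by intro w w'; simp only [sgn, t_mul, map_mul, Complex.ofReal_mul, smul_mul_smul_comm])
    (by intro v v'; simpa using D.f_comm v v')
    (by
      intro a v
      rw [D.sgn_s, ← D.cross a v]
      simp)

/-- The linear anti-involution `•` of `ℍ`: `t_w ↦ t_w⁻¹` and `v ↦ v`. -/
def bullet : D.H →ₐ[ℂ] D.Hᵐᵒᵖ :=
  lift (fun w => MulOpposite.op (D.t w⁻¹))
    ((MulOpposite.opLinearEquiv ℂ).toLinearMap ∘ₗ D.f)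
    (by simp [t_one])
    (by intro w w'; simp [t_mul])
    (by intro v v'; simpa [← MulOpposite.op_mul] using D.f_comm v' v)
    (by
      intro a v
      apply MulOpposite.unop_injective
      have := D.cross a (D.act (D.s a) v)
      rw [← act_mul, s_mul_s, act_one, cpair_s, mul_neg, map_neg] at this
      simp only [LinearMap.coe_comp, Function.comp_apply, LinearEquiv.coe_coe,
        MulOpposite.coe_opLinearEquiv, MulOpposite.unop_sub, MulOpposite.unop_mul,
        MulOpposite.unop_op, s_inv, MulOpposite.algebraMap_apply]
      rw [← neg_eq_iff_eq_neg.2 this]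
      abel)

/-- The linear anti-involution `*` of `ℍ`: `t_w ↦ t_w⁻¹` and
`v ↦ t_{w₀}⁻¹ (-w₀ v) t_{w₀}`, where `w₀ = w₀⁻¹` is the longest element of `W`. -/
def star [Finite ι] : D.H →ₐ[ℂ] D.Hᵐᵒᵖ :=
  lift (fun w => MulOpposite.op (D.t w⁻¹))
    { toFun := fun v => MulOpposite.op (D.t D.w₀⁻¹ * D.f (-D.act D.w₀ v) * D.t D.w₀)
      map_add' := by
        intro v v'
        simp only [map_add, neg_add, mul_add, add_mul, MulOpposite.op_add]
      map_smul' := by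
        intro c v
        simp only [map_smul, ← smul_neg, mul_smul_comm, smul_mul_assoc, MulOpposite.op_smul,
          RingHom.id_apply] }
    (by simp [t_one])
    (by intro w w'; simp [t_mul])
    (by
      intro v v'
      apply MulOpposite.unop_injective
      have h : ∀ x y : D.H, D.t D.w₀⁻¹ * x * D.t D.w₀ * (D.t D.w₀⁻¹ * y * D.t D.w₀) =
          D.t D.w₀⁻¹ * (x * y) * D.t D.w₀ := by
        intro x y
        have h1 : D.t D.w₀ * D.t D.w₀⁻¹ = 1 := by rw [← t_mul, mul_inv_cancel, t_one]
        calc _ = D.t D.w₀⁻¹ * x * (D.t D.w₀ * D.t D.w₀⁻¹) * y * D.t D.w₀ := by noncomm_ring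
          _ = _ := by rw [h1]; noncomm_ring
      simp only [LinearMap.coe_mk, AddHom.coe_mk, MulOpposite.unop_mul, MulOpposite.unop_op, h]
      rw [f_comm])
    (by
      intro a v
      obtain ⟨c, hc⟩ := D.exists_w₀_simple a
      apply MulOpposite.unop_injective
      have hk : D.k c = D.k a := by
        refine (D.k_eq a c ⟨D.w₀ * D.s a, ?_⟩).symm
        rw [hc, mul_smul]
        have : D.s (a : ι) • D.P.root a = - D.P.root a := D.P.reflection_apply_self a
        rw [this, smul_neg]
        rfl
      have hcj : (c : ι) = D.P.reflectionPerm (D.P.weylGroupToPerm D.w₀ a)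
          (D.P.weylGroupToPerm D.w₀ a) := by
        apply D.P.root.injective
        rw [RootPairing.root_reflectionPerm, RootPairing.reflection_apply_self, root_perm, hc]
      have hcor : D.P.coroot c = -D.P.coroot (D.P.weylGroupToPerm D.w₀ a) := by
        rw [hcj, RootPairing.coroot_reflectionPerm, RootPairing.coreflection_apply_self]
      have hcr : ∀ x : V₀, D.P.coroot' c x = -D.P.coroot' (D.P.weylGroupToPerm D.w₀ a) x := by
        intro x
        rw [RootPairing.coroot', hcor, map_neg]
        rfl
      have hs : D.s c = D.s (D.P.weylGroupToPerm D.w₀ a) := by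
        apply Subtype.ext
        apply RootPairing.Equiv.weightHom_injective
        apply LinearEquiv.ext
        intro x
        have e2 : ∀ (j : ι) (y : V₀), RootPairing.Equiv.weightHom D.P (D.s j : D.P.Aut) y =
          D.P.reflection j y := fun _ _ => rfl
        rw [e2, e2, RootPairing.reflection_apply, RootPairing.reflection_apply, hcr, hc,
          root_perm, smul_neg, neg_smul, neg_neg]
      have hp : ∀ v, D.cpair c (D.act D.w₀ v) = - D.cpair a v := by
        intro v
        rw [← D.cpair_act D.w₀ a v]
        generalize D.act D.w₀ v = u
        induction u using TensorProduct.induction_on with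
        | zero => simp
        | add x y hx hy => simp only [map_add, hx, hy, neg_add]
        | tmul r x =>
          simp only [cpair, Module.Dual.baseChange_apply_tmul]
          rw [hcr, neg_smul]
      have hconj : D.t D.w₀ * D.t (D.s a) = D.t (D.s c) * D.t D.w₀ := by
        rw [← t_mul, s_conj, ← hs, t_mul]
      have hconj' : D.t (D.s a) * D.t D.w₀⁻¹ = D.t D.w₀⁻¹ * D.t (D.s c) := by
        have : D.s a * D.w₀⁻¹ = D.w₀⁻¹ * D.s c := by
          rw [hs, eq_inv_mul_iff_mul_eq, ← mul_assoc, D.s_conj, mul_assoc, mul_inv_cancel, mul_one]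
        rw [← t_mul, ← t_mul, this]
      have hact : D.act D.w₀ (D.act (D.s a) v) = D.act (D.s c) (D.act D.w₀ v) := by
        rw [← act_mul, ← act_mul, s_conj, hs]
      have hx := D.cross c (D.act (D.s c) (D.act D.w₀ v))
      have hss : ∀ u, D.act (D.s c) (D.act (D.s c) u) = u := by
        intro u
        rw [← act_mul, s_mul_s, act_one]
      rw [hss, cpair_s, hp, neg_neg, hk] at hx
      have h1 : D.t D.w₀⁻¹ * D.t D.w₀ = 1 := by rw [← t_mul, inv_mul_cancel, t_one]
      simp only [LinearMap.coe_mk, AddHom.coe_mk, MulOpposite.unop_sub, MulOpposite.unop_mul,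
        MulOpposite.unop_op, s_inv, MulOpposite.algebraMap_apply, hact, map_neg]
      calc _ = D.t (D.s a) * D.t D.w₀⁻¹ * D.f (D.act (D.s c) (D.act D.w₀ v)) * D.t D.w₀
            - D.t D.w₀⁻¹ * D.f (D.act D.w₀ v) * (D.t D.w₀ * D.t (D.s a)) := by noncomm_ring
        _ = D.t D.w₀⁻¹ * (D.t (D.s c) * D.f (D.act (D.s c) (D.act D.w₀ v))
            - D.f (D.act D.w₀ v) * D.t (D.s c)) * D.t D.w₀ := by
          rw [hconj, hconj']; noncomm_ring
        _ = algebraMap ℂ D.H (D.k a * D.cpair a v) := by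
          rw [hx, ← Algebra.commutes, mul_assoc, h1, mul_one])

end Algebra

section Duals

variable (φ : D.H →ₐ[ℂ] D.Hᵐᵒᵖ) (X : ModuleCat.{u} D.H)

/-- The space of linear functionals on `X`, on which `h ∈ ℍ` acts by `(h p)(x) = p(φ(h) x)` for an
anti-homomorphism `φ` of `ℍ`. -/
def TwistedDual (_ : D.H →ₐ[ℂ] D.Hᵐᵒᵖ) (X : ModuleCat.{u} D.H) : Type u := Module.Dual ℂ X

instance : AddCommGroup (D.TwistedDual φ X) := inferInstanceAs (AddCommGroup (Module.Dual ℂ X))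

/-- Evaluation of an element of the twisted dual at a vector of `X`. -/
def evalHom : D.TwistedDual φ X →+ X →ₗ[ℂ] ℂ := AddMonoidHom.id (Module.Dual ℂ X)

instance : Module D.H (D.TwistedDual φ X) where
  smul h p := (D.evalHom φ X p ∘ₗ Module.toModuleEnd ℂ (S := D.H) X (MulOpposite.unop (φ h)) :)
  one_smul p := LinearMap.ext fun x => by
    change D.evalHom φ X p (MulOpposite.unop (φ 1) • x) = D.evalHom φ X p x
    simp
  mul_smul h h' p := LinearMap.ext fun x => by
    change D.evalHom φ X p (MulOpposite.unop (φ (h * h')) • x) =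
      D.evalHom φ X p (MulOpposite.unop (φ h') • MulOpposite.unop (φ h) • x)
    rw [map_mul, MulOpposite.unop_mul, mul_smul]
  smul_zero h := LinearMap.ext fun x => rfl
  smul_add h p q := LinearMap.ext fun x => rfl
  add_smul h h' p := LinearMap.ext fun x => by
    change D.evalHom φ X p (MulOpposite.unop (φ (h + h')) • x) =
      D.evalHom φ X p (MulOpposite.unop (φ h) • x) + D.evalHom φ X p (MulOpposite.unop (φ h') • x)
    rw [map_add, MulOpposite.unop_add, add_smul, map_add]
  zero_smul p := LinearMap.ext fun x => by
    change D.evalHom φ X p (MulOpposite.unop (φ 0) • x) = 0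
    simp

/-- The dual module of `X` with respect to the anti-homomorphism `φ` of `ℍ`. -/
def dual : ModuleCat.{u} D.H := ModuleCat.of D.H (D.TwistedDual φ X)

/-- The natural pairing between the twisted dual of `X` and `X`. -/
def ev : D.dual φ X →ₗ[ℂ] X →ₗ[ℂ] ℂ where
  toFun p := D.evalHom φ X p
  map_add' p q := map_add (D.evalHom φ X) p q
  map_smul' c p := LinearMap.ext fun x => by
    change D.evalHom φ X p (MulOpposite.unop (φ (algebraMap ℂ D.H c)) • x) =
      c • D.evalHom φ X p x
    rw [AlgHom.commutes, MulOpposite.algebraMap_apply, MulOpposite.unop_op, algebraMap_smul,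
      map_smul]

/-- A linear functional on `X`, as an element of the twisted dual. -/
def ofFunctional (p : X →ₗ[ℂ] ℂ) : D.dual φ X := show D.TwistedDual φ X from p

lemma ev_smul (h : D.H) (p : D.dual φ X) (x : X) :
    D.ev φ X (h • p) x = D.ev φ X p (MulOpposite.unop (φ h) • x) := rfl

lemma ev_ofFunctional (p : X →ₗ[ℂ] ℂ) : D.ev φ X (D.ofFunctional φ X p) = p := rfl

variable [FiniteDimensional ℝ V₀]

/-- `ι(X)`: the module `X` on which `h` acts through `ι(h)`. -/
def twist : ModuleCat.{u} D.H := (ModuleCat.restrictScalars D.imInv.toRingHom).obj X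

/-- The identity map, as a linear map from `X` to its twist `ι(X)`. -/
def toTwist : X →ₗ[ℂ] D.twist X where
  toFun x := (show (ModuleCat.restrictScalars D.imInv.toRingHom).obj X from x)
  map_add' _ _ := rfl
  map_smul' c x := by
    change algebraMap ℂ D.H c • x = D.imInv (algebraMap ℂ D.H c) • x
    rw [AlgHom.commutes]

lemma smul_toTwist (h : D.H) (x : X) : h • D.toTwist X x = D.toTwist X (D.imInv h • x) := rfl

/-- The `•`-dual `X^•` of `X`. -/
def bulletDual : ModuleCat.{u} D.H := D.dual D.bullet X

/-- The evaluation pairing `(y, g) ↦ g(y)` of `Y` with `ι(Y)^•`. -/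
def contract (Y : ModuleCat.{u} D.H) : Y →ₗ[ℂ] D.bulletDual (D.twist Y) →ₗ[ℂ] ℂ :=
  (D.ev D.bullet (D.twist Y)).flip ∘ₗ D.toTwist Y

variable [Finite ι]

/-- The `*`-dual `X^*` of `X`. -/
def starDual : ModuleCat.{u} D.H := D.dual D.star X

/-- The dualizing module `𝔻(X) = ι(X^•)^*`. -/
def dualizing : ModuleCat.{u} D.H := D.starDual (D.twist (D.bulletDual X))

end Duals

section Koszul

/-- The space `Hom_ℂ(X ⊗ ⋀ⁱV, Y)`. -/
abbrev Cochain (i : ℕ) (X Y : ModuleCat.{u} D.H) : Type u :=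
  X →ₗ[ℂ] (D.VC [⋀^Fin i]→ₗ[ℂ] Y)

variable {D}

/-- `η ∈ Hom_W(X ⊗ ⋀ⁱV, Y)`; by Frobenius reciprocity such `η` are the `ℍ`-linear maps
`ℍ ⊗_{ℂ[W]} (X ⊗ ⋀ⁱV) → Y`. -/
def IsEquivariant {i : ℕ} {X Y : ModuleCat.{u} D.H} (η : D.Cochain i X Y) : Prop :=
  ∀ (w : D.W) (x : X) (v : Fin i → D.VC),
    η (D.t w • x) (fun a => D.act w (v a)) = D.t w • η x v

/-- The differential of the Koszul complex: the composite of (the `ℍ`-linear extension of) `η` with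
`1 ⊗ x ⊗ v₀ ∧ ⋯ ∧ vᵢ ↦ ∑ₐ (-1)ᵃ (vₐ ⊗ x - 1 ⊗ vₐ x) ⊗ v₀ ∧ ⋯ v̂ₐ ⋯ ∧ vᵢ`. -/
def koszulD {i : ℕ} {X Y : ModuleCat.{u} D.H} (η : D.Cochain i X Y) (x : X)
    (v : Fin (i + 1) → D.VC) : Y :=
  ∑ a : Fin (i + 1), (-1 : ℤ) ^ (a : ℕ) •
    (D.f (v a) • η x (fun b => v (a.succAbove b)) - η (D.f (v a) • x) (fun b => v (a.succAbove b)))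

/-- `η` is a cocycle of the complex `Hom_W(X ⊗ ⋀^• V, Y)`. -/
structure IsCocycle {i : ℕ} {X Y : ModuleCat.{u} D.H} (η : D.Cochain i X Y) : Prop where
  equivariant : IsEquivariant η
  d_eq_zero : ∀ (x : X) (v : Fin (i + 1) → D.VC), koszulD η x v = 0

/-- A chain map from the Koszul resolution `ℍ ⊗_{ℂ[W]} (X ⊗ ⋀^• V) → X` to a projective resolution
of `X` which lifts the identity of `X`, described by its restrictions to `1 ⊗ X ⊗ ⋀^• V`. -/
structure KoszulLift {X : ModuleCat.{u} D.H} (R : ProjectiveResolution X) where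
  app (i : ℕ) : D.Cochain i X (R.complex.X i)
  equivariant (i : ℕ) : IsEquivariant (app i)
  d_app (i : ℕ) (x : X) (v : Fin (i + 1) → D.VC) :
    R.complex.d (i + 1) i (app (i + 1) x v) = koszulD (app i) x v
  π_app (x : X) (v : Fin 0 → D.VC) :
    (R.π.f 0 ≫ (HomologicalComplex.singleObjXSelf (ComplexShape.down ℕ) 0 X).hom) (app 0 x v) = x

/-- The cocycle `η` represents the class `c` when `Extⁱ(X, Y)` is computed by the Koszul resolution
of `X`: for some projective resolution `R` of `X`, the class `c` is given by a cocycle `ζ` on `R`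
whose pull-back to the Koszul resolution is `η`. -/
def Represents {i : ℕ} {X Y : ModuleCat.{u} D.H} (η : D.Cochain i X Y)
    (c : Abelian.Ext X Y i) : Prop :=
  IsCocycle η ∧ ∃ (R : ProjectiveResolution X) (F : KoszulLift R) (ζ : R.complex.X i ⟶ Y)
    (hζ : R.complex.d (i + 1) i ≫ ζ = 0),
    R.extMk ζ (i + 1) rfl hζ = c ∧ ∀ (x : X) (v : Fin i → D.VC), η x v = ζ (F.app i x v)

variable [FiniteDimensional ℝ V₀] [Finite ι]

/-- The pairing of `Hom(X ⊗ ⋀ⁱV, Y)` and `Hom(X^* ⊗ ⋀ʲV, ι(Y)^•)`, `i + j = n`, which on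
`(p ⊗ y ⊗ φ, x ⊗ g ⊗ ψ)` takes the value `p(x) g(y) (φ ∧ ψ)(e₁, …, eₙ)`, where `p ∈ X^*`, `y ∈ Y`,
`x ∈ X = (X^*)^*`, `g ∈ ι(Y)^•`, `φ` and `ψ` are alternating forms on `V` of degrees `i` and `j`.
In coordinates it is `∑ᵣ ∑_L ± η'(xᵣ^*; e_{L^c})(η(xᵣ; e_L))`, over a basis `xᵣ` of `X` and the
subsets `L` of `{1, …, n}` of size `i`, with the sign of the shuffle `(L, L^c)`. -/
def cochainPairing {n i j : ℕ} (hij : i + j = n) (e : Fin n → D.VC) {X Y : ModuleCat.{u} D.H}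
    [FiniteDimensional ℂ X] (η : D.Cochain i X Y)
    (η' : D.Cochain j (D.starDual X) (D.bulletDual (D.twist Y))) : ℂ :=
  let b := Module.finBasis ℂ X
  ∑ r, TensorProduct.lift (D.contract Y)
    (((η (b r)).domCoprod (η' (D.ofFunctional D.star X (b.coord r))))
      (fun a => e (Fin.cast hij (finSumFinEquiv a))))

/-- `B` is the duality pairing `Extⁱ(X, Y) × Extʲ(X^*, ι(Y)^•) → ℂ`, `i + j = n`: the non-degenerate
pairing induced on cohomology by `cochainPairing`. -/
structure IsPoincarePairing {n i j : ℕ} (hij : i + j = n) (e : Fin n → D.VC)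
    {X Y : ModuleCat.{u} D.H} [FiniteDimensional ℂ X]
    (B : Abelian.Ext X Y i →ₗ[ℂ]
      Abelian.Ext (D.starDual X) (D.bulletDual (D.twist Y)) j →ₗ[ℂ] ℂ) : Prop where
  exists_left : ∀ a : Abelian.Ext X Y i, ∃ η : D.Cochain i X Y, Represents η a
  exists_right : ∀ b : Abelian.Ext (D.starDual X) (D.bulletDual (D.twist Y)) j,
    ∃ η' : D.Cochain j (D.starDual X) (D.bulletDual (D.twist Y)), Represents η' b
  apply_eq : ∀ (a : Abelian.Ext X Y i)
    (b : Abelian.Ext (D.starDual X) (D.bulletDual (D.twist Y)) j) (η : D.Cochain i X Y)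
    (η' : D.Cochain j (D.starDual X) (D.bulletDual (D.twist Y))),
    Represents η a → Represents η' b → B a b = cochainPairing hij e η η'
  nondegenerate : B.Nondegenerate

/-- The cochain `η'` corresponds to `η` under the identification
`Hom(Y ⊗ ⋀ʲV, 𝔻(X)) = Hom(X^* ⊗ ⋀ʲV, ι(Y)^•)`, `η'(p; v)(y) = η(y; v)(p)`; recall that `X^*`
and `ι(X^•)` are both the space of linear functionals on `X`. -/
def IsTranspose {j : ℕ} {X Y : ModuleCat.{u} D.H} (η : D.Cochain j Y (D.dualizing X))
    (η' : D.Cochain j (D.starDual X) (D.bulletDual (D.twist Y))) : Prop :=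
  ∀ (y : Y) (p : X →ₗ[ℂ] ℂ) (v : Fin j → D.VC),
    D.contract Y y (η' (D.ofFunctional D.star X p) v) =
      D.ev D.star _ (η y v) (D.toTwist _ (D.ofFunctional D.bullet X p))

/-- `T` is the identification `Extʲ(Y, 𝔻(X)) ≅ Extʲ(X^*, ι(Y)^•)` that is induced by transposition
of cochains. -/
structure IsDualIdentification {j : ℕ} {X Y : ModuleCat.{u} D.H}
    (T : Abelian.Ext Y (D.dualizing X) j ≃ₗ[ℂ]
      Abelian.Ext (D.starDual X) (D.bulletDual (D.twist Y)) j) : Prop where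
  exists_transpose : ∀ b : Abelian.Ext Y (D.dualizing X) j,
    ∃ (η : D.Cochain j Y (D.dualizing X))
      (η' : D.Cochain j (D.starDual X) (D.bulletDual (D.twist Y))),
      Represents η b ∧ IsTranspose η η'
  represents : ∀ (b : Abelian.Ext Y (D.dualizing X) j) (η : D.Cochain j Y (D.dualizing X))
    (η' : D.Cochain j (D.starDual X) (D.bulletDual (D.twist Y))),
    Represents η b → IsTranspose η η' → Represents η' (T b)

end Koszul
end HeckeDatum
end

/-!
The theorem is Poincaré duality for the complexes of equivariant cochains `X ⊗ ⋀ⁱV → Y`.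

*Drinfeld generators.* The element `ṽ = v - ½ ∑_{β > 0} k_β ⟨v, β^∨⟩ t_{s_β}` of `ℍ` (`ftil`)
satisfies `t_w ṽ = (w v)~ t_w` (`t_mul_ftil`), and `ṽ^* = -ṽ`, `ṽ^• = ṽ`, `ι(ṽ) = -ṽ`. Hence `ṽ`
acts on `𝔻(X)` as on the bidual of `X`, while `W` acts as on the bidual twisted by `sgn`. On
equivariant cochains the differential may be formed with `ṽ` instead of `v` (`dF_f_eq_dF_ftil`),
since a reflection changes an alternating form by a multiple of the linear form that defines it. The
`ṽ` do not commute with each other, so the square of the differential is computed with the `v`, and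
the behaviour under duality with the `ṽ`.

*Koszul resolution.* Its terms are defined by their universal property, and are projective by
averaging over `W`. For exactness, functions `W → M` on a space `M` with commuting operators are
made an `ℍ`-module `coind` that satisfies Frobenius reciprocity, which yields the part of the
Poincaré–Birkhoff–Witt theorem that is needed. If `M` is the space of functions of multi-indices,
with the shifts as operators, cocycles with values in `coind` are coboundaries (`cogen_acyclic`),
and the maps to `coind` detect membership in submodules (`mem_of_forall_cogen`); both together give
exactness (`koszul_exact`). Therefore `Ext` is the cohomology of equivariant cochains (`cls`,
`represents_iff`), and the Yoneda product is induced by the product of cochains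
(`koszulCls_comp_koszulCls`), which comes from a comparison of Yoneda products with lifts to
projective resolutions (`extMk_comp_extMk`).

*Duality.* The trace of the value of a cochain of degree `n` with values in `𝔻(X)` at the basis `e`
is a `W`-invariant functional `fund e` on cochains: the sign in the action on `𝔻(X)` cancels the
determinant on `⋀ⁿV` (`fund_conjC`). It kills differentials, because traces of commutators with `ṽ`
vanish (`fund_dF`), so it descends to `Extⁿ(X, 𝔻(X))` (`exists_fund_cls`); this is the functional
`𝒟`. Followed by `fund e`, the product of cochains of complementary degrees is a perfect pairing, by
the non-degeneracy of the trace form and of the exterior product (`eq_zero_of_wedge_left`,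
`eq_zero_of_wedge_right`); it stays perfect on equivariant cochains, by averaging over `W`. By the
Leibniz rule the differentials are adjoint up to sign (`equivPair_dEquiv`), so the pairing remains
non-degenerate on cohomology (`cls_eq_zero_of_left`, `cls_eq_zero_of_right`). Transposition of
cochains commutes with the differential formed with `ṽ`, which gives the identification `τ`
(`extTranspose`) and turns the pairing into the duality pairing (`cochainPairing_transposeC`).

This is the third claim. The second one follows, because the duality pairing is non-degenerate and
`τ` is bijective; the first one is the second one for `Y = X` and `i = 0`, applied to the class of
the identity.
-/

noncomputable section

namespace HeckeDatum

variable {ι V₀ N : Type u} [AddCommGroup V₀] [Module ℝ V₀] [AddCommGroup N] [Module ℝ N]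
  (D : HeckeDatum ι V₀ N)

/-! ### The reflection group -/

lemma W_ext {w w' : D.W} (h : ∀ x, D.P.weylGroupRootRep w x = D.P.weylGroupRootRep w' x) :
    w = w' := by
  apply Subtype.ext
  apply RootPairing.Equiv.weightHom_injective
  apply LinearEquiv.ext
  exact h

lemma rootRep_s (i : ι) (x : V₀) :
    D.P.weylGroupRootRep (D.s i) x = x - D.P.coroot' i x • D.P.root i :=
  D.P.reflection_apply i x

lemma toPerm_s (i j : ι) : D.P.weylGroupToPerm (D.s i) j = D.P.reflectionPerm i j := rfl

lemma toPerm_mul (w w' : D.W) (j : ι) :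
    D.P.weylGroupToPerm (w * w') j = D.P.weylGroupToPerm w (D.P.weylGroupToPerm w' j) := by
  rw [map_mul, Equiv.Perm.mul_apply]

/-- The index of the root opposite to the `i`-th root. -/
def negIdx (i : ι) : ι := D.P.reflectionPerm i i

lemma root_negIdx (i : ι) : D.P.root (D.negIdx i) = - D.P.root i := by
  rw [negIdx, RootPairing.root_reflectionPerm, RootPairing.reflection_apply_self]

lemma coroot_negIdx (i : ι) : D.P.coroot (D.negIdx i) = - D.P.coroot i := by
  rw [negIdx, RootPairing.coroot_reflectionPerm, RootPairing.coreflection_apply_self]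

lemma coroot'_negIdx (i : ι) (x : V₀) : D.P.coroot' (D.negIdx i) x = - D.P.coroot' i x := by
  rw [RootPairing.coroot', coroot_negIdx, map_neg]; rfl

lemma s_negIdx (i : ι) : D.s (D.negIdx i) = D.s i := by
  apply D.W_ext
  intro x
  rw [rootRep_s, rootRep_s, coroot'_negIdx, root_negIdx, smul_neg, neg_smul, neg_neg]

lemma toPerm_negIdx (w : D.W) (i : ι) :
    D.P.weylGroupToPerm w (D.negIdx i) = D.negIdx (D.P.weylGroupToPerm w i) := by
  apply D.P.root.injective
  rw [root_perm, root_negIdx, root_negIdx, root_perm, map_neg]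

lemma simple_isPos (b : D.Δ) : D.IsPos b := Submodule.subset_span ⟨b, b.2, rfl⟩

/-- `W` acts trivially modulo the span of the roots. -/
lemma rootRep_sub_mem (w : D.W) (x : V₀) :
    D.P.weylGroupRootRep w x - x ∈ Submodule.span ℝ (Set.range D.P.root) := by
  obtain ⟨w, hw⟩ := w
  revert x
  induction hw using RootPairing.weylGroup.induction with
  | mem i =>
    intro x
    have := D.rootRep_s i x
    change D.P.weylGroupRootRep (D.s i) x - x ∈ _
    rw [this]
    have : x - D.P.coroot' i x • D.P.root i - x = -(D.P.coroot' i x • D.P.root i) := by abel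
    rw [this]
    exact neg_mem (Submodule.smul_mem _ _ (Submodule.subset_span ⟨i, rfl⟩))
  | one =>
    intro x
    change D.P.weylGroupRootRep 1 x - x ∈ _
    simp
  | mul a b ha hb ha' hb' =>
    intro x
    have : D.P.weylGroupRootRep (⟨a * b, mul_mem ha hb⟩ : D.W) x - x =
      (D.P.weylGroupRootRep ⟨a, ha⟩ (D.P.weylGroupRootRep ⟨b, hb⟩ x) -
        D.P.weylGroupRootRep ⟨b, hb⟩ x) + (D.P.weylGroupRootRep ⟨b, hb⟩ x - x) := by
      rw [sub_add_sub_cancel, ← Module.End.mul_apply, ← map_mul]; rfl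
    rw [this]
    exact add_mem (ha' _) (hb' _)

open Classical in
/-- The sign of a root: `1` if it is positive and `-1` if it is negative. -/
def posSign (i : ι) : ℂ := if D.IsPos i then 1 else -1

lemma posSign_simple (a : D.Δ) : D.posSign a = 1 := if_pos (D.simple_isPos a)

section Fin
variable [Fintype ι]

lemma rootForm_self (x : V₀) : D.P.RootForm x x = ∑ i, (D.P.coroot' i x) ^ 2 := by
  rw [RootPairing.rootForm_apply_apply]
  simp [sq]

/-- A vector of the span of the roots that is killed by all coroots vanishes, since the canonical
form is positive definite on this span. -/
lemma eq_zero_of_coroot {x : V₀} (hx : x ∈ Submodule.span ℝ (Set.range D.P.root))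
    (h : ∀ i, D.P.coroot' i x = 0) : x = 0 := by
  by_contra h0
  have := D.P.rootForm_pos_of_ne_zero (x := x) hx h0
  rw [rootForm_self] at this
  simp [h] at this

/-- `W` acts faithfully on the roots, even if they do not span `V₀`: an element that fixes all
coroots moves a vector `x` by an element of the span of the roots which is killed by all coroots. -/
lemma toPerm_injective : Function.Injective D.P.weylGroupToPerm := by
  rw [injective_iff_map_eq_one]
  intro w hw
  apply D.W_ext
  intro x
  rw [map_one, Module.End.one_apply, ← sub_eq_zero]
  apply D.eq_zero_of_coroot (D.rootRep_sub_mem w x)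
  intro i
  have h := D.coroot_act w i x
  rw [hw] at h
  rw [map_sub, sub_eq_zero]
  exact h

instance finite_W : Finite D.W := Finite.of_injective _ D.toPerm_injective

instance fintype_W : Fintype D.W := Fintype.ofFinite _

lemma coroot'_pos_of_rootForm_pos (c i : ι) (h : 0 < D.P.RootForm (D.P.root c) (D.P.root i)) :
    0 < D.P.coroot' c (D.P.root i) := by
  have h1 := D.P.rootForm_self_smul_coroot c
  have h2 := congrArg (fun y => D.P.toLinearMap (D.P.root i) y) h1
  simp only [map_smul, smul_eq_mul] at h2
  have h3 : 0 < D.P.RootForm (D.P.root c) (D.P.root c) :=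
    D.P.rootForm_pos_of_ne_zero (Submodule.subset_span ⟨c, rfl⟩) (D.P.ne_zero c)
  have h4 : D.P.toLinearMap (D.P.root i) (2 • D.P.Polarization (D.P.root c)) =
      2 * D.P.RootForm (D.P.root c) (D.P.root i) := by
    rw [map_nsmul, RootPairing.toLinearMap_apply_apply_Polarization,
      ← D.P.rootForm_symmetric.eq]
    simp
  rw [h4] at h2
  have h5 : D.P.coroot' c (D.P.root i) = D.P.toLinearMap (D.P.root i) (D.P.coroot c) := rfl
  rw [h5]
  by_contra hle
  push Not at hle
  have := mul_nonpos_of_nonneg_of_nonpos h3.le hle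
  linarith

/-- The subgroup generated by the simple reflections. -/
def simpleSubgroup : Subgroup D.W := Subgroup.closure (Set.range fun b : D.Δ => D.s b)

/-- Every positive root is conjugate to a simple root under the group generated by the simple
reflections: a root of minimal height in its orbit is simple. -/
lemma exists_simple_of_isPos {i : ι} (hi : D.IsPos i) :
    ∃ u ∈ D.simpleSubgroup, ∃ c : D.Δ, D.P.weylGroupToPerm u i = c := by
  classical
  have := Fintype.ofFinite D.Δ
  let A : Set ι := {j | D.IsPos j ∧ ∃ u ∈ D.simpleSubgroup, D.P.weylGroupToPerm u i = j}
  have hA : A.Nonempty := ⟨i, hi, 1, one_mem _, by simp⟩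
  obtain ⟨j, ⟨hj, u, hu, huj⟩, hmin⟩ := Set.exists_min_image A
    (fun j => ∑ c : D.Δ, D.coef c (D.P.root j)) (Set.toFinite _) hA
  by_contra hcon
  push Not at hcon
  -- As `(j, j) > 0`, some simple root `c` with a positive coefficient has `(c, j) > 0`; reflecting
  -- in `c` lowers the height of `j`.
  have hne : ∀ c : D.Δ, j ≠ c := fun c h => hcon u hu c (huj.trans h)
  have hpos : 0 < D.P.RootForm (D.P.root j) (D.P.root j) :=
    D.P.rootForm_pos_of_ne_zero (Submodule.subset_span ⟨j, rfl⟩) (D.P.ne_zero j)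
  have hsum : D.P.RootForm (D.P.root j) (D.P.root j) =
      ∑ c : D.Δ, D.coef c (D.P.root j) * D.P.RootForm (D.P.root c) (D.P.root j) := by
    have h := congrArg (fun y => D.P.RootForm y (D.P.root j)) (D.eq_sum hj)
    simpa only [map_sum, map_smul, LinearMap.sum_apply, LinearMap.smul_apply, smul_eq_mul] using h
  rw [hsum] at hpos
  obtain ⟨c, -, hc⟩ := Finset.exists_lt_of_sum_lt (s := Finset.univ)
    (f := fun _ : D.Δ => (0 : ℝ)) (by simpa using hpos)
  have hc0 := D.coef_nonneg hj c
  have hB : 0 < D.P.RootForm (D.P.root c) (D.P.root j) := by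
    by_contra h
    push Not at h
    exact absurd hc (not_lt.2 (mul_nonpos_of_nonneg_of_nonpos hc0 h))
  have hcr := D.coroot'_pos_of_rootForm_pos c j hB
  have hmem : D.P.reflectionPerm c j ∈ A := by
    refine ⟨D.pos_reflection c hj (hne c), D.s c * u,
      mul_mem (Subgroup.subset_closure ⟨c, rfl⟩) hu, ?_⟩
    rw [toPerm_mul, huj, toPerm_s]
  have hle := hmin _ hmem
  have hlt : ∑ d : D.Δ, D.coef d (D.P.root (D.P.reflectionPerm c j)) <
      ∑ d : D.Δ, D.coef d (D.P.root j) := by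
    apply Finset.sum_lt_sum
    · intro d _
      rw [RootPairing.root_reflectionPerm, RootPairing.reflection_apply, map_sub, map_smul,
        smul_eq_mul]
      have := D.coef_nonneg (D.simple_isPos c) d
      nlinarith
    · refine ⟨c, Finset.mem_univ _, ?_⟩
      rw [RootPairing.root_reflectionPerm, RootPairing.reflection_apply, map_sub, map_smul,
        smul_eq_mul, D.coef_self]
      linarith
  exact absurd hle (not_le.2 hlt)

lemma exists_simple (i : ι) : ∃ (w : D.W) (c : D.Δ), D.P.weylGroupToPerm w i = c := by
  rcases D.mem_or_neg_mem i with h | h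
  · obtain ⟨u, -, c, hc⟩ := D.exists_simple_of_isPos h
    exact ⟨u, c, hc⟩
  · have h' : D.IsPos (D.negIdx i) := by rw [IsPos, root_negIdx]; exact h
    obtain ⟨u, -, c, hc⟩ := D.exists_simple_of_isPos h'
    refine ⟨u * D.s i, c, ?_⟩
    rw [toPerm_mul, toPerm_s]
    exact hc

lemma s_mem_simpleSubgroup (i : ι) : D.s i ∈ D.simpleSubgroup := by
  have key : ∀ i, D.IsPos i → D.s i ∈ D.simpleSubgroup := by
    intro i hi
    obtain ⟨u, hu, c, hc⟩ := D.exists_simple_of_isPos hi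
    have h := D.s_conj u i
    rw [hc] at h
    have h2 : D.s i = u⁻¹ * (D.s c * u) := by rw [← h]; group
    rw [h2]
    exact mul_mem (inv_mem hu) (mul_mem (Subgroup.subset_closure ⟨c, rfl⟩) hu)
  rcases D.mem_or_neg_mem i with h | h
  · exact key i h
  · rw [← s_negIdx]
    exact key _ (by rw [IsPos, root_negIdx]; exact h)

/-- Induction on the elements of `W`, which is generated by the simple reflections. -/
lemma simple_induction {p : D.W → Prop} (one : p 1) (mul_s : ∀ (a : D.Δ) w, p w → p (D.s a * w))
    (w : D.W) : p w := by
  have hS : ∀ u ∈ D.simpleSubgroup, ∀ w, p w → p (u * w) := by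
    intro u hu
    induction hu using Subgroup.closure_induction'' with
    | one => intro w hw; simpa using hw
    | mem x hx =>
      obtain ⟨a, rfl⟩ := hx
      exact mul_s a
    | inv_mem x hx =>
      obtain ⟨a, rfl⟩ := hx
      intro w hw
      simp only [s_inv]
      exact mul_s a w hw
    | mul x y _ _ hx hy =>
      intro w hw
      rw [mul_assoc]
      exact hx _ (hy _ hw)
  have hw : w ∈ D.simpleSubgroup := by
    obtain ⟨w, hw⟩ := w
    induction hw using RootPairing.weylGroup.induction with
    | mem i => exact D.s_mem_simpleSubgroup i
    | one => exact one_mem _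
    | mul a b ha hb ha' hb' => exact mul_mem ha' hb'
  simpa using hS w hw 1 one

/-- The `W`-invariant extension of the parameter function to all roots. -/
def kk (i : ι) : ℂ := D.k (D.exists_simple i).choose_spec.choose

lemma kk_eq (i : ι) (w : D.W) (c : D.Δ) (h : D.P.weylGroupToPerm w i = c) : D.kk i = D.k c := by
  apply D.k_eq
  have h2 := (D.exists_simple i).choose_spec.choose_spec
  set w' := (D.exists_simple i).choose
  refine ⟨w * w'⁻¹, ?_⟩
  rw [RootPairing.weylGroup_apply_root, ← h2, toPerm_mul, ← D.toPerm_mul w'⁻¹ w']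
  simp only [inv_mul_cancel, map_one, Equiv.Perm.one_apply, h]

lemma kk_simple (c : D.Δ) : D.kk c = D.k c := D.kk_eq c 1 c (by simp)

lemma kk_toPerm (w : D.W) (i : ι) : D.kk (D.P.weylGroupToPerm w i) = D.kk i := by
  obtain ⟨u, c, h⟩ := D.exists_simple i
  rw [D.kk_eq i u c h]
  apply D.kk_eq _ (u * w⁻¹)
  rw [toPerm_mul, ← D.toPerm_mul w⁻¹ w, inv_mul_cancel, map_one, Equiv.Perm.one_apply, h]

lemma kk_negIdx (i : ι) : D.kk (D.negIdx i) = D.kk i := D.kk_toPerm (D.s i) i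

lemma posSign_negIdx (i : ι) : D.posSign (D.negIdx i) = - D.posSign i := by
  unfold posSign
  rcases D.mem_or_neg_mem i with h | h
  · have h' : ¬ D.IsPos (D.negIdx i) := fun h' => D.not_pos_neg i h (by
      rw [← root_negIdx]; exact h')
    rw [if_neg h', if_pos (show D.IsPos i from h)]
  · have h' : ¬ D.IsPos i := fun h' => D.not_pos_neg i h' h
    rw [if_neg h', if_pos (by rw [IsPos, root_negIdx]; exact h), neg_neg]

lemma posSign_reflection (a : D.Δ) {i : ι} (h : i ≠ a) (h' : i ≠ D.negIdx a) :
    D.posSign (D.P.reflectionPerm a i) = D.posSign i := by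
  have key : ∀ i : ι, i ≠ a → D.IsPos i → D.posSign (D.P.reflectionPerm a i) = D.posSign i := by
    intro i h hi
    unfold posSign
    rw [if_pos hi, if_pos (D.pos_reflection a hi h)]
  rcases D.mem_or_neg_mem i with hi | hi
  · exact key i h hi
  · have h1 := key (D.negIdx i) (fun h2 => h' (by
      apply D.P.root.injective
      rw [root_negIdx, ← h2, root_negIdx, neg_neg])) (by rw [IsPos, root_negIdx]; exact hi)
    rw [← toPerm_s, toPerm_negIdx, posSign_negIdx, posSign_negIdx, toPerm_s] at h1
    exact neg_injective h1

/-- The longest element turns positive roots into negative ones and conversely. -/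
lemma posSign_w₀ (i : ι) : D.posSign (D.P.weylGroupToPerm D.w₀ i) = - D.posSign i := by
  have key : ∀ i : ι, D.IsPos i → D.posSign (D.P.weylGroupToPerm D.w₀ i) = - D.posSign i := by
    intro i hi
    unfold posSign
    rw [if_pos hi, if_neg (D.w₀_neg i hi)]
  rcases D.mem_or_neg_mem i with hi | hi
  · exact key i hi
  · have h1 := key (D.negIdx i) (by rw [IsPos, root_negIdx]; exact hi)
    rw [toPerm_negIdx, posSign_negIdx, posSign_negIdx] at h1
    exact neg_injective h1

end Fin
end HeckeDatum
namespace HeckeDatum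

variable {ι V₀ N : Type u} [AddCommGroup V₀] [Module ℝ V₀] [AddCommGroup N] [Module ℝ N]
  (D : HeckeDatum ι V₀ N)

/-! ### Generators of the Hecke algebra that are permuted by the reflection group -/

lemma cpair_negIdx (i : ι) (v : D.VC) : D.cpair (D.negIdx i) v = - D.cpair i v := by
  induction v using TensorProduct.induction_on with
  | zero => simp
  | add x y hx hy => simp only [map_add, hx, hy, neg_add]
  | tmul c x =>
    simp only [cpair, Module.Dual.baseChange_apply_tmul, coroot'_negIdx, neg_smul]

/-- The `i`-th root, as a vector of the complexification. -/
def rootC (i : ι) : D.VC := 1 ⊗ₜ D.P.root i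

lemma act_s (i : ι) (v : D.VC) : D.act (D.s i) v = v - D.cpair i v • D.rootC i := by
  induction v using TensorProduct.induction_on with
  | zero => simp
  | add x y hx hy => simp only [map_add, hx, hy, add_smul]; abel
  | tmul c x =>
    simp only [act, cpair, LinearMap.baseChange_tmul, Module.Dual.baseChange_apply_tmul, rootRep_s,
      rootC, TensorProduct.tmul_sub, TensorProduct.smul_tmul', TensorProduct.tmul_smul]
    congr 1
    simp

/-- The action of `ℂ[W]` on `ℍ`-modules, as an algebra homomorphism to `ℍ`. -/
def tAlg : MonoidAlgebra ℂ D.W →ₐ[ℂ] D.H :=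
  MonoidAlgebra.lift ℂ D.H D.W { toFun := D.t, map_one' := D.t_one, map_mul' := D.t_mul }

@[simp] lemma tAlg_of (w : D.W) : D.tAlg (MonoidAlgebra.of ℂ D.W w) = D.t w := by
  simp [tAlg]

lemma t_mul_t_inv (w : D.W) : D.t w * D.t w⁻¹ = 1 := by rw [← t_mul, mul_inv_cancel, t_one]

lemma t_inv_mul_t (w : D.W) : D.t w⁻¹ * D.t w = 1 := by rw [← t_mul, inv_mul_cancel, t_one]

lemma t_inv_smul_t_smul (w : D.W) {X : ModuleCat.{u} D.H} (x : X) : D.t w⁻¹ • D.t w • x = x := by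
  rw [smul_smul, t_inv_mul_t, one_smul]

lemma t_smul_t_inv_smul (w : D.W) {X : ModuleCat.{u} D.H} (x : X) : D.t w • D.t w⁻¹ • x = x := by
  rw [smul_smul, t_mul_t_inv, one_smul]

lemma act_inv_act (w : D.W) (v : D.VC) : D.act w⁻¹ (D.act w v) = v := by
  rw [← act_mul, inv_mul_cancel, act_one]

lemma act_act_inv (w : D.W) (v : D.VC) : D.act w (D.act w⁻¹ v) = v := by
  rw [← act_mul, mul_inv_cancel, act_one]

lemma bullet_t [FiniteDimensional ℝ V₀] (w : D.W) :
    D.bullet (D.t w) = MulOpposite.op (D.t w⁻¹) := lift_t ..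

lemma imInv_t [FiniteDimensional ℝ V₀] (w : D.W) : D.imInv (D.t w) = D.sgn w • D.t w := lift_t ..

lemma sgn_mul (w w' : D.W) : D.sgn (w * w') = D.sgn w * D.sgn w' := by
  simp only [sgn, map_mul, Complex.ofReal_mul]

lemma sgn_one : D.sgn 1 = 1 := by simp [sgn]

/-- Induction along the generators of `ℍ`. -/
lemma H_induction {p : D.H → Prop} (algebraMap : ∀ c : ℂ, p (algebraMap ℂ D.H c))
    (t : ∀ w, p (D.t w)) (f : ∀ v, p (D.f v)) (mul : ∀ a b, p a → p b → p (a * b))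
    (add : ∀ a b, p a → p b → p (a + b)) (h : D.H) : p h := by
  obtain ⟨a, rfl⟩ := RingQuot.mkAlgHom_surjective ℂ D.Rel h
  induction a using FreeAlgebra.induction with
  | grade0 r => rw [AlgHom.commutes]; exact algebraMap r
  | grade1 x =>
    rcases x with w | v
    · exact t w
    · exact f v
  | mul a b ha hb => rw [map_mul]; exact mul _ _ ha hb
  | add a b ha hb => rw [map_add]; exact add _ _ ha hb

section Fin
variable [Fintype ι]

/-- The element `½ ∑_{β > 0} k_β ⟨v, β^∨⟩ s_β` of the group algebra of `W`. The sum is extended over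
all roots, with the sign of the root as a factor, which counts every reflection twice. -/
def phi : D.VC →ₗ[ℂ] MonoidAlgebra ℂ D.W :=
  ∑ i, (D.cpair i).smulRight
    ((4⁻¹ * D.kk i * D.posSign i) • MonoidAlgebra.of ℂ D.W (D.s i))

lemma phi_apply (v : D.VC) : D.phi v =
    ∑ i, (4⁻¹ * D.kk i * D.posSign i * D.cpair i v) • MonoidAlgebra.of ℂ D.W (D.s i) := by
  rw [phi, LinearMap.sum_apply]
  refine Finset.sum_congr rfl fun i _ => ?_
  rw [LinearMap.smulRight_apply, smul_smul, mul_comm]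

lemma phi_act (w : D.W) (v : D.VC) : D.phi (D.act w v) * MonoidAlgebra.of ℂ D.W w =
    ∑ i, (4⁻¹ * D.kk i * D.posSign (D.P.weylGroupToPerm w i) * D.cpair i v) •
      (MonoidAlgebra.of ℂ D.W w * MonoidAlgebra.of ℂ D.W (D.s i)) := by
  rw [phi_apply, ← Equiv.sum_comp (D.P.weylGroupToPerm w), Finset.sum_mul]
  refine Finset.sum_congr rfl fun i _ => ?_
  rw [kk_toPerm, cpair_act, ← map_mul, s_conj, map_mul, smul_mul_assoc]

lemma of_mul_phi (w : D.W) (v : D.VC) : MonoidAlgebra.of ℂ D.W w * D.phi v =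
    ∑ i, (4⁻¹ * D.kk i * D.posSign i * D.cpair i v) •
      (MonoidAlgebra.of ℂ D.W w * MonoidAlgebra.of ℂ D.W (D.s i)) := by
  rw [phi_apply, Finset.mul_sum]
  refine Finset.sum_congr rfl fun i _ => ?_
  rw [mul_smul_comm]

/-- Only the two roots proportional to the simple root `a` contribute to the difference, as `s_a`
permutes the other positive roots. -/
lemma of_s_mul_phi (a : D.Δ) (v : D.VC) :
    MonoidAlgebra.of ℂ D.W (D.s a) * D.phi v =
      D.phi (D.act (D.s a) v) * MonoidAlgebra.of ℂ D.W (D.s a) +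
        (D.k a * D.cpair a v) • (1 : MonoidAlgebra ℂ D.W) := by
  classical
  have hne : (a : ι) ≠ D.negIdx a := by
    intro h
    have h1 := D.posSign_negIdx a
    rw [← h, posSign_simple] at h1
    norm_num at h1
  rw [← sub_eq_iff_eq_add', phi_act, of_mul_phi, ← Finset.sum_sub_distrib,
    ← Finset.sum_subset (Finset.subset_univ {(a : ι), D.negIdx a}), Finset.sum_pair hne]
  · have h1 : D.P.weylGroupToPerm (D.s a) a = D.negIdx a := rfl
    have h2 : D.P.weylGroupToPerm (D.s a) (D.negIdx a) = a := by
      rw [toPerm_negIdx, h1]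
      apply D.P.root.injective
      rw [root_negIdx, root_negIdx, neg_neg]
    rw [h1, h2, s_negIdx, posSign_negIdx, posSign_simple, cpair_negIdx, kk_negIdx, kk_simple,
      ← map_mul, s_mul_s, map_one, ← sub_smul, ← sub_smul, ← add_smul]
    congr 1
    ring
  · intro i _ hi
    rw [Finset.mem_insert, Finset.mem_singleton, not_or] at hi
    rw [toPerm_s, D.posSign_reflection a hi.1 hi.2, sub_self]

/-- As `w₀` exchanges the positive and the negative roots, it anticommutes with `φ`. -/
lemma of_w₀_mul_phi (v : D.VC) :
    MonoidAlgebra.of ℂ D.W D.w₀ * D.phi v =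
      - (D.phi (D.act D.w₀ v) * MonoidAlgebra.of ℂ D.W D.w₀) := by
  rw [phi_act, of_mul_phi, ← Finset.sum_neg_distrib]
  refine Finset.sum_congr rfl fun i _ => ?_
  rw [posSign_w₀, ← neg_smul]
  congr 1
  ring

/-- The commutators `[φ(v), φ(v')]` depend `W`-equivariantly on `v` and `v'`. -/
lemma phi_commutator (w : D.W) (v v' : D.VC) :
    MonoidAlgebra.of ℂ D.W w * (D.phi v * D.phi v' - D.phi v' * D.phi v) =
      (D.phi (D.act w v) * D.phi (D.act w v') - D.phi (D.act w v') * D.phi (D.act w v)) *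
        MonoidAlgebra.of ℂ D.W w := by
  revert v v'
  induction w using D.simple_induction with
  | one => intro v v'; rw [map_one, act_one, act_one, one_mul, mul_one]
  | mul_s a w ih =>
    intro v v'
    rw [map_mul, mul_assoc, ih, ← mul_assoc, ← mul_assoc, act_mul, act_mul]
    congr 1
    generalize D.act w v = v
    generalize D.act w v' = v'
    have h1 := D.of_s_mul_phi a v
    have h2 := D.of_s_mul_phi a v'
    have h3 : D.phi (D.act (D.s a) v) = D.phi v - D.cpair a v • D.phi (D.rootC a) := by
      rw [act_s, map_sub, map_smul]
    have h4 : D.phi (D.act (D.s a) v') = D.phi v' - D.cpair a v' • D.phi (D.rootC a) := by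
      rw [act_s, map_sub, map_smul]
    -- Both sides are `-k_a ⟨v, a^∨⟩ ⟨v', a^∨⟩ φ(a)`; they are the error terms that `s_a` leaves.
    have key : (D.k a * D.cpair a v') • (D.phi (D.act (D.s a) v) - D.phi v) =
        (D.k a * D.cpair a v) • (D.phi (D.act (D.s a) v') - D.phi v') := by
      rw [h3, h4, sub_sub_cancel_left, sub_sub_cancel_left, smul_neg, smul_neg, smul_smul,
        smul_smul]
      congr 2
      ring
    clear h3 h4
    set S := MonoidAlgebra.of ℂ D.W (D.s a)
    set p := D.phi v
    set q := D.phi v'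
    set p' := D.phi (D.act (D.s a) v)
    set q' := D.phi (D.act (D.s a) v')
    set c := D.k a * D.cpair a v
    set d := D.k a * D.cpair a v'
    have e1 : S * (p * q) = p' * q' * S + d • p' + c • q := by
      rw [← mul_assoc, h1, add_mul, mul_assoc, h2, mul_add, smul_mul_assoc, one_mul,
        mul_smul_comm, mul_one, mul_assoc]
    have e2 : S * (q * p) = q' * p' * S + c • q' + d • p := by
      rw [← mul_assoc, h2, add_mul, mul_assoc, h1, mul_add, smul_mul_assoc, one_mul,
        mul_smul_comm, mul_one, mul_assoc]
    rw [mul_sub, e1, e2, sub_mul]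
    rw [smul_sub, smul_sub, sub_eq_sub_iff_add_eq_add] at key
    rw [add_assoc, add_assoc, key, add_sub_add_right_eq_sub]

/-- The Drinfeld generator `ṽ = v - ½ ∑_{β > 0} k_β ⟨v, β^∨⟩ t_{s_β}` of `ℍ`. -/
def ftil : D.VC →ₗ[ℂ] D.H := D.f - D.tAlg.toLinearMap ∘ₗ D.phi

lemma ftil_apply (v : D.VC) : D.ftil v = D.f v - D.tAlg (D.phi v) := rfl

lemma f_eq (v : D.VC) : D.f v = D.ftil v + D.tAlg (D.phi v) := by rw [ftil_apply, sub_add_cancel]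

/-- The Drinfeld generators are permuted by `W`: the failure of `φ` to be equivariant is exactly the
right-hand side of the cross relation. -/
lemma t_mul_ftil (w : D.W) (v : D.VC) : D.t w * D.ftil v = D.ftil (D.act w v) * D.t w := by
  revert v
  induction w using D.simple_induction with
  | one => intro v; rw [t_one, act_one, one_mul, mul_one]
  | mul_s a w ih =>
    intro v
    rw [t_mul, mul_assoc, ih, ← mul_assoc, ← mul_assoc, act_mul]
    congr 1
    generalize D.act w v = v
    have h1 := congrArg D.tAlg (D.of_s_mul_phi a v)
    have h2 := D.cross a v
    rw [map_add, map_mul, map_mul, map_smul, map_one, tAlg_of, ← Algebra.algebraMap_eq_smul_one]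
      at h1
    rw [ftil_apply, ftil_apply, mul_sub, sub_mul, h1, ← h2]
    abel

lemma t_conj_ftil (w : D.W) (v : D.VC) : D.t w⁻¹ * D.ftil (D.act w v) * D.t w = D.ftil v := by
  rw [mul_assoc, ← t_mul_ftil, ← mul_assoc, t_inv_mul_t, one_mul]

lemma star_t (w : D.W) : D.star (D.t w) = MulOpposite.op (D.t w⁻¹) := lift_t ..

/-- An anti-homomorphism of `ℍ` with `t_w ↦ t_w⁻¹` fixes `φ(v)`, as reflections are
involutions. -/
lemma antihom_phi (σ : D.H →ₐ[ℂ] D.Hᵐᵒᵖ) (hσ : ∀ w, σ (D.t w) = MulOpposite.op (D.t w⁻¹))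
    (v : D.VC) : σ (D.tAlg (D.phi v)) = MulOpposite.op (D.tAlg (D.phi v)) := by
  rw [phi_apply]
  simp only [map_sum, map_smul, tAlg_of, hσ, s_inv]
  exact (map_sum (MulOpposite.opAddEquiv (α := D.H)) _ _).symm

/-- The anti-involution `*` maps `ṽ` to `-ṽ`: the equivariance of `ṽ` absorbs the conjugation by
`w₀`. -/
lemma star_ftil (v : D.VC) : D.star (D.ftil v) = - MulOpposite.op (D.ftil v) := by
  have h : D.star (D.f v) = MulOpposite.op (D.t D.w₀⁻¹ * D.f (-D.act D.w₀ v) * D.t D.w₀) :=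
    lift_f ..
  have h1 := congrArg D.tAlg (D.of_w₀_mul_phi v)
  rw [map_neg, map_mul, map_mul, tAlg_of] at h1
  have h2 : D.tAlg (D.phi v) = - (D.t D.w₀⁻¹ * D.tAlg (D.phi (D.act D.w₀ v)) * D.t D.w₀) := by
    rw [mul_assoc, ← mul_neg, ← h1, ← mul_assoc, t_inv_mul_t, one_mul]
  rw [ftil_apply, map_sub, D.antihom_phi _ D.star_t, h, ← MulOpposite.op_sub, ← MulOpposite.op_neg,
    ← ftil_apply]
  congr 1
  rw [map_neg, f_eq, neg_add, mul_add, add_mul, mul_neg, neg_mul, t_conj_ftil, mul_neg, neg_mul,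
    ← h2, add_sub_cancel_right]

variable [FiniteDimensional ℝ V₀]

lemma bullet_ftil (v : D.VC) : D.bullet (D.ftil v) = MulOpposite.op (D.ftil v) := by
  rw [ftil_apply, map_sub, D.antihom_phi _ fun w => D.bullet_t w, MulOpposite.op_sub]
  congr 1
  exact lift_f ..

lemma imInv_ftil (v : D.VC) : D.imInv (D.ftil v) = - D.ftil v := by
  have h : D.imInv (D.f v) = - D.f v := lift_f ..
  have h2 : D.imInv (D.tAlg (D.phi v)) = - D.tAlg (D.phi v) := by
    rw [phi_apply]
    simp only [map_sum, map_smul, tAlg_of, imInv_t, sgn_s]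
    rw [← Finset.sum_neg_distrib]
    refine Finset.sum_congr rfl fun i _ => ?_
    rw [neg_smul, one_smul, smul_neg]
  rw [ftil_apply, map_sub, h, h2, neg_sub_neg, neg_sub]

lemma sgn_mul_self (w : D.W) : D.sgn w * D.sgn w = 1 := by
  induction w using D.simple_induction with
  | one => rw [sgn_one, one_mul]
  | mul_s a w ih => rw [sgn_mul, sgn_s, neg_one_mul, neg_mul_neg, ih]

end Fin
end HeckeDatum

/-! ### Alternating forms with values in a module with commuting operators -/

section Koszul

variable {R V A : Type*} [CommRing R] [AddCommGroup V] [Module R V] [AddCommGroup A] [Module R A]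

/-- The map `u ↦ δ(u) ∘ ω`, for operators `δ(u)` on the values of an alternating form `ω`. -/
def operCurry (δ : V →ₗ[R] Module.End R A) {i : ℕ} (ω : V [⋀^Fin i]→ₗ[R] A) :
    V →ₗ[R] V [⋀^Fin i]→ₗ[R] A where
  toFun u := (δ u).compAlternatingMap ω
  map_add' u v := by ext; simp
  map_smul' c v := by ext; simp

/-- The Koszul differential `(dω)(v₀, …, vᵢ) = ∑ₐ (-1)ᵃ δ(vₐ) ω(v₀, …, v̂ₐ, …, vᵢ)` of alternating
forms on `V` with values in a module `A` on which `V` acts by the operators `δ`. -/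
def koszulDiff (δ : V →ₗ[R] Module.End R A) {i : ℕ} (ω : V [⋀^Fin i]→ₗ[R] A) :
    V [⋀^Fin (i + 1)]→ₗ[R] A :=
  AlternatingMap.alternatizeUncurryFin (operCurry δ ω)

lemma koszulDiff_apply (δ : V →ₗ[R] Module.End R A) {i : ℕ} (ω : V [⋀^Fin i]→ₗ[R] A)
    (v : Fin (i + 1) → V) :
    koszulDiff δ ω v = ∑ a : Fin (i + 1), (-1 : ℤ) ^ (a : ℕ) • δ (v a) (ω (a.removeNth v)) := by
  simp [koszulDiff, AlternatingMap.alternatizeUncurryFin_apply, operCurry]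

lemma koszulDiff_sub (δ : V →ₗ[R] Module.End R A) {i : ℕ} (ω ω' : V [⋀^Fin i]→ₗ[R] A) :
    koszulDiff δ (ω - ω') = koszulDiff δ ω - koszulDiff δ ω' := by
  ext v
  simp only [koszulDiff_apply, AlternatingMap.sub_apply, map_sub, smul_sub,
    Finset.sum_sub_distrib]

lemma koszulDiff_koszulDiff (δ : V →ₗ[R] Module.End R A) (hδ : ∀ u v, Commute (δ u) (δ v)) {i : ℕ}
    (ω : V [⋀^Fin i]→ₗ[R] A) : koszulDiff δ (koszulDiff δ ω) = 0 := by
  let f : V →ₗ[R] V →ₗ[R] V [⋀^Fin i]→ₗ[R] A := LinearMap.mk₂ R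
    (fun u v => (δ u).compAlternatingMap ((δ v).compAlternatingMap ω))
    (fun _ _ _ => by ext; simp) (fun _ _ _ => by ext; simp)
    (fun _ _ _ => by ext; simp) (fun _ _ _ => by ext; simp)
  have hf : ∀ u v, f u v = f v u := by
    intro u v
    ext x
    exact LinearMap.congr_fun (hδ u v).eq (ω x)
  rw [← AlternatingMap.alternatizeUncurryFin_alternatizeUncurryFinLM_comp_of_symmetric hf]
  unfold koszulDiff
  congr 1
  ext u x
  simp [operCurry, AlternatingMap.alternatizeUncurryFin_apply, f]

/-- Cartan's formula `i_u d + d i_u = δ(u)`. -/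
lemma koszulDiff_cons (δ : V →ₗ[R] Module.End R A) {i : ℕ} (ω : V [⋀^Fin (i + 1)]→ₗ[R] A)
    (u : V) (v : Fin (i + 1) → V) :
    koszulDiff δ ω (Matrix.vecCons u v) = δ u (ω v) - koszulDiff δ (ω.curryLeft u) v := by
  rw [koszulDiff_apply, koszulDiff_apply, Fin.sum_univ_succ, sub_eq_add_neg,
    ← Finset.sum_neg_distrib]
  congr 1
  · simp [Matrix.vecCons]
  · refine Finset.sum_congr rfl fun a _ => ?_
    have h : a.succ.removeNth (Matrix.vecCons u v) = Matrix.vecCons u (a.removeNth v) := by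
      funext b
      refine Fin.cases ?_ (fun b => ?_) b
      · simp [Fin.removeNth]
      · simp [Fin.removeNth]
    rw [h, Fin.val_succ, pow_succ, AlternatingMap.curryLeft_apply_apply]
    simp [Matrix.vecCons]

/-- The Koszul complex of a module with commuting operators `δ` is acyclic if, for a basis of `V`,
every `δ(b j)` has a right inverse that commutes with the other `δ(b k)`. The contractions of a
cocycle with the basis vectors are removed one after the other, with the help of Cartan's
formula. -/
lemma exists_koszulDiff_eq {β : Type*} [Finite β] (b : Module.Basis β R V)
    (δ : V →ₗ[R] Module.End R A) (hδ : ∀ u v, Commute (δ u) (δ v)) (σ : β → Module.End R A)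
    (h1 : ∀ j, δ (b j) * σ j = 1) (h2 : ∀ j k, k ≠ j → δ (b k) * σ j = σ j * δ (b k))
    {i : ℕ} (ω : V [⋀^Fin (i + 1)]→ₗ[R] A) (hω : koszulDiff δ ω = 0) :
    ∃ θ, koszulDiff δ θ = ω := by
  classical
  have := Fintype.ofFinite β
  -- After subtraction of a coboundary, `ω` is killed by the contractions with `b j`, `j ∈ s`.
  have key : ∀ s : Finset β, ∃ θ : V [⋀^Fin i]→ₗ[R] A, ∀ j ∈ s,
      (ω - koszulDiff δ θ).curryLeft (b j) = 0 := by
    intro s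
    induction s using Finset.induction_on with
    | empty => exact ⟨0, by simp⟩
    | insert j s hj ih =>
      obtain ⟨θ, hθ⟩ := ih
      set ω' := ω - koszulDiff δ θ with hω'
      have hd : koszulDiff δ ω' = 0 := by
        rw [hω', koszulDiff_sub, hω, koszulDiff_koszulDiff δ hδ, sub_zero]
      -- By Cartan's formula, as `ω'` and its contraction with `b k` are closed.
      have hk : ∀ k ∈ s, ∀ v, δ (b k) (ω' v) = 0 := by
        intro k hk v
        have h := koszulDiff_cons δ ω' (b k) v
        rw [hd, hθ k hk] at h
        have h0 : koszulDiff δ (0 : V [⋀^Fin i]→ₗ[R] A) = 0 := by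
          ext; simp [koszulDiff_apply]
        rw [h0] at h
        simpa using h.symm
      -- `dμ` has the same contraction with `b j` as `ω'`, and none with the `b k`, `k ∈ s`.
      let μ : V [⋀^Fin i]→ₗ[R] A := (σ j).compAlternatingMap (ω'.curryLeft (b j))
      have hμ : ∀ k ∈ insert j s, (koszulDiff δ μ).curryLeft (b k) =
          (δ (b k)).compAlternatingMap μ := by
        intro k hk'
        cases i with
        | zero =>
          ext v
          rw [AlternatingMap.curryLeft_apply_apply, koszulDiff_apply]
          have h : Fin.removeNth 0 (Matrix.vecCons (b k) v) = v := Subsingleton.elim _ _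
          simp [h]
        | succ i =>
          have hz : μ.curryLeft (b k) = 0 := by
            ext v
            change σ j (ω' (Matrix.vecCons (b j) (Matrix.vecCons (b k) v))) = 0
            rw [Finset.mem_insert] at hk'
            rcases hk' with rfl | hk'
            · rw [ω'.map_eq_zero_of_eq _ (i := 0) (j := 1) (by simp) (by simp), map_zero]
            · have h3 := DFunLike.congr_fun (hθ k hk')
                (Matrix.vecCons (b j) v)
              have h4 := ω'.map_swap (Matrix.vecCons (b k) (Matrix.vecCons (b j) v))
                (i := 0) (j := 1) (by simp)
              have h5 : (Matrix.vecCons (b k) (Matrix.vecCons (b j) v)) ∘ (Equiv.swap 0 1) =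
                  Matrix.vecCons (b j) (Matrix.vecCons (b k) v) := by
                funext a
                refine Fin.cases ?_ (fun a => ?_) a
                · simp
                · refine Fin.cases ?_ (fun a => ?_) a
                  · simp
                  · rw [Function.comp_apply, Equiv.swap_apply_of_ne_of_ne (by simp)
                      (by simp [Fin.ext_iff])]
                    simp
              rw [h5] at h4
              rw [h4]
              rw [AlternatingMap.curryLeft_apply_apply] at h3
              rw [h3]
              simp
          ext v
          rw [AlternatingMap.curryLeft_apply_apply, koszulDiff_cons, hz]
          simp [koszulDiff_apply]
      refine ⟨θ + μ, fun k hk' => ?_⟩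
      have hadd : ω - koszulDiff δ (θ + μ) = ω' - koszulDiff δ μ := by
        have : θ + μ = θ - (-μ) := by abel
        rw [this, koszulDiff_sub, hω']
        have : koszulDiff δ (-μ) = - koszulDiff δ μ := by
          rw [← zero_sub, koszulDiff_sub]
          have h0 : koszulDiff δ (0 : V [⋀^Fin i]→ₗ[R] A) = 0 := by
            ext; simp [koszulDiff_apply]
          rw [h0, zero_sub]
        rw [this]
        abel
      rw [hadd]
      ext v
      have e1 := DFunLike.congr_fun (hμ k hk') v
      rw [AlternatingMap.curryLeft_apply_apply] at e1
      rw [AlternatingMap.curryLeft_apply_apply, AlternatingMap.sub_apply, e1]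
      change ω' (Matrix.vecCons (b k) v) - (δ (b k) * σ j) (ω' (Matrix.vecCons (b j) v)) = 0
      rw [Finset.mem_insert] at hk'
      rcases hk' with rfl | hk'
      · rw [h1, Module.End.one_apply, sub_self]
      · rw [h2 j k (by rintro rfl; exact hj hk'), Module.End.mul_apply, hk k hk', map_zero,
          sub_zero]
        exact DFunLike.congr_fun (hθ k hk') v
  obtain ⟨θ, hθ⟩ := key Finset.univ
  refine ⟨θ, ?_⟩
  rw [eq_comm, ← sub_eq_zero]
  have hc : (ω - koszulDiff δ θ).curryLeft = 0 :=
    b.ext fun j => hθ j (Finset.mem_univ j)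
  ext v
  have h := DFunLike.congr_fun (LinearMap.congr_fun hc (v 0)) (Fin.tail v)
  rw [AlternatingMap.curryLeft_apply_apply] at h
  have hv : Matrix.vecCons (v 0) (Fin.tail v) = v := Fin.cons_self_tail v
  rw [hv] at h
  exact h

end Koszul

/-! ### Shift operators on functions of multi-indices -/

section Shift

variable {β X : Type*} [DecidableEq β]

/-- The operator on functions of multi-indices that is dual to the multiplication of monomials by
the `j`-th variable. -/
def shiftOp (j : β) : Module.End ℂ ((β → ℕ) → ℂ) where
  toFun u m := u (Function.update m j (m j + 1))
  map_add' _ _ := rfl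
  map_smul' _ _ := rfl

lemma shiftOp_apply (j : β) (u : (β → ℕ) → ℂ) (m : β → ℕ) :
    shiftOp j u m = u (Function.update m j (m j + 1)) := rfl

lemma shiftOp_comm (j k : β) : Commute (shiftOp j) (shiftOp k) := by
  ext u m
  rw [Module.End.mul_apply, Module.End.mul_apply, shiftOp_apply, shiftOp_apply, shiftOp_apply,
    shiftOp_apply]
  congr 1
  by_cases h : j = k
  · subst h; rfl
  · rw [Function.update_comm h, Function.update_of_ne h, Function.update_of_ne (Ne.symm h)]

variable [AddCommGroup X] [Module ℂ X]

/-- The operator `U ↦ shiftOp j ∘ U - U ∘ a` on linear maps from `X` to functions of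
multi-indices. -/
def shiftDer (j : β) (a : Module.End ℂ X) : Module.End ℂ (X →ₗ[ℂ] ((β → ℕ) → ℂ)) where
  toFun U := shiftOp j ∘ₗ U - U ∘ₗ a
  map_add' U U' := by rw [LinearMap.comp_add, LinearMap.add_comp]; abel
  map_smul' c U := by
    rw [LinearMap.comp_smul, LinearMap.smul_comp, smul_sub, RingHom.id_apply]

/-- A right inverse of `shiftDer j a`: it solves
`U(x)(m + 1_j) - U(a x)(m) = g(x)(m)` by recursion on `m_j`, starting from `0`. -/
def shiftInv (j : β) (a : Module.End ℂ X) : Module.End ℂ (X →ₗ[ℂ] ((β → ℕ) → ℂ)) where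
  toFun g :=
    { toFun := fun x m => ∑ q ∈ Finset.range (m j),
        g ((a ^ q) x) (Function.update m j (m j - 1 - q))
      map_add' := by
        intro x y; funext m; simp [Finset.sum_add_distrib]
      map_smul' := by
        intro c x; funext m; simp [Finset.mul_sum] }
  map_add' g g' := by
    ext x m; simp [Finset.sum_add_distrib]
  map_smul' c g := by
    ext x m; simp [Finset.mul_sum]

lemma shiftInv_apply (j : β) (a : Module.End ℂ X) (g : X →ₗ[ℂ] ((β → ℕ) → ℂ)) (x : X)
    (m : β → ℕ) : shiftInv j a g x m =
      ∑ q ∈ Finset.range (m j), g ((a ^ q) x) (Function.update m j (m j - 1 - q)) := rfl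

lemma shiftDer_apply (j : β) (a : Module.End ℂ X) (g : X →ₗ[ℂ] ((β → ℕ) → ℂ)) (x : X)
    (m : β → ℕ) : shiftDer j a g x m = g x (Function.update m j (m j + 1)) - g (a x) m := rfl

lemma shiftDer_mul_shiftInv (j : β) (a : Module.End ℂ X) : shiftDer j a * shiftInv j a = 1 := by
  ext g x m
  rw [Module.End.mul_apply, shiftDer_apply, shiftInv_apply, shiftInv_apply, Function.update_self,
    Finset.sum_range_succ', Module.End.one_apply]
  have h : ∀ q, g ((a ^ (q + 1)) x) (Function.update (Function.update m j (m j + 1)) j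
      (m j + 1 - 1 - (q + 1))) = g ((a ^ q) (a x)) (Function.update m j (m j - 1 - q)) := by
    intro q
    have hq : m j + 1 - 1 - (q + 1) = m j - 1 - q := by omega
    rw [Function.update_idem, pow_succ, Module.End.mul_apply, hq]
  simp only [h]
  simp

/-- The right inverse in one direction commutes with the operators in the other directions. -/
lemma shiftDer_mul_shiftInv_of_ne {j k : β} (hk : k ≠ j) {a c : Module.End ℂ X}
    (hac : Commute a c) : shiftDer k c * shiftInv j a = shiftInv j a * shiftDer k c := by
  ext g x m
  rw [Module.End.mul_apply, Module.End.mul_apply, shiftDer_apply, shiftInv_apply, shiftInv_apply,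
    shiftInv_apply, Function.update_of_ne hk.symm, ← Finset.sum_sub_distrib]
  refine Finset.sum_congr rfl fun q _ => ?_
  have h : (a ^ q) (c x) = c ((a ^ q) x) := LinearMap.congr_fun (hac.pow_left q).eq x
  rw [shiftDer_apply, h, Function.update_comm hk, Function.update_of_ne hk]

end Shift
namespace HeckeDatum

variable {ι V₀ N : Type u} [AddCommGroup V₀] [Module ℝ V₀] [AddCommGroup N] [Module ℝ N]
  (D : HeckeDatum ι V₀ N)

/-! ### Modules coinduced from commuting operators -/

section Coinduced

lemma act_mul_s (w : D.W) (i : ι) (v : D.VC) :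
    D.act (w * D.s i) v = D.act w v - D.cpair i v • D.act w (D.rootC i) := by
  rw [act_mul, act_s, map_sub, map_smul]

lemma act_s_mul (w : D.W) (i : ι) (v : D.VC) :
    D.act (D.s i * w) v = D.act w v - D.cpair i (D.act w v) • D.rootC i := by
  rw [act_mul, act_s]

variable {M : Type u} [AddCommGroup M] [Module ℂ M]

/-- The linear extension to `ℂ[W]` of a function on `W`. -/
def linExt (F : D.W → M) : MonoidAlgebra ℂ D.W →ₗ[ℂ] M :=
  Finsupp.linearCombination ℂ F ∘ₗ (MonoidAlgebra.coeffLinearEquiv ℂ).toLinearMap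

lemma linExt_of (F : D.W → M) (w : D.W) : D.linExt F (MonoidAlgebra.of ℂ D.W w) = F w := by
  simp [linExt]

lemma linExt_add (F G : D.W → M) (c : MonoidAlgebra ℂ D.W) :
    D.linExt (F + G) c = D.linExt F c + D.linExt G c := by
  simp [linExt, Finsupp.linearCombination_apply, Finsupp.sum, Finset.sum_add_distrib]

lemma linExt_smul (a : ℂ) (F : D.W → M) (c : MonoidAlgebra ℂ D.W) :
    D.linExt (a • F) c = a • D.linExt F c := by
  simp [linExt, Finsupp.linearCombination_apply, Finsupp.sum, Finset.smul_sum, smul_comm a]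

/-- The operator by which `t_x` acts on the coinduced module. -/
def coindT (x : D.W) : Module.End ℂ (D.W → M) where
  toFun F w := F (w * x)
  map_add' _ _ := rfl
  map_smul' _ _ := rfl

lemma coindT_apply (x : D.W) (F : D.W → M) (w : D.W) : D.coindT x F w = F (w * x) := rfl

variable [Fintype ι]

/-- The coefficient of `φ(v)` at the reflection in the `i`-th root. -/
def phiCoeff (i : ι) (v : D.VC) : ℂ := 4⁻¹ * D.kk i * D.posSign i * D.cpair i v

lemma phi_eq_sum (v : D.VC) :
    D.phi v = ∑ i, D.phiCoeff i v • MonoidAlgebra.of ℂ D.W (D.s i) := D.phi_apply v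

lemma phiCoeff_mul_cpair (i : ι) (v v' : D.VC) :
    D.phiCoeff i v * D.cpair i v' = D.phiCoeff i v' * D.cpair i v := by
  unfold phiCoeff; ring

variable (σ : D.VC →ₗ[ℂ] Module.End ℂ M)

/-- The operator by which `v ∈ V` acts on the coinduced module: a function `F : W → M` stands for
the map `∑ p t_w ↦ ∑ σ(p) F(w)` on `ℍ`, and `t_w v = w(v) t_w + (w φ(v) - φ(w v) w)`. -/
def coindV : D.VC →ₗ[ℂ] Module.End ℂ (D.W → M) where
  toFun v :=
    { toFun := fun F w => σ (D.act w v) (F w) +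
        D.linExt F (MonoidAlgebra.of ℂ D.W w * D.phi v) -
          D.linExt F (D.phi (D.act w v) * MonoidAlgebra.of ℂ D.W w)
      map_add' := by
        intro F G; funext w; simp only [linExt_add, Pi.add_apply, map_add]; abel
      map_smul' := by
        intro c F; funext w
        simp only [linExt_smul, Pi.smul_apply, map_smul, RingHom.id_apply, smul_add, smul_sub] }
  map_add' v v' := by
    ext F w
    simp only [map_add, mul_add, add_mul, LinearMap.add_apply, LinearMap.coe_mk, AddHom.coe_mk,
      Pi.add_apply]
    abel
  map_smul' c v := by
    ext F w
    simp only [map_smul, mul_smul_comm, smul_mul_assoc, LinearMap.smul_apply, LinearMap.coe_mk,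
      AddHom.coe_mk, Pi.smul_apply, RingHom.id_apply, smul_add, smul_sub]

lemma coindV_apply (v : D.VC) (F : D.W → M) (w : D.W) :
    D.coindV σ v F w = σ (D.act w v) (F w) +
        D.linExt F (MonoidAlgebra.of ℂ D.W w * D.phi v) -
          D.linExt F (D.phi (D.act w v) * MonoidAlgebra.of ℂ D.W w) := rfl

lemma linExt_of_mul_phi (F : D.W → M) (w : D.W) (v : D.VC) :
    D.linExt F (MonoidAlgebra.of ℂ D.W w * D.phi v) = ∑ i, D.phiCoeff i v • F (w * D.s i) := by
  rw [phi_eq_sum, Finset.mul_sum, map_sum]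
  refine Finset.sum_congr rfl fun i _ => ?_
  rw [mul_smul_comm, map_smul, ← map_mul, linExt_of]

lemma linExt_phi_mul_of (F : D.W → M) (w : D.W) (v : D.VC) :
    D.linExt F (D.phi v * MonoidAlgebra.of ℂ D.W w) = ∑ i, D.phiCoeff i v • F (D.s i * w) := by
  rw [phi_eq_sum, Finset.sum_mul, map_sum]
  refine Finset.sum_congr rfl fun i _ => ?_
  rw [smul_mul_assoc, map_smul, ← map_mul, linExt_of]

/-- The product of two of the operators `coindV`, up to terms symmetric in `v` and `v'`, which are
collected in the last four summands. -/
lemma coindV_coindV (v v' : D.VC) (F : D.W → M) (w : D.W) :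
    D.coindV σ v (D.coindV σ v' F) w =
      σ (D.act w v) (σ (D.act w v') (F w)) +
      (σ (D.act w v) (D.linExt F (MonoidAlgebra.of ℂ D.W w * D.phi v')) +
        σ (D.act w v') (D.linExt F (MonoidAlgebra.of ℂ D.W w * D.phi v))) -
      (σ (D.act w v) (D.linExt F (D.phi (D.act w v') * MonoidAlgebra.of ℂ D.W w)) +
        σ (D.act w v') (D.linExt F (D.phi (D.act w v) * MonoidAlgebra.of ℂ D.W w))) -
      (D.linExt F (D.phi (D.act w v') * MonoidAlgebra.of ℂ D.W w * D.phi v) +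
        D.linExt F (D.phi (D.act w v) * MonoidAlgebra.of ℂ D.W w * D.phi v')) +
      D.linExt F (MonoidAlgebra.of ℂ D.W w * (D.phi v * D.phi v')) +
      D.linExt F (D.phi (D.act w v') * D.phi (D.act w v) * MonoidAlgebra.of ℂ D.W w) +
      ∑ i, (D.phiCoeff i v * D.cpair i v') •
        (D.linExt F (D.phi (D.act w (D.rootC i)) * MonoidAlgebra.of ℂ D.W (w * D.s i)) -
          σ (D.act w (D.rootC i)) (F (w * D.s i))) +
      ∑ i, (D.phiCoeff i (D.act w v) * D.cpair i (D.act w v')) •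
        (σ (D.rootC i) (F (D.s i * w)) -
          D.linExt F (D.phi (D.rootC i) * MonoidAlgebra.of ℂ D.W (D.s i * w))) := by
  rw [coindV_apply, linExt_of_mul_phi, linExt_phi_mul_of]
  have e1 : ∑ i, D.phiCoeff i v • D.coindV σ v' F (w * D.s i) =
      σ (D.act w v') (D.linExt F (MonoidAlgebra.of ℂ D.W w * D.phi v)) +
      D.linExt F (MonoidAlgebra.of ℂ D.W w * (D.phi v * D.phi v')) -
      D.linExt F (D.phi (D.act w v') * MonoidAlgebra.of ℂ D.W w * D.phi v) +
      ∑ i, (D.phiCoeff i v * D.cpair i v') •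
        (D.linExt F (D.phi (D.act w (D.rootC i)) * MonoidAlgebra.of ℂ D.W (w * D.s i)) -
          σ (D.act w (D.rootC i)) (F (w * D.s i))) := by
    have h1 : σ (D.act w v') (D.linExt F (MonoidAlgebra.of ℂ D.W w * D.phi v)) =
        ∑ i, D.phiCoeff i v • σ (D.act w v') (F (w * D.s i)) := by
      rw [linExt_of_mul_phi, map_sum]; simp only [map_smul]
    have h2 : D.linExt F (MonoidAlgebra.of ℂ D.W w * (D.phi v * D.phi v')) =
        ∑ i, D.phiCoeff i v •
          D.linExt F (MonoidAlgebra.of ℂ D.W (w * D.s i) * D.phi v') := by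
      rw [← mul_assoc, D.phi_eq_sum v, Finset.mul_sum, Finset.sum_mul, map_sum]
      refine Finset.sum_congr rfl fun i _ => ?_
      rw [mul_smul_comm, smul_mul_assoc, map_smul, map_mul (MonoidAlgebra.of ℂ D.W)]
    have h3 : D.linExt F (D.phi (D.act w v') * MonoidAlgebra.of ℂ D.W w * D.phi v) =
        ∑ i, D.phiCoeff i v •
          D.linExt F (D.phi (D.act w v') * MonoidAlgebra.of ℂ D.W (w * D.s i)) := by
      rw [D.phi_eq_sum v, Finset.mul_sum, map_sum]
      refine Finset.sum_congr rfl fun i _ => ?_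
      rw [mul_smul_comm, map_smul, map_mul (MonoidAlgebra.of ℂ D.W), mul_assoc]
    rw [h1, h2, h3, ← Finset.sum_add_distrib, ← Finset.sum_sub_distrib, ← Finset.sum_add_distrib]
    refine Finset.sum_congr rfl fun i _ => ?_
    rw [coindV_apply, act_mul_s, map_sub, map_smul, LinearMap.sub_apply, LinearMap.smul_apply,
      map_sub, map_smul, sub_mul, smul_mul_assoc, map_sub, map_smul]
    module
  have e2 : ∑ i, D.phiCoeff i (D.act w v) • D.coindV σ v' F (D.s i * w) =
      σ (D.act w v') (D.linExt F (D.phi (D.act w v) * MonoidAlgebra.of ℂ D.W w)) +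
      D.linExt F (D.phi (D.act w v) * MonoidAlgebra.of ℂ D.W w * D.phi v') -
      D.linExt F (D.phi (D.act w v') * D.phi (D.act w v) * MonoidAlgebra.of ℂ D.W w) -
      ∑ i, (D.phiCoeff i (D.act w v) * D.cpair i (D.act w v')) •
        (σ (D.rootC i) (F (D.s i * w)) -
          D.linExt F (D.phi (D.rootC i) * MonoidAlgebra.of ℂ D.W (D.s i * w))) := by
    have h1 : σ (D.act w v') (D.linExt F (D.phi (D.act w v) * MonoidAlgebra.of ℂ D.W w)) =
        ∑ i, D.phiCoeff i (D.act w v) • σ (D.act w v') (F (D.s i * w)) := by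
      rw [linExt_phi_mul_of, map_sum]; simp only [map_smul]
    have h2 : D.linExt F (D.phi (D.act w v) * MonoidAlgebra.of ℂ D.W w * D.phi v') =
        ∑ i, D.phiCoeff i (D.act w v) •
          D.linExt F (MonoidAlgebra.of ℂ D.W (D.s i * w) * D.phi v') := by
      rw [D.phi_eq_sum (D.act w v), Finset.sum_mul, Finset.sum_mul, map_sum]
      refine Finset.sum_congr rfl fun i _ => ?_
      rw [smul_mul_assoc, smul_mul_assoc, map_smul, map_mul (MonoidAlgebra.of ℂ D.W)]
    have h3 : D.linExt F (D.phi (D.act w v') * D.phi (D.act w v) * MonoidAlgebra.of ℂ D.W w) =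
        ∑ i, D.phiCoeff i (D.act w v) •
          D.linExt F (D.phi (D.act w v') * MonoidAlgebra.of ℂ D.W (D.s i * w)) := by
      rw [D.phi_eq_sum (D.act w v), Finset.mul_sum, Finset.sum_mul, map_sum]
      refine Finset.sum_congr rfl fun i _ => ?_
      rw [mul_smul_comm, smul_mul_assoc, map_smul, map_mul (MonoidAlgebra.of ℂ D.W), mul_assoc]
    rw [h1, h2, h3, ← Finset.sum_add_distrib, ← Finset.sum_sub_distrib, ← Finset.sum_sub_distrib]
    refine Finset.sum_congr rfl fun i _ => ?_
    rw [coindV_apply, act_s_mul, map_sub, map_smul, LinearMap.sub_apply, LinearMap.smul_apply,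
      map_sub, map_smul, sub_mul, smul_mul_assoc, map_sub, map_smul]
    module
  rw [e1, e2, coindV_apply, map_sub, map_add]
  abel

/-- The operators `coindV` commute: what is not symmetric in `v` and `v'` cancels by the
equivariance of the commutators `[φ(v), φ(v')]`. -/
lemma coindV_comm (hσ : ∀ v v', Commute (σ v) (σ v')) (v v' : D.VC) :
    D.coindV σ v * D.coindV σ v' = D.coindV σ v' * D.coindV σ v := by
  ext F w
  rw [Module.End.mul_apply, Module.End.mul_apply, coindV_coindV, coindV_coindV]
  have h1 : σ (D.act w v) (σ (D.act w v') (F w)) = σ (D.act w v') (σ (D.act w v) (F w)) :=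
    LinearMap.congr_fun (hσ _ _).eq (F w)
  have h2 := congrArg (D.linExt F) (D.phi_commutator w v v')
  rw [mul_sub, sub_mul, map_sub, map_sub, sub_eq_sub_iff_add_eq_add] at h2
  simp only [D.phiCoeff_mul_cpair _ v v',
    D.phiCoeff_mul_cpair _ (D.act w v) (D.act w v')]
  rw [h1, add_comm (σ (D.act w v) (D.linExt F (MonoidAlgebra.of ℂ D.W w * D.phi v'))),
    add_comm (σ (D.act w v) (D.linExt F (D.phi (D.act w v') * MonoidAlgebra.of ℂ D.W w))),
    add_comm (D.linExt F (D.phi (D.act w v') * MonoidAlgebra.of ℂ D.W w * D.phi v))]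
  congr 2
  rw [add_assoc, add_assoc, h2]
  rw [add_comm (D.linExt F (D.phi (D.act w v) * D.phi (D.act w v') * _))]

/-- The cross relation of `ℍ` for the operators on the coinduced module. -/
lemma coind_cross (a : D.Δ) (v : D.VC) :
    D.coindT (D.s a) * D.coindV σ v - D.coindV σ (D.act (D.s a) v) * D.coindT (D.s a) =
      algebraMap ℂ (Module.End ℂ (D.W → M)) (D.k a * D.cpair a v) := by
  ext F w
  -- Right translation of a function is right multiplication on the group algebra.
  have hT : ∀ c : MonoidAlgebra ℂ D.W, D.linExt (D.coindT (D.s a) F) c =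
      D.linExt F (c * MonoidAlgebra.of ℂ D.W (D.s a)) := by
    intro c
    induction c using MonoidAlgebra.induction_on with
    | of g => rw [linExt_of, ← map_mul, linExt_of, coindT_apply]
    | add x y hx hy => rw [map_add, add_mul, map_add, hx, hy]
    | smul r x hx => rw [map_smul, smul_mul_assoc, map_smul, hx]
  rw [LinearMap.sub_apply, Pi.sub_apply, Module.End.mul_apply, Module.End.mul_apply, coindT_apply,
    coindV_apply, coindV_apply, hT, hT, coindT_apply, Module.algebraMap_end_apply, Pi.smul_apply,
    map_mul (MonoidAlgebra.of ℂ D.W), mul_assoc, of_s_mul_phi, mul_add, map_add, act_mul,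
    mul_smul_comm, mul_one, map_smul, linExt_of]
  simp only [mul_assoc]
  abel

variable (hσ : ∀ v v', Commute (σ v) (σ v'))

/-- The action of `ℍ` on the coinduced module. -/
def coindHom : D.H →ₐ[ℂ] Module.End ℂ (D.W → M) :=
  lift (D.coindT (M := M)) (D.coindV σ)
    (by ext F w; rw [coindT_apply, mul_one, Module.End.one_apply])
    (by intro w w'; ext F x; rw [Module.End.mul_apply]; simp only [coindT_apply, mul_assoc])
    (D.coindV_comm σ hσ) (D.coind_cross σ)

/-- The space of functions `W → M`, on which `ℍ` acts. -/
def CoindSpace (_ : D.H →ₐ[ℂ] Module.End ℂ (D.W → M)) : Type u := D.W → M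

instance (ρ : D.H →ₐ[ℂ] Module.End ℂ (D.W → M)) : AddCommGroup (D.CoindSpace ρ) :=
  inferInstanceAs (AddCommGroup (D.W → M))

instance (ρ : D.H →ₐ[ℂ] Module.End ℂ (D.W → M)) : Module D.H (D.CoindSpace ρ) :=
  Module.compHom (D.W → M) ρ.toRingHom

/-- The `ℍ`-module coinduced from a space `M` with commuting operators `σ(v)`. -/
def coind : ModuleCat.{u} D.H := ModuleCat.of D.H (D.CoindSpace (D.coindHom σ hσ))

/-- The coinduced module as a space of functions. -/
def coindEquiv : D.coind σ hσ ≃ₗ[ℂ] (D.W → M) where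
  toFun F := (show D.CoindSpace (D.coindHom σ hσ) from F)
  invFun F := (show D.CoindSpace (D.coindHom σ hσ) from F)
  left_inv _ := rfl
  right_inv _ := rfl
  map_add' _ _ := rfl
  map_smul' c F := by
    exact LinearMap.congr_fun ((D.coindHom σ hσ).commutes c)
      (show D.CoindSpace (D.coindHom σ hσ) from F : D.W → M)

lemma coindEquiv_smul (h : D.H) (F : D.coind σ hσ) :
    D.coindEquiv σ hσ (h • F) = D.coindHom σ hσ h (D.coindEquiv σ hσ F) := rfl

lemma coindEquiv_t (x : D.W) (F : D.coind σ hσ) (w : D.W) :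
    D.coindEquiv σ hσ (D.t x • F) w = D.coindEquiv σ hσ F (w * x) := by
  rw [coindEquiv_smul]
  have : D.coindHom σ hσ (D.t x) = D.coindT x := lift_t ..
  rw [this, coindT_apply]

lemma coindEquiv_f (v : D.VC) (F : D.coind σ hσ) (w : D.W) :
    D.coindEquiv σ hσ (D.f v • F) w = D.coindV σ v (D.coindEquiv σ hσ F) w := by
  rw [coindEquiv_smul]
  have : D.coindHom σ hσ (D.f v) = D.coindV σ v := lift_f ..
  rw [this]

lemma coindEquiv_f_one (v : D.VC) (F : D.coind σ hσ) :
    D.coindEquiv σ hσ (D.f v • F) 1 = σ v (D.coindEquiv σ hσ F 1) := by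
  rw [coindEquiv_f, coindV_apply, map_one, one_mul, mul_one, act_one, add_sub_cancel_right]

/-- Frobenius reciprocity for coinduced modules. -/
lemma exists_hom_coind (Y : ModuleCat.{u} D.H) (g : Y →ₗ[ℂ] M)
    (hg : ∀ v y, g (D.f v • y) = σ v (g y)) :
    ∃ Φ : Y →ₗ[D.H] D.coind σ hσ, ∀ y, D.coindEquiv σ hσ (Φ y) 1 = g y := by
  -- The `ℍ`-linear map with components `y ↦ g (t_w y)`.
  let Φ₀ : Y →+ D.coind σ hσ :=
    { toFun := fun y => (D.coindEquiv σ hσ).symm fun w => g (D.t w • y)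
      map_zero' := by
        rw [LinearEquiv.symm_apply_eq]; funext w; simp
      map_add' := fun y y' => by
        rw [LinearEquiv.symm_apply_eq]; funext w; simp }
  have hΦ : ∀ y w, D.coindEquiv σ hσ (Φ₀ y) w = g (D.t w • y) := fun y w => by
    simp [Φ₀]
  have hΦc : ∀ (y : Y) (c : MonoidAlgebra ℂ D.W),
      D.linExt (D.coindEquiv σ hσ (Φ₀ y)) c = g (D.tAlg c • y) := by
    intro y c
    induction c using MonoidAlgebra.induction_on with
    | of w => rw [linExt_of, hΦ, tAlg_of]
    | add x x' hx hx' => rw [map_add, map_add, add_smul, map_add, hx, hx']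
    | smul r x hx => rw [map_smul, map_smul D.tAlg, hx, smul_assoc, g.map_smul]
  have ht : ∀ x y, Φ₀ (D.t x • y) = D.t x • Φ₀ y := by
    intro x y
    apply (D.coindEquiv σ hσ).injective
    funext w
    rw [coindEquiv_t, hΦ, hΦ, smul_smul, t_mul]
  have hf : ∀ v y, Φ₀ (D.f v • y) = D.f v • Φ₀ y := by
    intro v y
    apply (D.coindEquiv σ hσ).injective
    funext w
    rw [coindEquiv_f, coindV_apply, hΦc, hΦc, hΦ, hΦ, ← hg, ← map_add, ← map_sub]
    congr 1
    rw [smul_smul, smul_smul, ← add_smul, ← sub_smul, map_mul, map_mul, tAlg_of]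
    congr 1
    rw [D.f_eq v, D.f_eq (D.act w v), mul_add, add_mul, t_mul_ftil]
    abel
  have hH : ∀ (h : D.H) y, Φ₀ (h • y) = h • Φ₀ y := by
    intro h
    induction h using D.H_induction with
    | algebraMap c =>
      intro y
      rw [algebraMap_smul, algebraMap_smul]
      apply (D.coindEquiv σ hσ).injective
      funext w
      rw [(D.coindEquiv σ hσ).map_smul, Pi.smul_apply, hΦ, hΦ, smul_comm, map_smul]
    | t w => exact ht w
    | f v => exact hf v
    | mul a b ha hb => intro y; rw [mul_smul, mul_smul, ha, hb]
    | add a b ha hb => intro y; rw [add_smul, add_smul, map_add, ha, hb]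
  exact ⟨{ Φ₀ with map_smul' := hH }, fun y => by
    change D.coindEquiv σ hσ (Φ₀ y) 1 = g y
    rw [hΦ, t_one, one_smul]⟩

end Coinduced
end HeckeDatum

/-! ### Pull-back of alternating forms along a reflection -/

section Reflection

variable {R V A : Type*} [CommRing R] [AddCommGroup V] [Module R V] [AddCommGroup A] [Module R A]

/-- The operators `v ↦ λ(v) · id`, for which the Koszul differential is the wedge product with the
linear form `λ`. -/
def scalarOper (l : V →ₗ[R] R) : V →ₗ[R] Module.End R A := l.smulRight 1

lemma scalarOper_apply (l : V →ₗ[R] R) (v : V) (a : A) : scalarOper l v a = l v • a := rfl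

/-- Contractions anticommute. -/
lemma curryLeft_curryLeft_self {i : ℕ} (ω : V [⋀^Fin (i + 2)]→ₗ[R] A) (r u : V) :
    (ω.curryLeft r).curryLeft u = - (ω.curryLeft u).curryLeft r := by
  ext v
  have h4 := ω.map_swap (Matrix.vecCons u (Matrix.vecCons r v)) (i := 0) (j := 1) (by simp)
  have h5 : (Matrix.vecCons u (Matrix.vecCons r v)) ∘ (Equiv.swap 0 1) =
      Matrix.vecCons r (Matrix.vecCons u v) := by
    funext a
    refine Fin.cases ?_ (fun a => ?_) a
    · simp
    · refine Fin.cases ?_ (fun a => ?_) a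
      · simp
      · rw [Function.comp_apply, Equiv.swap_apply_of_ne_of_ne (by simp)
          (by simp [Fin.ext_iff])]
        simp
  rw [h5] at h4
  exact h4

lemma alternating_sum_apply {κ τ : Type*} (s : Finset κ) (ω : κ → V [⋀^τ]→ₗ[R] A) (v : τ → V) :
    (∑ j ∈ s, ω j) v = ∑ j ∈ s, ω j v :=
  map_sum (⟨⟨fun ω : V [⋀^τ]→ₗ[R] A => ω v, rfl⟩, fun _ _ => rfl⟩ : V [⋀^τ]→ₗ[R] A →+ A) ω s

lemma comp_vecCons {V : Type*} {i : ℕ} (s : V → V) (u : V) (v : Fin i → V) :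
    (fun a => s (Matrix.vecCons u v a)) = Matrix.vecCons (s u) (fun a => s (v a)) := by
  funext a
  refine Fin.cases ?_ (fun a => ?_) a <;> simp

/-- For the reflection `s = 1 - λ(·) r`, pulling back a form changes it by `λ ∧ s^*(i_r ω)`. -/
lemma compLinearMap_reflection (l : V →ₗ[R] R) (r : V) (s : V →ₗ[R] V)
    (hs : ∀ v, s v = v - l v • r) {i : ℕ} (ω : V [⋀^Fin (i + 1)]→ₗ[R] A) :
    ω.compLinearMap s - ω = - koszulDiff (scalarOper l) ((ω.curryLeft r).compLinearMap s) := by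
  induction i with
  | zero =>
    ext v
    obtain ⟨u, rfl⟩ : ∃ u, v = Matrix.vecCons u ![] := ⟨v 0, by
      funext a; rw [Subsingleton.elim (α := Fin 1) a 0]; rfl⟩
    simp only [AlternatingMap.sub_apply, AlternatingMap.compLinearMap_apply,
      AlternatingMap.neg_apply, koszulDiff_apply]
    have h2 : ∀ x : Fin 0 → V, x = ![] := fun x => Subsingleton.elim _ _
    rw [Fin.sum_univ_succ, Fin.sum_univ_zero, add_zero, scalarOper_apply]
    change ω (fun a => s (Matrix.vecCons u ![] a)) - _ =
      -((-1 : ℤ) ^ 0 • l u • ω.curryLeft r (fun x : Fin 0 => s _))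
    rw [comp_vecCons, hs, h2 (fun a => s (![] a)), h2 (fun x => s _),
      AlternatingMap.curryLeft_apply_apply, sub_eq_add_neg u, ← neg_smul]
    have h3 := (ω.curryLeft).map_add u (-l u • r)
    have h4 := DFunLike.congr_fun h3 (![] : Fin 0 → V)
    rw [map_smul] at h4
    simp only [AlternatingMap.curryLeft_apply_apply, AlternatingMap.add_apply,
      AlternatingMap.smul_apply] at h4
    rw [h4]
    simp
  | succ i ih =>
    ext v
    obtain ⟨u, v, rfl⟩ : ∃ u v', v = Matrix.vecCons u v' :=
      ⟨v 0, Fin.tail v, (Fin.cons_self_tail v).symm⟩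
    have h1 := DFunLike.congr_fun (ih (ω.curryLeft u)) v
    have h2 : ((ω.curryLeft r).compLinearMap s).curryLeft u =
        - ((ω.curryLeft u).curryLeft r).compLinearMap s := by
      have h3 : (ω.curryLeft r).curryLeft (s u) = - (ω.curryLeft u).curryLeft r := by
        rw [curryLeft_curryLeft_self, hs, map_sub, map_smul]
        have h4 : (ω.curryLeft r).curryLeft r = 0 := by
          ext v
          exact ω.map_eq_zero_of_eq _ (i := 0) (j := 1) (by simp) (by simp)
        have h5 : (ω.curryLeft u - l u • ω.curryLeft r).curryLeft r =
          (ω.curryLeft u).curryLeft r - l u • (ω.curryLeft r).curryLeft r := rfl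
        rw [h5, h4, smul_zero, sub_zero]
      ext x
      have h6 := DFunLike.congr_fun h3 (fun a => s (x a))
      rw [AlternatingMap.curryLeft_apply_apply, AlternatingMap.compLinearMap_apply]
      rw [AlternatingMap.curryLeft_apply_apply] at h6
      change ω.curryLeft r (fun a => s (Matrix.vecCons u x a)) = _
      rw [comp_vecCons, h6]
      rfl
    rw [AlternatingMap.neg_apply, koszulDiff_cons, h2]
    have h7 : koszulDiff (scalarOper l) (-((ω.curryLeft u).curryLeft r).compLinearMap s) =
        - koszulDiff (scalarOper l) (((ω.curryLeft u).curryLeft r).compLinearMap s) := by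
      ext x
      simp [koszulDiff_apply]
    rw [h7, ← ih, scalarOper_apply]
    simp only [AlternatingMap.sub_apply, AlternatingMap.compLinearMap_apply,
      AlternatingMap.curryLeft_apply_apply]
    rw [comp_vecCons, hs u]
    have h8 := DFunLike.congr_fun ((ω.curryLeft).map_sub u (l u • r)) (fun a => s (v a))
    rw [map_smul] at h8
    simp only [AlternatingMap.curryLeft_apply_apply, AlternatingMap.sub_apply,
      AlternatingMap.smul_apply] at h8
    rw [h8]
    abel

/-- A form `ω` and its pull-back along the reflection `s = 1 - λ(·) r` have the same product with
`λ`, since they differ by a multiple of `λ`. -/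
lemma koszulDiff_scalarOper_reflection (l : V →ₗ[R] R) (r : V) (s : V →ₗ[R] V)
    (hs : ∀ v, s v = v - l v • r) {i : ℕ} (ω : V [⋀^Fin i]→ₗ[R] A) :
    koszulDiff (scalarOper l) (ω.compLinearMap s - ω) = 0 := by
  cases i with
  | zero =>
    have h : ω.compLinearMap s - ω = 0 := by
      ext v
      have : (fun a => s (v a)) = v := Subsingleton.elim _ _
      simp only [AlternatingMap.sub_apply, AlternatingMap.compLinearMap_apply, this, sub_self,
        AlternatingMap.zero_apply]
    rw [h]
    ext
    simp [koszulDiff_apply]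
  | succ i =>
    have hc : ∀ u v : V, Commute (scalarOper (A := A) l u) (scalarOper l v) := by
      intro u v
      ext a
      simp only [Module.End.mul_apply, scalarOper_apply]
      exact smul_comm _ _ _
    rw [compLinearMap_reflection l r s hs]
    have h := koszulDiff_koszulDiff (scalarOper l) hc ((ω.curryLeft r).compLinearMap s)
    ext x
    have h' := DFunLike.congr_fun h x
    rw [koszulDiff_apply] at h' ⊢
    simp only [AlternatingMap.neg_apply, map_neg, smul_neg, Finset.sum_neg_distrib]
    rw [h']
    simp

end Reflection

namespace HeckeDatum

variable {ι V₀ N : Type u} [AddCommGroup V₀] [Module ℝ V₀] [AddCommGroup N] [Module ℝ N]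
  {D : HeckeDatum ι V₀ N}

/-! ### The differential of equivariant cochains -/

/-- The action of `h ∈ ℍ` on a module, as a linear map. -/
def op (h : D.H) (X : ModuleCat.{u} D.H) : X →ₗ[ℂ] X := Algebra.lsmul ℂ ℂ X h

lemma op_apply (h : D.H) (X : ModuleCat.{u} D.H) (x : X) : op h X x = h • x := rfl

/-- The operators `S ↦ F(v) S - S F(v)` on linear maps between modules, for a linear map
`F : V → ℍ`. -/
def commOp (F : D.VC →ₗ[ℂ] D.H) (X Y : ModuleCat.{u} D.H) :
    D.VC →ₗ[ℂ] Module.End ℂ (X →ₗ[ℂ] Y) where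
  toFun v :=
    { toFun := fun S => op (F v) Y ∘ₗ S - S ∘ₗ op (F v) X
      map_add' := fun S T => by rw [LinearMap.comp_add, LinearMap.add_comp]; abel
      map_smul' := fun c S => by
        rw [LinearMap.comp_smul, LinearMap.smul_comp, smul_sub, RingHom.id_apply] }
  map_add' v v' := by
    ext S x
    simp only [map_add, LinearMap.coe_mk, AddHom.coe_mk, LinearMap.sub_apply,
      LinearMap.comp_apply, op_apply, add_smul, LinearMap.add_apply]
    abel
  map_smul' c v := by
    ext S x
    simp only [map_smul, LinearMap.coe_mk, AddHom.coe_mk, LinearMap.sub_apply,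
      LinearMap.comp_apply, op_apply, smul_assoc, LinearMap.smul_apply, RingHom.id_apply, smul_sub]

lemma commOp_apply (F : D.VC →ₗ[ℂ] D.H) {X Y : ModuleCat.{u} D.H} (v : D.VC) (S : X →ₗ[ℂ] Y)
    (x : X) : commOp F X Y v S x = F v • S x - S (F v • x) := rfl

lemma commOp_f_comm (X Y : ModuleCat.{u} D.H) (u v : D.VC) :
    Commute (commOp D.f X Y u) (commOp D.f X Y v) := by
  ext S x
  simp only [Module.End.mul_apply, commOp_apply, smul_sub, smul_smul, D.f_comm u v]
  abel

/-- Cochains as alternating forms with values in the linear maps from `X` to `Y`. -/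
def flat {i : ℕ} {X Y : ModuleCat.{u} D.H} :
    D.Cochain i X Y ≃ₗ[ℂ] D.VC [⋀^Fin i]→ₗ[ℂ] (X →ₗ[ℂ] Y) where
  toFun η :=
    { toFun := fun v =>
        { toFun := fun x => η x v
          map_add' := fun x y => by rw [map_add]; rfl
          map_smul' := fun c x => by rw [map_smul]; rfl }
      map_update_add' := fun v a x y => by ext z; exact (η z).map_update_add v a x y
      map_update_smul' := fun v a c x => by ext z; exact (η z).map_update_smul v a c x
      map_eq_zero_of_eq' := fun v a b h hab => by
        ext z; exact (η z).map_eq_zero_of_eq v h hab }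
  invFun ω :=
    { toFun := fun x => (LinearMap.applyₗ x).compAlternatingMap ω
      map_add' := fun x y => by ext v; simp
      map_smul' := fun c x => by ext v; simp }
  left_inv η := rfl
  right_inv ω := rfl
  map_add' η θ := rfl
  map_smul' c η := rfl

@[simp] lemma flat_apply {i : ℕ} {X Y : ModuleCat.{u} D.H} (η : D.Cochain i X Y)
    (v : Fin i → D.VC) (x : X) : flat η v x = η x v := rfl

@[simp] lemma flat_symm_apply {i : ℕ} {X Y : ModuleCat.{u} D.H}
    (ω : D.VC [⋀^Fin i]→ₗ[ℂ] (X →ₗ[ℂ] Y)) (v : Fin i → D.VC) (x : X) :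
    flat.symm ω x v = ω v x := rfl

/-- The differential of cochains, formed with a linear map `F : V → ℍ` in place of the inclusion. -/
def dF (F : D.VC →ₗ[ℂ] D.H) {i : ℕ} {X Y : ModuleCat.{u} D.H} :
    D.Cochain i X Y →ₗ[ℂ] D.Cochain (i + 1) X Y where
  toFun η := flat.symm (koszulDiff (commOp F X Y) (flat η))
  map_add' η θ := by
    ext x v
    simp only [flat_symm_apply, koszulDiff_apply, map_add, AlternatingMap.add_apply,
      LinearMap.add_apply, smul_add, Finset.sum_add_distrib]
  map_smul' c η := by
    ext x v
    simp only [flat_symm_apply, koszulDiff_apply, map_smul, AlternatingMap.smul_apply,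
      LinearMap.smul_apply, RingHom.id_apply, smul_comm _ c, ← Finset.smul_sum]

lemma dF_apply (F : D.VC →ₗ[ℂ] D.H) {i : ℕ} {X Y : ModuleCat.{u} D.H} (η : D.Cochain i X Y) (x : X)
    (v : Fin (i + 1) → D.VC) : dF F η x v = ∑ a : Fin (i + 1), (-1 : ℤ) ^ (a : ℕ) •
      (F (v a) • η x (a.removeNth v) - η (F (v a) • x) (a.removeNth v)) := by
  change koszulDiff (commOp F X Y) (flat η) v x = _
  rw [koszulDiff_apply, LinearMap.sum_apply]
  rfl

lemma dF_f_apply {i : ℕ} {X Y : ModuleCat.{u} D.H} (η : D.Cochain i X Y) (x : X)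
    (v : Fin (i + 1) → D.VC) : dF D.f η x v = koszulD η x v := by
  rw [dF_apply]
  rfl

lemma dF_f_dF_f {i : ℕ} {X Y : ModuleCat.{u} D.H} (η : D.Cochain i X Y) :
    dF D.f (dF D.f η) = 0 := by
  change flat.symm (koszulDiff _ (koszulDiff _ (flat η))) = 0
  rw [koszulDiff_koszulDiff _ (commOp_f_comm X Y), map_zero]

/-- The subspace of `W`-equivariant cochains. -/
def equivariants (i : ℕ) (X Y : ModuleCat.{u} D.H) : Submodule ℂ (D.Cochain i X Y) where
  carrier := {η | IsEquivariant η}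
  zero_mem' := fun w x v => by simp
  add_mem' := fun {a b} ha hb w x v => by
    simp only [LinearMap.add_apply, AlternatingMap.add_apply, smul_add, ha w x v, hb w x v]
  smul_mem' := fun c a ha w x v => by
    simp only [LinearMap.smul_apply, AlternatingMap.smul_apply, ha w x v]
    exact smul_comm _ _ _

section Fin
variable [Fintype ι]

/-- On equivariant cochains, the differential may be formed with the Drinfeld generators `ṽ`
instead of `v`: the contributions of every reflection cancel. -/
lemma dF_f_eq_dF_ftil {i : ℕ} {X Y : ModuleCat.{u} D.H} {η : D.Cochain i X Y}
    (hη : IsEquivariant η) : dF D.f η = dF D.ftil η := by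
  ext x v
  rw [← sub_eq_zero, dF_apply, dF_apply, ← Finset.sum_sub_distrib]
  -- The reflection `s_j` contributes the product of the linear form `⟨·, j^∨⟩` with the difference
  -- between a form and its pull-back along `s_j`.
  have h1 : ∀ a : Fin (i + 1), (-1 : ℤ) ^ (a : ℕ) •
      (D.f (v a) • η x (a.removeNth v) - η (D.f (v a) • x) (a.removeNth v)) -
      (-1 : ℤ) ^ (a : ℕ) •
      (D.ftil (v a) • η x (a.removeNth v) - η (D.ftil (v a) • x) (a.removeNth v)) =
      ∑ j, (4⁻¹ * D.kk j * D.posSign j) • ((-1 : ℤ) ^ (a : ℕ) •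
        (scalarOper (D.cpair j) (v a)
          (((η (D.t (D.s j) • x)).compLinearMap (D.act (D.s j)) - η (D.t (D.s j) • x))
            (a.removeNth v)))) := by
    intro a
    have h2 : ∀ Z : ModuleCat.{u} D.H, ∀ z : Z, D.f (v a) • z = D.ftil (v a) • z +
        ∑ j, (4⁻¹ * D.kk j * D.posSign j * D.cpair j (v a)) • D.t (D.s j) • z := by
      intro Z z
      rw [f_eq, add_smul, phi_apply, map_sum, Finset.sum_smul]
      congr 1
      refine Finset.sum_congr rfl fun j _ => ?_
      rw [map_smul, tAlg_of, smul_assoc]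
    rw [← smul_sub, h2, h2, map_add, AlternatingMap.add_apply, add_sub_add_comm,
      add_sub_cancel_left, map_sum, alternating_sum_apply, ← Finset.sum_sub_distrib,
      Finset.smul_sum]
    refine Finset.sum_congr rfl fun j _ => ?_
    rw [map_smul, AlternatingMap.smul_apply, ← smul_sub, smul_comm, mul_smul, scalarOper_apply,
      ← hη (D.s j) x (a.removeNth v)]
    rw [smul_comm (D.cpair j (v a))]
    rfl
  rw [Finset.sum_congr rfl fun a _ => h1 a, Finset.sum_comm]
  refine Finset.sum_eq_zero fun j _ => ?_
  rw [← Finset.smul_sum, ← koszulDiff_apply,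
    koszulDiff_scalarOper_reflection (D.cpair j) (D.rootC j) (D.act (D.s j)) (D.act_s j)]
  simp

lemma IsEquivariant.dF_ftil {i : ℕ} {X Y : ModuleCat.{u} D.H} {η : D.Cochain i X Y}
    (hη : IsEquivariant η) : IsEquivariant (dF D.ftil η) := by
  intro w x v
  rw [dF_apply, dF_apply, Finset.smul_sum]
  refine Finset.sum_congr rfl fun a _ => ?_
  have h1 : a.removeNth (fun b => D.act w (v b)) = fun b => D.act w (a.removeNth v b) := rfl
  rw [h1, smul_comm (D.t w), smul_sub, hη, smul_smul, smul_smul, ← t_mul_ftil,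
    mul_smul, mul_smul, hη, smul_sub (D.t w), smul_sub]

/-- The differential preserves equivariance. For `ṽ` in place of `v` this is plain, as the `ṽ` are
permuted by `W`. -/
lemma IsEquivariant.dF_f {i : ℕ} {X Y : ModuleCat.{u} D.H} {η : D.Cochain i X Y}
    (hη : IsEquivariant η) : IsEquivariant (dF D.f η) := by
  rw [dF_f_eq_dF_ftil hη]
  exact hη.dF_ftil

end Fin

lemma isCocycle_iff {i : ℕ} {X Y : ModuleCat.{u} D.H} {η : D.Cochain i X Y} :
    IsCocycle η ↔ IsEquivariant η ∧ dF D.f η = 0 := by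
  refine ⟨fun h => ⟨h.1, ?_⟩, fun h => ⟨h.1, fun x v => ?_⟩⟩
  · ext x v
    rw [dF_f_apply, h.2 x v]
    rfl
  · rw [← dF_f_apply, h.2]
    rfl

end HeckeDatum

namespace HeckeDatum

variable {ι V₀ N : Type u} [AddCommGroup V₀] [Module ℝ V₀] [AddCommGroup N] [Module ℝ N]
  {D : HeckeDatum ι V₀ N}

/-! ### Composition and averaging of cochains, and cochains of degree zero -/

/-- The composite of a cochain with a linear map of its values. -/
def postComp {i : ℕ} {X Y Z : ModuleCat.{u} D.H} (φ : Y →ₗ[ℂ] Z) (η : D.Cochain i X Y) :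
    D.Cochain i X Z where
  toFun x := φ.compAlternatingMap (η x)
  map_add' x y := by ext; simp
  map_smul' c x := by ext; simp

@[simp] lemma postComp_apply {i : ℕ} {X Y Z : ModuleCat.{u} D.H} (φ : Y →ₗ[ℂ] Z)
    (η : D.Cochain i X Y) (x : X) (v : Fin i → D.VC) : postComp φ η x v = φ (η x v) := rfl

lemma IsEquivariant.postComp {i : ℕ} {X Y Z : ModuleCat.{u} D.H} {η : D.Cochain i X Y}
    (hη : IsEquivariant η) (φ : Y →ₗ[D.H] Z) :
    IsEquivariant (postComp (φ.restrictScalars ℂ) η) := by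
  intro w x v
  simp only [postComp_apply, hη w x v, LinearMap.restrictScalars_apply, map_smul]

lemma dF_postComp (F : D.VC →ₗ[ℂ] D.H) {i : ℕ} {X Y Z : ModuleCat.{u} D.H} (η : D.Cochain i X Y)
    (φ : Y →ₗ[D.H] Z) :
    dF F (postComp (φ.restrictScalars ℂ) η) = postComp (φ.restrictScalars ℂ) (dF F η) := by
  ext x v
  simp only [dF_apply, postComp_apply, LinearMap.restrictScalars_apply, map_sum, map_zsmul, map_sub,
    map_smul]

/-- The action of `w ∈ W` on cochains, whose invariants are the equivariant cochains. -/
def conjC {i : ℕ} {X Y : ModuleCat.{u} D.H} (w : D.W) : D.Cochain i X Y →ₗ[ℂ] D.Cochain i X Y where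
  toFun η :=
    { toFun := fun x =>
        (op (D.t w) Y).compAlternatingMap ((η (D.t w⁻¹ • x)).compLinearMap (D.act w⁻¹))
      map_add' := fun x y => by ext; simp
      map_smul' := fun c x => by ext; simp [smul_comm (D.t w⁻¹) c x] }
  map_add' η θ := by ext; simp
  map_smul' c η := by ext; simp

lemma conjC_apply {i : ℕ} {X Y : ModuleCat.{u} D.H} (w : D.W) (η : D.Cochain i X Y) (x : X)
    (v : Fin i → D.VC) :
    conjC w η x v = D.t w • η (D.t w⁻¹ • x) (fun a => D.act w⁻¹ (v a)) := rfl

lemma conjC_conjC {i : ℕ} {X Y : ModuleCat.{u} D.H} (y w : D.W) (η : D.Cochain i X Y) :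
    conjC y (conjC w η) = conjC (y * w) η := by
  ext x v
  simp only [conjC_apply, smul_smul, ← t_mul, ← act_mul, mul_inv_rev]

lemma isEquivariant_iff_conjC {i : ℕ} {X Y : ModuleCat.{u} D.H} {η : D.Cochain i X Y} :
    IsEquivariant η ↔ ∀ w, conjC w η = η := by
  constructor
  · intro h w
    ext x v
    rw [conjC_apply, ← h w]
    simp only [t_smul_t_inv_smul, act_act_inv]
  · intro h w x v
    have h1 := congrArg (fun θ : D.Cochain i X Y => θ (D.t w • x) (fun a => D.act w (v a))) (h w)
    simp only [conjC_apply, t_inv_smul_t_smul, act_inv_act] at h1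
    exact h1.symm

section Fin
variable [Fintype ι]

/-- The projection of cochains to equivariant cochains, by averaging over `W`. -/
def average {i : ℕ} {X Y : ModuleCat.{u} D.H} : D.Cochain i X Y →ₗ[ℂ] D.Cochain i X Y :=
  ((Fintype.card D.W : ℂ)⁻¹) • ∑ w, conjC w

lemma average_apply {i : ℕ} {X Y : ModuleCat.{u} D.H} (η : D.Cochain i X Y) :
    average η = ((Fintype.card D.W : ℂ)⁻¹) • ∑ w, conjC w η := by
  rw [average, LinearMap.smul_apply, LinearMap.sum_apply]

lemma isEquivariant_average {i : ℕ} {X Y : ModuleCat.{u} D.H} (η : D.Cochain i X Y) :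
    IsEquivariant (average η) := by
  rw [isEquivariant_iff_conjC]
  intro y
  rw [average_apply, map_smul, map_sum]
  congr 1
  simp only [conjC_conjC]
  exact Fintype.sum_equiv (Equiv.mulLeft y) _ _ fun w => rfl

lemma average_const_smul {M : Type*} [AddCommGroup M] [Module ℂ M] (m : M) :
    ((Fintype.card D.W : ℂ)⁻¹) • ∑ _w : D.W, m = m := by
  rw [Finset.sum_const, Finset.card_univ, ← Nat.cast_smul_eq_nsmul ℂ, smul_smul,
    inv_mul_cancel₀ (by exact_mod_cast Fintype.card_ne_zero), one_smul]

/-- An equivariant cochain lifts along a surjection of modules. -/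
lemma exists_equivariant_lift {i : ℕ} {X Y Z : ModuleCat.{u} D.H} (φ : Y →ₗ[D.H] Z)
    (hφ : Function.Surjective φ) {η : D.Cochain i X Z} (hη : IsEquivariant η) :
    ∃ θ : D.Cochain i X Y, IsEquivariant θ ∧ postComp (φ.restrictScalars ℂ) θ = η := by
  obtain ⟨s, hs⟩ := (φ.restrictScalars ℂ).exists_rightInverse_of_surjective
    (LinearMap.range_eq_top.2 hφ)
  refine ⟨average (postComp s η), isEquivariant_average _, ?_⟩
  ext x v
  have h1 : ∀ z, φ (s z) = z := fun z => LinearMap.congr_fun hs z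
  have h2 : ∀ w : D.W, φ (conjC w (postComp s η) x v) = η x v := by
    intro w
    rw [conjC_apply, map_smul, postComp_apply, h1, ← hη]
    simp only [t_smul_t_inv_smul, act_act_inv]
  rw [postComp_apply, average_apply, LinearMap.smul_apply, AlternatingMap.smul_apply, map_smul,
    LinearMap.sum_apply, alternating_sum_apply, map_sum]
  simp only [LinearMap.restrictScalars_apply, h2]
  exact average_const_smul (D := D) _

end Fin

/-- A linear map that commutes with the generators of `ℍ` is `ℍ`-linear. -/
def homOf {X Y : ModuleCat.{u} D.H} (g : X →ₗ[ℂ] Y) (ht : ∀ w x, g (D.t w • x) = D.t w • g x)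
    (hf : ∀ v x, g (D.f v • x) = D.f v • g x) : X →ₗ[D.H] Y where
  toFun := g
  map_add' := map_add g
  map_smul' h := by
    induction h using D.H_induction with
    | algebraMap c => intro x; rw [algebraMap_smul, map_smul, RingHom.id_apply, algebraMap_smul]
    | t w => exact ht w
    | f v => exact hf v
    | mul a b ha hb => intro x; rw [mul_smul, ha, hb, RingHom.id_apply, RingHom.id_apply,
        RingHom.id_apply, mul_smul]
    | add a b ha hb => intro x; rw [add_smul, map_add, ha, hb, RingHom.id_apply, RingHom.id_apply,
        RingHom.id_apply, add_smul]

/-- The cochain of degree `0` given by a linear map. -/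
def ofLinear {X Y : ModuleCat.{u} D.H} (g : X →ₗ[ℂ] Y) : D.Cochain 0 X Y where
  toFun x := AlternatingMap.constOfIsEmpty ℂ D.VC (Fin 0) (g x)
  map_add' x y := by ext; simp
  map_smul' c x := by ext; simp

@[simp] lemma ofLinear_apply {X Y : ModuleCat.{u} D.H} (g : X →ₗ[ℂ] Y) (x : X)
    (v : Fin 0 → D.VC) : ofLinear g x v = g x := rfl

lemma dF_zero_apply (F : D.VC →ₗ[ℂ] D.H) {X Y : ModuleCat.{u} D.H} (η : D.Cochain 0 X Y) (x : X)
    (v : Fin 1 → D.VC) : dF F η x v = F (v 0) • η x ![] - η (F (v 0) • x) ![] := by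
  rw [dF_apply, Fin.sum_univ_succ, Fin.sum_univ_zero, add_zero]
  rw [Subsingleton.elim (Fin.removeNth (0 : Fin 1) v) ![]]
  simp

lemma isCocycle_ofLinear {X Y : ModuleCat.{u} D.H} (g : X →ₗ[D.H] Y) :
    IsCocycle (ofLinear (g.restrictScalars ℂ)) := by
  rw [isCocycle_iff]
  refine ⟨fun w x v => by simp, ?_⟩
  ext x v
  rw [dF_zero_apply]
  simp

/-- Cocycles of degree `0` are `ℍ`-linear maps. -/
lemma exists_eq_ofLinear {X Y : ModuleCat.{u} D.H} {η : D.Cochain 0 X Y} (hη : IsCocycle η) :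
    ∃ g : X →ₗ[D.H] Y, η = ofLinear (g.restrictScalars ℂ) := by
  rw [isCocycle_iff] at hη
  refine ⟨homOf
    { toFun := fun x => η x ![]
      map_add' := fun x y => by rw [map_add]; rfl
      map_smul' := fun c x => by rw [map_smul]; rfl } ?_ ?_, ?_⟩
  · intro w x
    refine Eq.trans ?_ (hη.1 w x ![])
    exact congrArg (η (D.t w • x)) (Subsingleton.elim _ _)
  · intro v x
    have h := dF_zero_apply D.f η x ![v]
    rw [hη.2] at h
    exact (sub_eq_zero.1 h.symm).symm
  · ext x v
    exact congrArg (η x) (Subsingleton.elim _ _)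

/-! ### The Koszul resolution -/

section Koszul

variable (X : ModuleCat.{u} D.H) (i : ℕ)

/-- The relations between the symbols `1 ⊗ x ⊗ v₁ ∧ ⋯ ∧ vᵢ` in the free `ℍ`-module on pairs
`(x, v)`: the elements that are annihilated by all equivariant cochains. -/
def koszulRel : Submodule D.H ((X × (Fin i → D.VC)) →₀ D.H) :=
  ⨅ (Y : ModuleCat.{u} D.H) (η : equivariants i X Y),
    LinearMap.ker (Finsupp.linearCombination D.H fun p : X × (Fin i → D.VC) => η.1 p.1 p.2)

/-- The term `ℍ ⊗_{ℂ[W]} (X ⊗ ⋀ⁱV)` of the Koszul resolution. It is encoded by its universal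
property: `ℍ`-linear maps to `Y` are equivariant cochains `X ⊗ ⋀ⁱV → Y`. -/
def koszulObj : ModuleCat.{u} D.H :=
  ModuleCat.of D.H (((X × (Fin i → D.VC)) →₀ D.H) ⧸ koszulRel X i)

variable {X i}

lemma mem_koszulRel {z : (X × (Fin i → D.VC)) →₀ D.H} : z ∈ koszulRel X i ↔
    ∀ (Y : ModuleCat.{u} D.H) (η : D.Cochain i X Y), IsEquivariant η →
      Finsupp.linearCombination D.H (fun p : X × (Fin i → D.VC) => η p.1 p.2) z = 0 := by
  simp only [koszulRel, Submodule.mem_iInf, LinearMap.mem_ker]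
  exact ⟨fun h Y η hη => h Y ⟨η, hη⟩, fun h Y η => h Y η.1 η.2⟩

/-- The class of `h ⊗ x ⊗ v₁ ∧ ⋯ ∧ vᵢ`. -/
def koszulGen (h : D.H) (x : X) (v : Fin i → D.VC) : koszulObj X i :=
  (koszulRel X i).mkQ (Finsupp.single (x, v) h)

lemma koszulGen_smul (h h' : D.H) (x : X) (v : Fin i → D.VC) :
    koszulGen (h * h') x v = h • koszulGen h' x v := by
  rw [koszulGen, ← smul_eq_mul, ← Finsupp.smul_single, map_smul]
  rfl

lemma koszulGen_smul_complex (c : ℂ) (x : X) (v : Fin i → D.VC) :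
    c • koszulGen 1 x v = koszulGen (algebraMap ℂ D.H c) x v := by
  rw [← algebraMap_smul D.H c (koszulGen 1 x v), ← koszulGen_smul, mul_one]

variable (X i) in
/-- The universal equivariant cochain. -/
def koszulUniv : D.Cochain i X (koszulObj X i) where
  toFun x :=
    { toFun := fun v => koszulGen 1 x v
      map_update_add' := fun v a u u' => by
        rw [← sub_eq_zero, ← sub_sub]
        simp only [koszulGen]
        refine (Submodule.Quotient.mk_eq_zero _).2 (mem_koszulRel.2 fun Y η hη => ?_)
        simp
      map_update_smul' := fun v a c u => by
        rw [← sub_eq_zero, koszulGen_smul_complex]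
        simp only [koszulGen]
        refine (Submodule.Quotient.mk_eq_zero _).2 (mem_koszulRel.2 fun Y η hη => ?_)
        simp
      map_eq_zero_of_eq' := fun v a b h hab => by
        refine (Submodule.Quotient.mk_eq_zero _).2 (mem_koszulRel.2 fun Y η hη => ?_)
        simp [(η x).map_eq_zero_of_eq v h hab] }
  map_add' x y := by
    ext v
    change koszulGen 1 _ _ = koszulGen 1 _ _ + koszulGen 1 _ _
    rw [← sub_eq_zero, ← sub_sub]
    simp only [koszulGen]
    refine (Submodule.Quotient.mk_eq_zero _).2 (mem_koszulRel.2 fun Y η hη => ?_)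
    simp
  map_smul' c x := by
    ext v
    change koszulGen 1 _ _ = c • koszulGen 1 _ _
    rw [← sub_eq_zero, koszulGen_smul_complex]
    simp only [koszulGen]
    refine (Submodule.Quotient.mk_eq_zero _).2 (mem_koszulRel.2 fun Y η hη => ?_)
    simp

lemma koszulUniv_apply (x : X) (v : Fin i → D.VC) : koszulUniv X i x v = koszulGen 1 x v := rfl

lemma isEquivariant_koszulUniv : IsEquivariant (koszulUniv X i) := by
  intro w x v
  rw [koszulUniv_apply, koszulUniv_apply, ← koszulGen_smul, ← sub_eq_zero]
  simp only [koszulGen]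
  refine (Submodule.Quotient.mk_eq_zero _).2 (mem_koszulRel.2 fun Y η hη => ?_)
  simp [hη w x v]

/-- The `ℍ`-linear map given by an equivariant cochain. -/
def koszulLift {Y : ModuleCat.{u} D.H} (η : D.Cochain i X Y) (hη : IsEquivariant η) :
    koszulObj X i →ₗ[D.H] Y :=
  (koszulRel X i).liftQ
    (Finsupp.linearCombination D.H fun p : X × (Fin i → D.VC) => η p.1 p.2)
    (fun _ hz => LinearMap.mem_ker.2 (mem_koszulRel.1 hz Y η hη))

@[simp] lemma koszulLift_univ {Y : ModuleCat.{u} D.H} (η : D.Cochain i X Y) (hη : IsEquivariant η)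
    (x : X) (v : Fin i → D.VC) : koszulLift η hη (koszulUniv X i x v) = η x v := by
  refine (Finsupp.linearCombination_single D.H (1 : D.H) (x, v)).trans ?_
  exact one_smul D.H _

lemma koszulObj_hom_ext {Y : ModuleCat.{u} D.H} {φ ψ : koszulObj X i →ₗ[D.H] Y}
    (h : ∀ x v, φ (koszulUniv X i x v) = ψ (koszulUniv X i x v)) : φ = ψ := by
  refine Submodule.linearMap_qext _ (Finsupp.lhom_ext' fun p => LinearMap.ext_ring ?_)
  exact h p.1 p.2

variable (X) in
/-- The augmentation of the Koszul resolution. -/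
def koszulAug : koszulObj X 0 →ₗ[D.H] X :=
  koszulLift (ofLinear ((LinearMap.id : X →ₗ[D.H] X).restrictScalars ℂ))
    (isCocycle_ofLinear _).equivariant

lemma koszulAug_univ (x : X) (v : Fin 0 → D.VC) : koszulAug X (koszulUniv X 0 x v) = x :=
  koszulLift_univ ..

section Fin
variable [Fintype ι]

/-- The terms of the Koszul resolution are projective, as averaging over the finite group `W` makes
lifts of cochains equivariant. -/
lemma projective_koszulObj : Projective (koszulObj X i) where
  factors {E Z} f e _ := by
    obtain ⟨θ, hθ, h⟩ := exists_equivariant_lift e.hom ((ModuleCat.epi_iff_surjective e).1 ‹_›)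
      (isEquivariant_koszulUniv.postComp f.hom)
    refine ⟨ModuleCat.ofHom (koszulLift θ hθ), ?_⟩
    apply ModuleCat.hom_ext
    refine koszulObj_hom_ext fun x v => ?_
    change e.hom (koszulLift θ hθ _) = f.hom _
    rw [koszulLift_univ]
    exact DFunLike.congr_fun (DFunLike.congr_fun h x) v

variable (X) in
/-- The differential of the Koszul resolution. -/
def koszulDiffHom (i : ℕ) : koszulObj X (i + 1) →ₗ[D.H] koszulObj X i :=
  koszulLift (dF D.f (koszulUniv X i)) isEquivariant_koszulUniv.dF_f

lemma koszulDiffHom_univ (x : X) (v : Fin (i + 1) → D.VC) :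
    koszulDiffHom X i (koszulUniv X (i + 1) x v) = dF D.f (koszulUniv X i) x v :=
  koszulLift_univ ..

lemma comp_koszulDiffHom_univ {Y : ModuleCat.{u} D.H} (φ : koszulObj X i →ₗ[D.H] Y)
    (x : X) (v : Fin (i + 1) → D.VC) : φ (koszulDiffHom X i (koszulUniv X (i + 1) x v)) =
      dF D.f (postComp (φ.restrictScalars ℂ) (koszulUniv X i)) x v := by
  rw [koszulDiffHom_univ, dF_postComp]
  rfl

lemma koszulDiffHom_comp : koszulDiffHom X i ∘ₗ koszulDiffHom X (i + 1) = 0 := by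
  refine koszulObj_hom_ext fun x v => ?_
  rw [LinearMap.comp_apply, comp_koszulDiffHom_univ]
  have h : postComp ((koszulDiffHom X i).restrictScalars ℂ) (koszulUniv X (i + 1)) =
      dF D.f (koszulUniv X i) := by
    ext x v
    exact koszulDiffHom_univ x v
  rw [h, dF_f_dF_f]
  rfl

lemma koszulAug_comp : koszulAug X ∘ₗ koszulDiffHom X 0 = 0 := by
  refine koszulObj_hom_ext fun x v => ?_
  rw [LinearMap.comp_apply, comp_koszulDiffHom_univ]
  have h : postComp ((koszulAug X).restrictScalars ℂ) (koszulUniv X 0) =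
      ofLinear ((LinearMap.id : X →ₗ[D.H] X).restrictScalars ℂ) := by
    ext x v
    exact koszulAug_univ x v
  rw [h, (isCocycle_iff.1 (isCocycle_ofLinear _)).2]
  rfl

/-- The Koszul complex of `X`. -/
def koszulComplex (X : ModuleCat.{u} D.H) : ChainComplex (ModuleCat.{u} D.H) ℕ :=
  ChainComplex.of (koszulObj X) (fun i => ModuleCat.ofHom (koszulDiffHom X i))
    (fun i => ModuleCat.hom_ext (koszulDiffHom_comp (X := X) (i := i)))

lemma koszulComplex_d (X : ModuleCat.{u} D.H) (i : ℕ) :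
    (koszulComplex X).d (i + 1) i = ModuleCat.ofHom (koszulDiffHom X i) :=
  ChainComplex.of_d (koszulObj X) (fun i => ModuleCat.ofHom (koszulDiffHom X i)) i

/-- The augmentation of the Koszul complex, as a map of complexes. -/
def koszulπ (X : ModuleCat.{u} D.H) :
    koszulComplex X ⟶ (ChainComplex.single₀ (ModuleCat.{u} D.H)).obj X :=
  (ChainComplex.toSingle₀Equiv _ _).symm ⟨ModuleCat.ofHom (koszulAug X), by
    rw [koszulComplex_d]
    exact ModuleCat.hom_ext koszulAug_comp⟩

lemma koszulπ_f_zero (X : ModuleCat.{u} D.H) :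
    (koszulπ X).f 0 = ModuleCat.ofHom (koszulAug X) :=
  ChainComplex.toSingle₀Equiv_symm_apply_f_zero _ _

end Fin
end Koszul

end HeckeDatum

namespace HeckeDatum

variable {ι V₀ N : Type u} [AddCommGroup V₀] [Module ℝ V₀] [AddCommGroup N] [Module ℝ N]
  {D : HeckeDatum ι V₀ N}

/-! ### Exactness of the Koszul resolution -/

section Coinduced

variable {M : Type u} [AddCommGroup M] [Module ℂ M] (σ : D.VC →ₗ[ℂ] Module.End ℂ M)

/-- The operators `S ↦ σ(v) S - S v` on linear maps from a module `X` to `M`. -/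
def derOp (X : ModuleCat.{u} D.H) : D.VC →ₗ[ℂ] Module.End ℂ (X →ₗ[ℂ] M) where
  toFun v :=
    { toFun := fun S => σ v ∘ₗ S - S ∘ₗ op (D.f v) X
      map_add' := fun S T => by rw [LinearMap.comp_add, LinearMap.add_comp]; abel
      map_smul' := fun c S => by
        rw [LinearMap.comp_smul, LinearMap.smul_comp, smul_sub, RingHom.id_apply] }
  map_add' v v' := by
    ext S x
    simp only [map_add, LinearMap.coe_mk, AddHom.coe_mk, LinearMap.sub_apply,
      LinearMap.comp_apply, op_apply, add_smul, LinearMap.add_apply]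
    abel
  map_smul' c v := by
    ext S x
    simp only [map_smul, LinearMap.coe_mk, AddHom.coe_mk, LinearMap.sub_apply,
      LinearMap.comp_apply, op_apply, smul_assoc, LinearMap.smul_apply, RingHom.id_apply, smul_sub]

lemma derOp_apply {X : ModuleCat.{u} D.H} (v : D.VC) (S : X →ₗ[ℂ] M) (x : X) :
    derOp σ X v S x = σ v (S x) - S (D.f v • x) := rfl

variable (hσ : ∀ v v', Commute (σ v) (σ v'))

lemma derOp_comm {σ : D.VC →ₗ[ℂ] Module.End ℂ M} (hσ : ∀ v v', Commute (σ v) (σ v'))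
    (X : ModuleCat.{u} D.H) (u v : D.VC) : Commute (derOp σ X u) (derOp σ X v) := by
  ext S x
  have h := LinearMap.congr_fun (hσ u v).eq (S x)
  simp only [Module.End.mul_apply] at h
  simp only [Module.End.mul_apply, derOp_apply, map_sub, smul_smul, D.f_comm u v, h]
  abel

variable [Fintype ι]

/-- The values at `1 ∈ W` of a cochain with values in a coinduced module. -/
def evOne {i : ℕ} {X : ModuleCat.{u} D.H} (η : D.Cochain i X (D.coind σ hσ)) :
    D.VC [⋀^Fin i]→ₗ[ℂ] (X →ₗ[ℂ] M) :=
  (LinearMap.compRight ℂ (LinearMap.proj 1 ∘ₗ (D.coindEquiv σ hσ).toLinearMap)).compAlternatingMap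
    (flat η)

lemma evOne_apply {i : ℕ} {X : ModuleCat.{u} D.H} (η : D.Cochain i X (D.coind σ hσ)) (x : X)
    (v : Fin i → D.VC) : evOne σ hσ η v x = D.coindEquiv σ hσ (η x v) 1 := rfl

/-- Under evaluation at `1 ∈ W`, the complex of equivariant cochains with values in a coinduced
module becomes the Koszul complex of the commuting operators `derOp`. -/
lemma evOne_dF {i : ℕ} {X : ModuleCat.{u} D.H} (η : D.Cochain i X (D.coind σ hσ)) :
    evOne σ hσ (dF D.f η) = koszulDiff (derOp σ X) (evOne σ hσ η) := by
  ext v x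
  rw [evOne_apply, dF_apply, koszulDiff_apply, map_sum, Finset.sum_apply, LinearMap.sum_apply]
  refine Finset.sum_congr rfl fun a _ => ?_
  rw [map_zsmul, Pi.smul_apply, LinearMap.smul_apply, map_sub, Pi.sub_apply, coindEquiv_f_one]
  rfl

lemma IsEquivariant.coindEquiv_apply {i : ℕ} {X : ModuleCat.{u} D.H}
    {η : D.Cochain i X (D.coind σ hσ)} (hη : IsEquivariant η) (x : X) (v : Fin i → D.VC)
    (w : D.W) : D.coindEquiv σ hσ (η x v) w =
      evOne σ hσ η (fun a => D.act w (v a)) (D.t w • x) := by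
  rw [evOne_apply, hη, coindEquiv_t, one_mul]

lemma IsEquivariant.ext_evOne {i : ℕ} {X : ModuleCat.{u} D.H}
    {η θ : D.Cochain i X (D.coind σ hσ)} (hη : IsEquivariant η) (hθ : IsEquivariant θ)
    (h : evOne σ hσ η = evOne σ hσ θ) : η = θ := by
  ext x v
  apply (D.coindEquiv σ hσ).injective
  funext w
  rw [hη.coindEquiv_apply, hθ.coindEquiv_apply, h]

/-- Together with `IsEquivariant.ext_evOne`: equivariant cochains with values in a coinduced module
are arbitrary alternating forms with values in the linear maps from `X` to `M`. -/
lemma exists_evOne_eq {i : ℕ} {X : ModuleCat.{u} D.H} (ω : D.VC [⋀^Fin i]→ₗ[ℂ] (X →ₗ[ℂ] M)) :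
    ∃ η : D.Cochain i X (D.coind σ hσ), IsEquivariant η ∧ evOne σ hσ η = ω := by
  let η : D.Cochain i X (D.coind σ hσ) := flat.symm
    { toFun := fun v => (D.coindEquiv σ hσ).symm.toLinearMap ∘ₗ
        LinearMap.pi fun w => ω (fun a => D.act w (v a)) ∘ₗ op (D.t w) X
      map_update_add' := fun v a u u' => by
        ext x
        apply (D.coindEquiv σ hσ).injective
        funext w
        have := congrArg (fun S => S (D.t w • x))
          ((ω.compLinearMap (D.act w)).map_update_add v a u u')
        exact this
      map_update_smul' := fun v a c u => by
        ext x
        apply (D.coindEquiv σ hσ).injective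
        funext w
        have := congrArg (fun S => S (D.t w • x))
          ((ω.compLinearMap (D.act w)).map_update_smul v a c u)
        refine this.trans ?_
        rw [LinearMap.smul_apply]
        exact (congrFun ((D.coindEquiv σ hσ).map_smul c ((D.coindEquiv σ hσ).symm
          fun w => ω (fun b => D.act w (Function.update v a u b)) (D.t w • x))) w).symm
      map_eq_zero_of_eq' := fun v a b h hab => by
        ext x
        apply (D.coindEquiv σ hσ).injective
        funext w
        have := congrArg (fun S => S (D.t w • x))
          ((ω.compLinearMap (D.act w)).map_eq_zero_of_eq v h hab)
        exact this }
  have hη : ∀ x v w, D.coindEquiv σ hσ (η x v) w = ω (fun a => D.act w (v a)) (D.t w • x) := by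
    intro x v w
    exact congrFun ((D.coindEquiv σ hσ).apply_symm_apply
      (fun w => ω (fun a => D.act w (v a)) (D.t w • x))) w
  refine ⟨η, fun w x v => ?_, ?_⟩
  · apply (D.coindEquiv σ hσ).injective
    funext y
    rw [coindEquiv_t, hη, hη, smul_smul, ← t_mul]
    simp only [← act_mul]
  · ext v x
    rw [evOne_apply, hη, t_one, one_smul]
    simp only [act_one]

end Coinduced

section Monomials

/-- A basis of `V`. -/
abbrev stdBasis (D : HeckeDatum ι V₀ N) :
    Module.Basis (Module.Free.ChooseBasisIndex ℂ D.VC) ℂ D.VC :=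
  Module.Free.chooseBasis ℂ D.VC

open Classical in
/-- The action of `V` on functions of multi-indices by shifts; such functions are the linear
functionals on the symmetric algebra of `V`. -/
def shiftAct (D : HeckeDatum ι V₀ N) :
    D.VC →ₗ[ℂ] Module.End ℂ ((Module.Free.ChooseBasisIndex ℂ D.VC → ℕ) → ℂ) :=
  D.stdBasis.constr ℂ shiftOp

open Classical in
lemma shiftAct_basis (j : Module.Free.ChooseBasisIndex ℂ D.VC) :
    D.shiftAct (D.stdBasis j) = shiftOp j := D.stdBasis.constr_basis ℂ _ j

lemma shiftAct_comm (u v : D.VC) : Commute (D.shiftAct u) (D.shiftAct v) := by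
  classical
  have h1 : ∀ j, LinearMap.mulLeft ℂ (D.shiftAct (D.stdBasis j)) ∘ₗ D.shiftAct =
      LinearMap.mulRight ℂ (D.shiftAct (D.stdBasis j)) ∘ₗ D.shiftAct := by
    intro j
    refine D.stdBasis.ext fun k => ?_
    simp only [LinearMap.comp_apply, LinearMap.mulLeft_apply, LinearMap.mulRight_apply,
      shiftAct_basis]
    exact shiftOp_comm j k
  have h2 : LinearMap.mulRight ℂ (D.shiftAct v) ∘ₗ D.shiftAct =
      LinearMap.mulLeft ℂ (D.shiftAct v) ∘ₗ D.shiftAct :=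
    D.stdBasis.ext fun j => LinearMap.congr_fun (h1 j) v
  exact LinearMap.congr_fun h2 u

variable [FiniteDimensional ℝ V₀]

/-- Every linear functional on an `ℍ`-module extends to a map to functions of multi-indices that
intertwines the actions of `V`: it records the values of the functional on all monomials. -/
lemma exists_monomial_functional (Y : ModuleCat.{u} D.H) (ψ : Y →ₗ[ℂ] ℂ) :
    ∃ g : Y →ₗ[ℂ] (Module.Free.ChooseBasisIndex ℂ D.VC → ℕ) → ℂ,
      (∀ v y, g (D.f v • y) = D.shiftAct v (g y)) ∧ ∀ y, g y 0 = ψ y := by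
  classical
  let p : (Module.Free.ChooseBasisIndex ℂ D.VC → ℕ) → Module.Free.ChooseBasisIndex ℂ D.VC → D.H :=
    fun m j => D.f (D.stdBasis j) ^ m j
  have hp : ∀ m m' j k, Commute (p m j) (p m' k) := fun m m' j k =>
    Commute.pow_pow (D.f_comm _ _) _ _
  have hpw : ∀ m s, (s : Set (Module.Free.ChooseBasisIndex ℂ D.VC)).Pairwise
    (Function.onFun Commute (p m)) := fun m s j _ k _ _ => hp m m j k
  -- The monomials in the basis vectors of `V`, as elements of `ℍ`.
  let e : (Module.Free.ChooseBasisIndex ℂ D.VC → ℕ) → D.H :=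
    fun m => Finset.univ.noncommProd (p m) (hpw m _)
  have he : ∀ m j, e (Function.update m j (m j + 1)) = e m * D.f (D.stdBasis j) := by
    intro m j
    have h1 : ∀ m', e m' = (Finset.univ.erase j).noncommProd (p m') (hpw m' _) * p m' j :=
      fun m' => (Finset.noncommProd_erase_mul _ (Finset.mem_univ j) _ _ _).symm
    rw [h1, h1]
    have h2 : p (Function.update m j (m j + 1)) j = p m j * D.f (D.stdBasis j) := by
      simp only [p, Function.update_self, pow_succ]
    rw [h2, ← mul_assoc]
    congr 2
    refine Finset.noncommProd_congr rfl (fun k hk => ?_) _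
    simp only [p, Function.update_of_ne (Finset.ne_of_mem_erase hk)]
  let g : Y →ₗ[ℂ] (Module.Free.ChooseBasisIndex ℂ D.VC → ℕ) → ℂ :=
    LinearMap.pi fun m => ψ ∘ₗ op (e m) Y
  have hg : ∀ y m, g y m = ψ (e m • y) := fun _ _ => rfl
  refine ⟨g, fun v y => ?_, fun y => ?_⟩
  · have h1 : g ∘ₗ (LinearMap.toSpanSingleton D.H Y y).restrictScalars ℂ ∘ₗ D.f =
        D.shiftAct.flip (g y) := by
      refine D.stdBasis.ext fun j => ?_
      funext m
      rw [LinearMap.flip_apply, shiftAct_basis, shiftOp_apply, hg, he, mul_smul]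
      rfl
    exact LinearMap.congr_fun h1 v
  · rw [hg]
    have : e 0 = 1 := by
      refine (Finset.noncommProd_congr (g := fun _ => 1) rfl (fun k _ => ?_) _).trans ?_
      · simp [p]
      · exact (Finset.noncommProd_eq_pow_card _ _ _ 1 (fun _ _ => rfl)).trans (one_pow _)
    rw [this, one_smul]

/-- The Koszul complex of linear maps from `X` to functions of multi-indices is acyclic, since the
operators in the basis directions have the right inverses `shiftInv`. -/
lemma shiftAct_acyclic (X : ModuleCat.{u} D.H) {i : ℕ}
    (ω : D.VC [⋀^Fin (i + 1)]→ₗ[ℂ] (X →ₗ[ℂ] ((Module.Free.ChooseBasisIndex ℂ D.VC → ℕ) → ℂ)))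
    (hω : koszulDiff (derOp D.shiftAct X) ω = 0) :
    ∃ θ, koszulDiff (derOp D.shiftAct X) θ = ω := by
  classical
  have h : ∀ j, derOp D.shiftAct X (D.stdBasis j) = shiftDer j (op (D.f (D.stdBasis j)) X) := by
    intro j
    ext S x
    rw [derOp_apply, shiftAct_basis]
    rfl
  refine exists_koszulDiff_eq D.stdBasis _ (derOp_comm shiftAct_comm X)
    (fun j => shiftInv j (op (D.f (D.stdBasis j)) X)) (fun j => ?_) (fun j k hk => ?_) ω hω
  · rw [h, shiftDer_mul_shiftInv]
  · rw [h]
    refine shiftDer_mul_shiftInv_of_ne hk ?_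
    ext x
    simp only [Module.End.mul_apply, op_apply, smul_smul, D.f_comm]

variable [Fintype ι]

/-- A coinduced module in which all cocycles of positive degree are coboundaries. -/
abbrev cogen (D : HeckeDatum ι V₀ N) : ModuleCat.{u} D.H := D.coind D.shiftAct shiftAct_comm

lemma cogen_acyclic {X : ModuleCat.{u} D.H} {i : ℕ} {η : D.Cochain (i + 1) X D.cogen}
    (hη : IsCocycle η) : ∃ θ : D.Cochain i X D.cogen, IsEquivariant θ ∧ dF D.f θ = η := by
  rw [isCocycle_iff] at hη
  obtain ⟨θ', hθ'⟩ := shiftAct_acyclic X (evOne D.shiftAct shiftAct_comm η) (by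
    rw [← evOne_dF, hη.2]; rfl)
  obtain ⟨θ, hθ, rfl⟩ := exists_evOne_eq D.shiftAct shiftAct_comm θ'
  refine ⟨θ, hθ, IsEquivariant.ext_evOne _ _ hθ.dF_f hη.1 ?_⟩
  rw [evOne_dF, hθ']

/-- A submodule contains `z` if every map to the acyclic module `cogen` that vanishes on the
submodule kills `z`. -/
lemma mem_of_forall_cogen {Y : ModuleCat.{u} D.H} (I : Submodule D.H Y) (z : Y)
    (h : ∀ Φ : Y →ₗ[D.H] D.cogen, (∀ y ∈ I, Φ y = 0) → Φ z = 0) : z ∈ I := by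
  rw [← Submodule.Quotient.mk_eq_zero, ← Module.forall_dual_apply_eq_zero_iff ℂ]
  intro ψ
  obtain ⟨g, hg, hgψ⟩ := exists_monomial_functional (ModuleCat.of D.H (Y ⧸ I)) ψ
  obtain ⟨Φ, hΦ⟩ := D.exists_hom_coind D.shiftAct shiftAct_comm _ g hg
  have h1 := h (Φ ∘ₗ I.mkQ) (fun y hy => by
    rw [LinearMap.comp_apply, Submodule.mkQ_apply, (Submodule.Quotient.mk_eq_zero I).2 hy]
    exact map_zero Φ)
  have h2 := hΦ (I.mkQ z)
  rw [LinearMap.comp_apply] at h1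
  rw [h1] at h2
  refine (hgψ (I.mkQ z)).symm.trans ?_
  rw [← h2, map_zero]
  rfl

/-- The Koszul complex is exact. A map `Φ` to `cogen` that vanishes on the image of the differential
is a cocycle, hence factors through the next differential and kills the cycle `z`; by
`mem_of_forall_cogen` this puts `z` in the image. -/
lemma koszul_exact (X : ModuleCat.{u} D.H) (i : ℕ) (z : koszulObj X (i + 1))
    (hz : koszulDiffHom X i z = 0) : ∃ y, koszulDiffHom X (i + 1) y = z := by
  refine mem_of_forall_cogen (LinearMap.range (koszulDiffHom X (i + 1))) z fun Φ hΦ => ?_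
  have hc : IsCocycle (postComp (Φ.restrictScalars ℂ) (koszulUniv X (i + 1))) := by
    rw [isCocycle_iff]
    refine ⟨isEquivariant_koszulUniv.postComp Φ, ?_⟩
    ext x v
    rw [← comp_koszulDiffHom_univ]
    exact hΦ _ ⟨_, rfl⟩
  obtain ⟨θ, hθ, h⟩ := cogen_acyclic hc
  have h1 : Φ = koszulLift θ hθ ∘ₗ koszulDiffHom X i := by
    refine koszulObj_hom_ext fun x v => ?_
    rw [LinearMap.comp_apply, comp_koszulDiffHom_univ]
    have h2 : postComp ((koszulLift θ hθ).restrictScalars ℂ) (koszulUniv X i) = θ := by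
      ext x v
      exact koszulLift_univ θ hθ x v
    rw [h2, h]
    rfl
  rw [h1, LinearMap.comp_apply, hz, map_zero]

lemma koszul_exact_zero (X : ModuleCat.{u} D.H) (z : koszulObj X 0) (hz : koszulAug X z = 0) :
    ∃ y, koszulDiffHom X 0 y = z := by
  refine mem_of_forall_cogen (LinearMap.range (koszulDiffHom X 0)) z fun Φ hΦ => ?_
  have hc : IsCocycle (postComp (Φ.restrictScalars ℂ) (koszulUniv X 0)) := by
    rw [isCocycle_iff]
    refine ⟨isEquivariant_koszulUniv.postComp Φ, ?_⟩
    ext x v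
    rw [← comp_koszulDiffHom_univ]
    exact hΦ _ ⟨_, rfl⟩
  obtain ⟨g, hg⟩ := exists_eq_ofLinear hc
  have h1 : Φ = g ∘ₗ koszulAug X := by
    refine koszulObj_hom_ext fun x v => ?_
    rw [LinearMap.comp_apply, koszulAug_univ]
    exact DFunLike.congr_fun (DFunLike.congr_fun hg x) v
  rw [h1, LinearMap.comp_apply, hz, map_zero]

lemma koszulComplex_exactAt_succ (X : ModuleCat.{u} D.H) (i : ℕ) :
    (koszulComplex X).ExactAt (i + 1) := by
  rw [HomologicalComplex.exactAt_iff' _ (i + 1 + 1) (i + 1) i (by simp) (by simp),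
    ShortComplex.moduleCat_exact_iff]
  intro x hx
  change (koszulComplex X).d (i + 1) i x = 0 at hx
  rw [koszulComplex_d] at hx
  obtain ⟨y, hy⟩ := koszul_exact X i x hx
  refine ⟨y, ?_⟩
  change (koszulComplex X).d (i + 1 + 1) (i + 1) y = x
  rw [koszulComplex_d]
  exact hy

lemma quasiIso_koszulπ (X : ModuleCat.{u} D.H) : QuasiIso (koszulπ X) := by
  refine ⟨fun n => ?_⟩
  cases n with
  | zero =>
    rw [ChainComplex.quasiIsoAt₀_iff, ShortComplex.quasiIso_iff_of_zeros' _ rfl rfl rfl]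
    constructor
    · rw [ShortComplex.moduleCat_exact_iff]
      intro x hx
      change (koszulπ X).f 0 x = 0 at hx
      rw [koszulπ_f_zero] at hx
      obtain ⟨y, hy⟩ := koszul_exact_zero X x hx
      refine ⟨y, ?_⟩
      change (koszulComplex X).d 1 0 y = x
      rw [koszulComplex_d]
      exact hy
    · change Epi ((koszulπ X).f 0)
      rw [koszulπ_f_zero]
      refine (ModuleCat.epi_iff_surjective (ModuleCat.ofHom (koszulAug X))).2 fun x => ?_
      exact ⟨koszulUniv X 0 x ![], koszulAug_univ x ![]⟩
  | succ n =>
    rw [quasiIsoAt_iff_exactAt']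
    · exact koszulComplex_exactAt_succ X n
    · exact ChainComplex.exactAt_succ_single_obj _ _

/-- The Koszul resolution of `X`. -/
def koszulRes (X : ModuleCat.{u} D.H) : ProjectiveResolution X where
  complex := koszulComplex X
  projective _ := projective_koszulObj
  π := koszulπ X
  quasiIso := quasiIso_koszulπ X

end Monomials

end HeckeDatum

/-! ### Yoneda products in terms of projective resolutions -/

namespace CategoryTheory.ProjectiveResolution

open CochainComplex HomComplex Abelian

universe w' v' u'

variable {C : Type u'} [Category.{v'} C] [Abelian C] {X Y Z : C}
  (R : ProjectiveResolution X) (S : ProjectiveResolution Y) {i j n : ℕ}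

/-- The cochain of degree `i` between the complexes of two resolutions that is given by maps
`R_{i + b} ⟶ S_b`. -/
def liftCochain (φ : ∀ a b, i + b = a → (R.complex.X a ⟶ S.complex.X b)) :
    Cochain R.cochainComplex S.cochainComplex (i : ℤ) :=
  Cochain.mk fun p q hpq =>
    if h : q ≤ 0 then
      (R.cochainComplexXIso p (-p).toNat (by omega)).hom ≫ φ (-p).toNat (-q).toNat (by omega) ≫
        (S.cochainComplexXIso q (-q).toNat (by omega)).inv
    else 0

lemma liftCochain_v (φ : ∀ a b, i + b = a → (R.complex.X a ⟶ S.complex.X b)) (p q : ℤ)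
    (hpq : p + i = q) (a b : ℕ) (ha : -(a : ℤ) = p) (hb : -(b : ℤ) = q) :
    (liftCochain R S φ).v p q hpq = (R.cochainComplexXIso p a ha).hom ≫ φ a b (by omega) ≫
      (S.cochainComplexXIso q b hb).inv := by
  obtain rfl : a = (-p).toNat := by omega
  obtain rfl : b = (-q).toNat := by omega
  rw [liftCochain, Cochain.mk_v, dif_pos (by omega)]

/-- The cocycle given by maps `R_{i + b} ⟶ S_b` that commute with the differentials up to the
sign `(-1)ⁱ`. -/
def liftCocycle (φ : ∀ a b, i + b = a → (R.complex.X a ⟶ S.complex.X b))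
    (hφ : ∀ a b (h : i + b = a), φ (a + 1) (b + 1) (by omega) ≫ S.complex.d (b + 1) b =
      (-1 : ℤ) ^ i • R.complex.d (a + 1) a ≫ φ a b h) :
    Cocycle R.cochainComplex S.cochainComplex (i : ℤ) :=
  Cocycle.mk (liftCochain R S φ) (i + 1) rfl (by
    ext p q hpq
    rw [Cochain.zero_v, δ_v (i : ℤ) (i + 1) rfl _ p q hpq (q - 1) (p + 1) rfl rfl]
    by_cases hq : q ≤ 0
    · obtain ⟨b, rfl⟩ := Int.exists_eq_neg_ofNat hq
      rw [liftCochain_v R S φ p (-b - 1) _ (i + b + 1) (b + 1) (by omega) (by omega),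
        liftCochain_v R S φ (p + 1) (-b) _ (i + b) b (by omega) rfl,
        R.cochainComplex_d p (p + 1) (i + b + 1) (i + b) (by omega) (by omega),
        S.cochainComplex_d (-b - 1) (-b) (b + 1) b (by omega) rfl]
      simp only [Category.assoc, Iso.inv_hom_id_assoc]
      rw [reassoc_of% (hφ (i + b) b rfl)]
      have h1 : ((i : ℤ) + 1).negOnePow = -(i : ℤ).negOnePow := by rw [Int.negOnePow_succ]
      have h2 : ((i : ℤ).negOnePow : ℤ) = (-1 : ℤ) ^ i := by
        rw [Int.negOnePow_def, zpow_natCast]; simp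
      rw [h1, Units.smul_def]
      push_cast
      rw [h2]
      simp only [Category.assoc, Preadditive.comp_zsmul, Preadditive.zsmul_comp, neg_smul]
      abel
    · exact (CochainComplex.isZero_of_isStrictlyLE S.cochainComplex 0 q (by omega)).eq_of_tgt _ _)

/-- The composition of morphisms to shifted complexes corresponds to that of cocycles. -/
lemma equivHomShift_comp_v {K L M : CochainComplex C ℤ} {a b c : ℤ} (α : Cocycle K L a)
    (β : Cocycle L M b) (h : b + a = c) (p q r : ℤ) (hpq : p + a = q) (hqr : q + b = r)
    (hpr : p + c = r) :
    (Cocycle.equivHomShift (ShiftedHom.comp (Cocycle.equivHomShift.symm α)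
      (Cocycle.equivHomShift.symm β) h)).1.v p r hpr = α.1.v p q hpq ≫ β.1.v q r hqr := by
  subst hpq hqr
  rw [Cocycle.equivHomShift_apply, Cocycle.equivHomShift_symm_apply,
    Cocycle.equivHomShift_symm_apply, Cocycle.rightUnshift_coe,
    Cochain.rightUnshift_v _ _ _ _ _ _ _ (add_zero p), Cocycle.ofHom_coe, Cochain.ofHom_v,
    ShiftedHom.comp, HomologicalComplex.comp_f, HomologicalComplex.comp_f,
    shiftFunctorAdd'_inv_app_f', CochainComplex.shiftFunctor_map_f']
  simp [Cocycle.homOf_f, Cochain.rightShift_v _ _ _ _ _ _ _ _ rfl]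
  erw [Category.comp_id, Category.comp_id]
  simp

lemma π'_f_zero_eq : S.π'.f 0 = (S.cochainComplexXIso 0 0 rfl).hom ≫ (S.π.f 0 ≫
    (HomologicalComplex.singleObjXSelf (ComplexShape.down ℕ) 0 Y).hom) ≫
      (HomologicalComplex.singleObjXSelf (ComplexShape.up ℤ) 0 Y).inv := by
  rw [π'_f_zero]
  congr 1
  exact (congrArg (· ≫ _) (Category.comp_id (S.π.f 0))).symm

/-- The cancellation of an isomorphism with its inverse, stated for an arbitrary category so that it
can be used up to definitional equality of objects. -/
lemma comp_inv_comp_hom {T : Type*} [Category* T] {A B B' E F : T} (a : A ⟶ B) (f : B ⟶ B')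
    (e : E ≅ B') (r : B' ⟶ F) :
    (a ≫ f ≫ e.inv) ≫ e.hom ≫ r = a ≫ f ≫ r := by simp

/-- In a composite of two morphisms to shifted objects, written with conjugations by the
isomorphisms of the derived category, the isomorphisms in the middle cancel. -/
lemma shiftedHom_comp_of_cancel {T : Type*} [Category* T] [HasShift T ℤ] {X X' Y' Y₁ Y₀ Z' Z : T}
    {a b c : ℤ} (x : X ⟶ X') (F : ShiftedHom X' Y' a) (p : Y' ⟶ Y₁) (q : Y₁ ⟶ Y₀) (r : Y₀ ⟶ Y')
    (hr : p ≫ q ≫ r = 𝟙 Y') (G : ShiftedHom Y' Z' b) (z : Z' ⟶ Z) (h : b + a = c) :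
    ((ShiftedHom.mk₀ (0 : ℤ) rfl x).comp ((F.comp (ShiftedHom.mk₀ (0 : ℤ) rfl p) (zero_add a)).comp
      (ShiftedHom.mk₀ (0 : ℤ) rfl q) (zero_add a)) (add_zero a)).comp
      ((ShiftedHom.mk₀ (0 : ℤ) rfl r).comp (G.comp (ShiftedHom.mk₀ (0 : ℤ) rfl z) (zero_add b))
        (add_zero b)) h =
    (ShiftedHom.mk₀ (0 : ℤ) rfl x).comp ((F.comp G h).comp (ShiftedHom.mk₀ (0 : ℤ) rfl z)
      (zero_add c)) (add_zero c) := by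
  simp only [ShiftedHom.mk₀_comp, ShiftedHom.comp_mk₀]
  simp only [ShiftedHom.comp, Functor.map_comp, Category.assoc]
  rw [← Functor.map_comp_assoc _ q r, ← Functor.map_comp_assoc _ p, hr, Functor.map_id,
    Category.id_comp]
  congr 3
  exact (shiftFunctorAdd' T b a c h).inv.naturality z

/-- The cocycle of a map `f : R_i ⟶ Y` is the cocycle of a lift of `f`, followed by the augmentation
of `S`. -/
lemma toSingleMk_eq_postcomp (φ : ∀ a b, i + b = a → (R.complex.X a ⟶ S.complex.X b))
    (hφ : ∀ a b (h : i + b = a), φ (a + 1) (b + 1) (by omega) ≫ S.complex.d (b + 1) b =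
      (-1 : ℤ) ^ i • R.complex.d (a + 1) a ≫ φ a b h)
    (f : R.complex.X i ⟶ Y) (hf : φ i 0 rfl ≫ S.π.f 0 ≫
      (HomologicalComplex.singleObjXSelf (ComplexShape.down ℕ) 0 Y).hom = f)
    (hd : R.cochainComplex.d (-(i + 1 : ℕ)) (-i) ≫ (R.cochainComplexXIso (-i) i rfl).hom ≫ f = 0) :
    Cocycle.toSingleMk ((R.cochainComplexXIso (-i) i rfl).hom ≫ f) (by simp)
      (-(i + 1 : ℕ)) (by omega) hd = (liftCocycle R S φ hφ).postcomp S.π' := by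
  ext : 1
  apply (Cochain.toSingleEquiv (p := -i) (q := 0) (n := i) (by omega)).injective
  have h0 : -(i : ℤ) + i = 0 := by omega
  change (Cochain.toSingleMk ((R.cochainComplexXIso (-i) i rfl).hom ≫ f) h0).v (-i) 0 h0 ≫ _ =
    ((liftCochain R S φ).comp (Cochain.ofHom S.π') (add_zero _)).v (-i) 0 h0 ≫ _
  rw [Cochain.toSingleMk_v, Cochain.comp_v _ _ (add_zero _) (-i) 0 0 (by omega) (by omega),
    liftCochain_v R S φ (-i) 0 _ i 0 rfl rfl, Cochain.ofHom_v, S.π'_f_zero_eq, ← hf]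
  refine congrArg (· ≫ _) (Eq.trans ?_ (comp_inv_comp_hom _ _ _ _).symm)
  simp only [Category.assoc]
  rfl

/-- The composite of the cocycle of a lift with the cocycle of `g : S_j ⟶ Z`. -/
lemma liftCocycle_comp_toSingleMk (φ : ∀ a b, i + b = a → (R.complex.X a ⟶ S.complex.X b))
    (hφ : ∀ a b (h : i + b = a), φ (a + 1) (b + 1) (by omega) ≫ S.complex.d (b + 1) b =
      (-1 : ℤ) ^ i • R.complex.d (a + 1) a ≫ φ a b h)
    (g : S.complex.X j ⟶ Z) (hij : i + j = n)
    (hg : S.cochainComplex.d (-(j + 1 : ℕ)) (-j) ≫ (S.cochainComplexXIso (-j) j rfl).hom ≫ g = 0)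
    (hg' : R.cochainComplex.d (-(n + 1 : ℕ)) (-n) ≫
      (R.cochainComplexXIso (-n) n rfl).hom ≫ φ n j hij ≫ g = 0) :
    ShiftedHom.comp (Cocycle.equivHomShift.symm (liftCocycle R S φ hφ))
      (Cocycle.equivHomShift.symm (Cocycle.toSingleMk ((S.cochainComplexXIso (-j) j rfl).hom ≫ g)
        (by simp : -(j : ℤ) + j = 0) (-(j + 1 : ℕ)) (by omega) hg))
      (show (j : ℤ) + i = n by omega) =
    Cocycle.equivHomShift.symm (Cocycle.toSingleMk
      ((R.cochainComplexXIso (-n) n rfl).hom ≫ φ n j hij ≫ g)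
        (by simp : -(n : ℤ) + n = 0) (-(n + 1 : ℕ)) (by omega)
        hg') := by
  apply Cocycle.equivHomShift.injective
  rw [AddEquiv.apply_symm_apply]
  ext : 1
  apply (Cochain.toSingleEquiv (p := -n) (q := 0) (n := n) (by omega)).injective
  have h0 : -(n : ℤ) + n = 0 := by omega
  have h1 : -(j : ℤ) + j = 0 := by omega
  refine (congrArg (· ≫ _) (equivHomShift_comp_v (liftCocycle R S φ hφ) _ _ (-n) (-j) 0
    (by omega) h1 h0)).trans ?_
  change ((liftCochain R S φ).v (-n) (-j) _ ≫ (Cochain.toSingleMk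
    ((S.cochainComplexXIso (-j) j rfl).hom ≫ g) h1).v (-j) 0 h1) ≫ _ =
    (Cochain.toSingleMk ((R.cochainComplexXIso (-n) n rfl).hom ≫ φ n j hij ≫ g) h0).v (-n) 0 h0 ≫ _
  rw [Cochain.toSingleMk_v, Cochain.toSingleMk_v, liftCochain_v R S φ (-n) (-j) _ n j rfl rfl]
  refine congrArg (· ≫ _) (Eq.trans ?_ (Eq.trans (comp_inv_comp_hom
    (R.cochainComplexXIso (-n) n rfl).hom (φ n j hij) (S.cochainComplexXIso (-j) j rfl)
    (g ≫ (HomologicalComplex.singleObjXSelf (ComplexShape.up ℤ) 0 Z).inv)) ?_))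
  · exact congrArg (_ ≫ ·) (Category.assoc _ _ _)
  · simp only [Category.assoc]
    rfl

variable [HasExt.{w'} C]

/-- The Yoneda product of the classes of two cocycles `f` and `g` on projective resolutions, in
terms of a lift of `f` to a family of maps `R_{i + b} ⟶ S_b`. -/
lemma extMk_comp_extMk (φ : ∀ a b, i + b = a → (R.complex.X a ⟶ S.complex.X b))
    (hφ : ∀ a b (h : i + b = a), φ (a + 1) (b + 1) (by omega) ≫ S.complex.d (b + 1) b =
      (-1 : ℤ) ^ i • R.complex.d (a + 1) a ≫ φ a b h)
    (f : R.complex.X i ⟶ Y) (hf : φ i 0 rfl ≫ S.π.f 0 ≫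
      (HomologicalComplex.singleObjXSelf (ComplexShape.down ℕ) 0 Y).hom = f) (g : S.complex.X j ⟶ Z)
    (hij : i + j = n)
    (hdf : R.complex.d (i + 1) i ≫ f = 0) (hdg : S.complex.d (j + 1) j ≫ g = 0)
    (hdg' : R.complex.d (n + 1) n ≫ φ n j hij ≫ g = 0) :
    (R.extMk f (i + 1) rfl hdf).comp (S.extMk g (j + 1) rfl hdg) hij =
      R.extMk (φ n j hij ≫ g) (n + 1) rfl hdg' := by
  have := HasDerivedCategory.standard C
  have hg : S.cochainComplex.d (-(j + 1 : ℕ)) (-j) ≫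
      (S.cochainComplexXIso (-j) j rfl).hom ≫ g = 0 := by
    rw [S.cochainComplex_d _ _ (j + 1) j rfl rfl]
    simp [hdg]
  have hg' : R.cochainComplex.d (-(n + 1 : ℕ)) (-n) ≫
      (R.cochainComplexXIso (-n) n rfl).hom ≫ φ n j hij ≫ g = 0 := by
    rw [R.cochainComplex_d _ _ (n + 1) n rfl rfl]
    simp [hdg']
  ext
  rw [Ext.comp_hom, extMk_hom, extMk_hom, extMk_hom,
    toSingleMk_eq_postcomp R S φ hφ f hf, ← liftCocycle_comp_toSingleMk R S φ hφ g hij hg hg',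
    ShiftedHom.map_comp, Cocycle.equivHomShift_symm_postcomp, ← ShiftedHom.comp_mk₀ _ 0 rfl,
    ShiftedHom.map_comp, ShiftedHom.map_mk₀]
  exact shiftedHom_comp_of_cancel _ _ _ _ _ (by simp) _ _ _

end CategoryTheory.ProjectiveResolution

namespace HeckeDatum

variable {ι V₀ N : Type u} [AddCommGroup V₀] [Module ℝ V₀] [AddCommGroup N] [Module ℝ N]
  {D : HeckeDatum ι V₀ N}

/-! ### Classes of cocycles -/

/-- The space of cocycles of degree `i`. -/
def cocycles (i : ℕ) (X Y : ModuleCat.{u} D.H) : Submodule ℂ (D.Cochain i X Y) where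
  carrier := {η | IsCocycle η}
  zero_mem' := isCocycle_iff.2 ⟨(equivariants i X Y).zero_mem, map_zero _⟩
  add_mem' ha hb := by
    have ha := isCocycle_iff.1 ha
    have hb := isCocycle_iff.1 hb
    exact isCocycle_iff.2 ⟨(equivariants i X Y).add_mem ha.1 hb.1, by
      rw [map_add, ha.2, hb.2, add_zero]⟩
  smul_mem' c a ha := by
    have ha := isCocycle_iff.1 ha
    exact isCocycle_iff.2 ⟨(equivariants i X Y).smul_mem c ha.1, by
      rw [map_smul, ha.2, smul_zero]⟩

lemma mem_cocycles {i : ℕ} {X Y : ModuleCat.{u} D.H} {η : D.Cochain i X Y} :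
    η ∈ cocycles i X Y ↔ IsCocycle η := Iff.rfl

section Res

variable [FiniteDimensional ℝ V₀] [Fintype ι]

variable {i : ℕ} {X : ModuleCat.{u} D.H}

/-- The morphism from a term of the Koszul resolution given by an equivariant cochain. -/
def koszulHom {Y : ModuleCat.{u} D.H} (η : D.Cochain i X Y) (hη : IsEquivariant η) :
    (koszulRes X).complex.X i ⟶ Y :=
  ModuleCat.ofHom (koszulLift η hη)

variable (X i) in
/-- The universal equivariant cochain, with values in a term of the Koszul resolution. -/
def koszulU : D.Cochain i X ((koszulRes X).complex.X i) := koszulUniv X i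

lemma isEquivariant_koszulU : IsEquivariant (koszulU i X) := isEquivariant_koszulUniv

lemma koszulHom_univ {Y : ModuleCat.{u} D.H} (η : D.Cochain i X Y)
    (hη : IsEquivariant η) (x : X) (v : Fin i → D.VC) :
    koszulHom η hη (koszulU i X x v) = η x v :=
  koszulLift_univ η hη x v

lemma koszulRes_hom_ext {Y : ModuleCat.{u} D.H} {φ ψ : (koszulRes X).complex.X i ⟶ Y}
    (h : ∀ x v, φ (koszulU i X x v) = ψ (koszulU i X x v)) : φ = ψ :=
  ModuleCat.hom_ext (koszulObj_hom_ext h)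

variable (X i) in
lemma koszulRes_d :
    (koszulRes X).complex.d (i + 1) i = ModuleCat.ofHom (koszulDiffHom X i) :=
  koszulComplex_d X i

lemma koszulRes_d_univ (x : X) (v : Fin (i + 1) → D.VC) :
    (koszulRes X).complex.d (i + 1) i (koszulU (i + 1) X x v) = dF D.f (koszulU i X) x v := by
  rw [koszulRes_d]
  exact koszulDiffHom_univ x v

lemma apply_koszulRes_d_univ {Y : ModuleCat.{u} D.H}
    (φ : (koszulRes X).complex.X i ⟶ Y) (x : X) (v : Fin (i + 1) → D.VC) :
    φ ((koszulRes X).complex.d (i + 1) i (koszulU (i + 1) X x v)) =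
      dF D.f (postComp (φ.hom.restrictScalars ℂ) (koszulU i X)) x v := by
  rw [koszulRes_d_univ, dF_postComp]
  rfl

lemma postComp_koszulHom {Y : ModuleCat.{u} D.H} (η : D.Cochain i X Y)
    (hη : IsEquivariant η) :
    postComp ((koszulHom η hη).hom.restrictScalars ℂ) (koszulU i X) = η := by
  ext x v
  exact koszulHom_univ η hη x v

lemma d_comp_koszulHom {Y : ModuleCat.{u} D.H} {η : D.Cochain i X Y}
    (hη : IsCocycle η) :
    (koszulRes X).complex.d (i + 1) i ≫ koszulHom η hη.equivariant = 0 := by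
  refine koszulRes_hom_ext fun x v => ?_
  rw [ModuleCat.comp_apply, apply_koszulRes_d_univ, postComp_koszulHom, (isCocycle_iff.1 hη).2]
  rfl

lemma exists_eq_koszulHom {Y : ModuleCat.{u} D.H} (φ : (koszulRes X).complex.X i ⟶ Y)
    (hφ : (koszulRes X).complex.d (i + 1) i ≫ φ = 0) :
    ∃ (η : D.Cochain i X Y) (hη : IsCocycle η), φ = koszulHom η hη.equivariant := by
  have he := (isEquivariant_koszulU (X := X) (i := i)).postComp φ.hom
  refine ⟨postComp (φ.hom.restrictScalars ℂ) (koszulU i X), isCocycle_iff.2 ⟨he, ?_⟩, ?_⟩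
  · ext x v
    rw [← apply_koszulRes_d_univ, ← ModuleCat.comp_apply, hφ]
    rfl
  · refine koszulRes_hom_ext fun x v => ?_
    rw [koszulHom_univ]
    rfl

/-- The class of a cocycle. -/
def koszulCls {Y : ModuleCat.{u} D.H} (η : D.Cochain i X Y) (hη : IsCocycle η) :
    Abelian.Ext X Y i :=
  (koszulRes X).extMk (koszulHom η hη.equivariant) (i + 1) rfl (d_comp_koszulHom hη)

lemma koszulCls_eq {Y : ModuleCat.{u} D.H} (η : D.Cochain i X Y) (hη : IsCocycle η) :
    koszulCls η hη = (koszulRes X).extMk (koszulHom η hη.equivariant) (i + 1) rfl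
      (d_comp_koszulHom hη) := rfl

lemma koszulCls_surjective {Y : ModuleCat.{u} D.H} (c : Abelian.Ext X Y i) :
    ∃ (η : D.Cochain i X Y) (hη : IsCocycle η), koszulCls η hη = c := by
  obtain ⟨φ, hφ, rfl⟩ := (koszulRes X).extMk_surjective c (i + 1) rfl
  obtain ⟨η, hη, rfl⟩ := exists_eq_koszulHom φ hφ
  exact ⟨η, hη, rfl⟩

variable (i X) in
/-- The class map from cocycles to `Ext`. -/
def cls (Y : ModuleCat.{u} D.H) : cocycles i X Y →ₗ[ℂ] Abelian.Ext X Y i where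
  toFun η := koszulCls η.1 (mem_cocycles.1 η.2)
  map_add' η θ := by
    rw [koszulCls_eq, koszulCls_eq, koszulCls_eq, ProjectiveResolution.add_extMk]
    congr 1
    refine koszulRes_hom_ext fun x v => ?_
    change _ = koszulHom η.1 (mem_cocycles.1 η.2).equivariant (koszulU i X x v) +
      koszulHom θ.1 (mem_cocycles.1 θ.2).equivariant (koszulU i X x v)
    rw [koszulHom_univ, koszulHom_univ, koszulHom_univ]
    rfl
  map_smul' c η := by
    rw [RingHom.id_apply, Abelian.Ext.smul_eq_comp_mk₀, koszulCls_eq, koszulCls_eq,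
      ProjectiveResolution.extMk_comp_mk₀]
    congr 1
    refine koszulRes_hom_ext fun x v => ?_
    change _ = c • koszulHom η.1 (mem_cocycles.1 η.2).equivariant (koszulU i X x v)
    rw [koszulHom_univ, koszulHom_univ]
    rfl

lemma cls_apply {Y : ModuleCat.{u} D.H} (η : cocycles i X Y) :
    cls i X Y η = koszulCls η.1 (mem_cocycles.1 η.2) := rfl

variable (i X) in
lemma cls_surjective (Y : ModuleCat.{u} D.H) : Function.Surjective (cls i X Y) := by
  intro c
  obtain ⟨η, hη, rfl⟩ := koszulCls_surjective c
  exact ⟨⟨η, hη⟩, rfl⟩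

/-- In positive degree, the class of a cocycle vanishes if and only if it is the differential of an
equivariant cochain. -/
lemma cls_succ_eq_zero_iff {Y : ModuleCat.{u} D.H} (η : cocycles (i + 1) X Y) :
    cls (i + 1) X Y η = 0 ↔ ∃ θ : D.Cochain i X Y, IsEquivariant θ ∧ dF D.f θ = η.1 := by
  rw [cls_apply, koszulCls_eq, ProjectiveResolution.extMk_eq_zero_iff _ _ _ _ _ i rfl]
  constructor
  · rintro ⟨φ, hφ⟩
    refine ⟨postComp (φ.hom.restrictScalars ℂ) (koszulU i X),
      isEquivariant_koszulU.postComp φ.hom, ?_⟩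
    ext x v
    rw [← apply_koszulRes_d_univ, ← ModuleCat.comp_apply, hφ, koszulHom_univ]
  · rintro ⟨θ, hθ, h⟩
    refine ⟨koszulHom θ hθ, koszulRes_hom_ext fun x v => ?_⟩
    rw [ModuleCat.comp_apply, apply_koszulRes_d_univ, postComp_koszulHom, koszulHom_univ, h]

lemma cls_zero_eq_zero_iff {Y : ModuleCat.{u} D.H} (η : cocycles 0 X Y) :
    cls 0 X Y η = 0 ↔ η.1 = 0 := by
  refine ⟨fun h => ?_, fun h => ?_⟩
  · rw [cls_apply, koszulCls_eq, ← (koszulRes X).extEquivCohomologyClass.apply_eq_iff_eq,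
      ProjectiveResolution.extEquivCohomologyClass_extMk,
      ProjectiveResolution.extEquivCohomologyClass_zero,
      CochainComplex.HomComplex.CohomologyClass.mk_eq_zero_iff,
      CochainComplex.HomComplex.Cocycle.toSingleMk_mem_coboundaries_iff _ _ _ _ _ 1 (by simp)] at h
    obtain ⟨g, hg⟩ := h
    have hz : g = 0 :=
      (CochainComplex.isZero_of_isStrictlyLE (koszulRes X).cochainComplex 0 1
        (by simp)).eq_of_src _ _
    rw [hz, Limits.comp_zero] at hg
    have h1 : koszulHom η.1 (mem_cocycles.1 η.2).equivariant = 0 := by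
      rw [← cancel_epi ((koszulRes X).cochainComplexXIso (-(0 : ℕ)) 0 rfl).hom, ← hg,
        Limits.comp_zero]
    ext x v
    rw [← koszulHom_univ η.1 η.2.equivariant, h1]
    rfl
  · have : η = 0 := Subtype.ext h
    rw [this, map_zero]

/-- A chain map from the Koszul resolution, given by its values on the generators. -/
def koszulLiftHom {R : ProjectiveResolution X} (F : KoszulLift R) :
    (koszulRes X).complex ⟶ R.complex where
  f i := koszulHom (F.app i) (F.equivariant i)
  comm' := by
    intro a i h
    obtain rfl : i + 1 = a := h
    refine koszulRes_hom_ext fun x v => ?_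
    rw [ModuleCat.comp_apply, ModuleCat.comp_apply, apply_koszulRes_d_univ,
      postComp_koszulHom, koszulHom_univ, F.d_app, dF_f_apply]

/-- A cocycle represents a class if and only if the class is that of the cocycle on the Koszul
resolution: a chain map from the Koszul resolution over the identity of `X` does not change the
class. -/
lemma represents_iff {Y : ModuleCat.{u} D.H} {η : D.Cochain i X Y}
    {c : Abelian.Ext X Y i} : Represents η c ↔ ∃ hη : IsCocycle η, koszulCls η hη = c := by
  constructor
  · rintro ⟨hη, R, F, ζ, hζ, hc, h⟩
    refine ⟨hη, ?_⟩
    -- Both resolutions compute the same class, as the chain map lifts the identity of `X`.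
    let φ : ProjectiveResolution.Hom (koszulRes X) R (𝟙 X) :=
      { hom := koszulLiftHom F
        hom_f_zero_comp_π_f_zero := by
          rw [CategoryTheory.Functor.map_id, HomologicalComplex.id_f, Category.comp_id]
          refine koszulRes_hom_ext fun x v => ?_
          refine ((congrArg (R.π.f 0) (koszulHom_univ _ _ x v)).trans (F.π_app x v)).trans ?_
          exact ((congrArg (fun φ => φ.hom (koszulU 0 X x v)) (koszulπ_f_zero X)).trans
            (koszulAug_univ x v)).symm }
    have h1 := ProjectiveResolution.mk₀_comp_extMk ζ (i + 1) rfl hζ φ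
    rw [Abelian.Ext.mk₀_id_comp, hc] at h1
    rw [h1, koszulCls_eq]
    congr 1
    refine koszulRes_hom_ext fun x v => ?_
    rw [koszulHom_univ, ModuleCat.comp_apply, h]
    exact congrArg ζ (koszulHom_univ (F.app i) (F.equivariant i) x v).symm
  · rintro ⟨hη, rfl⟩
    refine ⟨hη, koszulRes X,
      { app := fun i => koszulU i X
        equivariant := fun i => isEquivariant_koszulU
        d_app := fun i x v => by rw [koszulRes_d_univ, dF_f_apply]
        π_app := fun x v => by
          exact (congrArg (fun φ => φ.hom (koszulU 0 X x v)) (koszulπ_f_zero X)).trans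
            (koszulAug_univ x v) }, koszulHom η hη.equivariant,
      d_comp_koszulHom hη, rfl, fun x v => (koszulHom_univ _ _ x v).symm⟩

lemma represents_cls {Y : ModuleCat.{u} D.H} (η : cocycles i X Y) :
    Represents η.1 (cls i X Y η) := represents_iff.2 ⟨mem_cocycles.1 η.2, rfl⟩

/-- The Yoneda product of the classes of two cocycles `η` and `θ`, in terms of a lift of `η` to a
chain map of Koszul resolutions. -/
lemma koszulCls_comp {j n : ℕ} {Y Z : ModuleCat.{u} D.H} {η : D.Cochain i X Y}
    (hη : IsCocycle η) {θ : D.Cochain j Y Z} (hθ : IsCocycle θ) (hij : i + j = n)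
    (E : ∀ a b, i + b = a → D.Cochain a X ((koszulRes Y).complex.X b))
    (hE : ∀ a b h, IsEquivariant (E a b h))
    (h0 : ∀ x v, koszulAug Y (E i 0 rfl x v) = η x v)
    (hd : ∀ a b (h : i + b = a),
      postComp (((koszulRes Y).complex.d (b + 1) b).hom.restrictScalars ℂ)
      (E (a + 1) (b + 1) (by omega)) = (-1 : ℤ) ^ i • dF D.f (E a b h))
    (hc : IsCocycle (postComp ((koszulHom θ hθ.equivariant).hom.restrictScalars ℂ) (E n j hij))) :
    (koszulCls η hη).comp (koszulCls θ hθ) hij = koszulCls _ hc := by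
  have h1 : koszulHom _ hc.equivariant =
      koszulHom (E n j hij) (hE n j hij) ≫ koszulHom θ hθ.equivariant := by
    refine koszulRes_hom_ext fun x v => ?_
    rw [koszulHom_univ, ModuleCat.comp_apply, koszulHom_univ]
    rfl
  have h2 := d_comp_koszulHom hc
  simp only [koszulCls_eq]
  simp only [h1] at h2 ⊢
  refine ProjectiveResolution.extMk_comp_extMk (koszulRes X) (koszulRes Y)
    (fun a b h => koszulHom (E a b h) (hE a b h)) (fun a b h => ?_) _ ?_ _ hij _ _ h2
  · refine koszulRes_hom_ext fun x v => ?_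
    rw [ModuleCat.comp_apply, koszulHom_univ]
    refine (DFunLike.congr_fun (DFunLike.congr_fun (hd a b h) x) v).trans ?_
    have h3 : ((koszulRes X).complex.d (a + 1) a ≫ koszulHom (E a b h) (hE a b h))
        (koszulU (a + 1) X x v) = dF D.f (E a b h) x v := by
      rw [ModuleCat.comp_apply, apply_koszulRes_d_univ, postComp_koszulHom]
    exact congrArg (fun y => (-1 : ℤ) ^ i • y) h3.symm
  · refine koszulRes_hom_ext fun x v => ?_
    rw [koszulHom_univ, ← h0]
    refine (congrArg (fun y => (koszulRes Y).π.f 0 y) (koszulHom_univ _ (hE i 0 rfl) x v)).trans ?_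
    exact congrArg (fun φ => φ.hom (E i 0 rfl x v)) (koszulπ_f_zero Y)

end Res

end HeckeDatum

/-! ### Products of alternating forms -/

section Wedge

variable {V A B C : Type*} [AddCommGroup V] [Module ℂ V] [AddCommGroup A] [Module ℂ A]
  [AddCommGroup B] [Module ℂ B] [AddCommGroup C] [Module ℂ C] {i j n : ℕ}

/-- The product of alternating forms `α` and `b` of degrees `i` and `j`, with `i + j = n`, along a
bilinear map `β` of their values. -/
def wedge (β : A →ₗ[ℂ] B →ₗ[ℂ] C) (h : i + j = n) :
    V [⋀^Fin i]→ₗ[ℂ] A →ₗ[ℂ] V [⋀^Fin j]→ₗ[ℂ] B →ₗ[ℂ] V [⋀^Fin n]→ₗ[ℂ] C :=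
  LinearMap.mk₂ ℂ
    (fun α b => ((TensorProduct.lift β).compAlternatingMap (α.domCoprod b)).domDomCongr
      (finSumFinEquiv.trans (finCongr h)))
    (fun α α' b => by
      simp only [← AlternatingMap.domCoprod'_apply, TensorProduct.add_tmul, map_add]
      ext v; simp)
    (fun c α b => by
      simp only [← AlternatingMap.domCoprod'_apply, ← TensorProduct.smul_tmul', map_smul]
      ext v; simp)
    (fun α b b' => by
      simp only [← AlternatingMap.domCoprod'_apply, TensorProduct.tmul_add, map_add]
      ext v; simp)
    (fun c α b => by
      simp only [← AlternatingMap.domCoprod'_apply, TensorProduct.tmul_smul, map_smul]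
      ext v; simp)

/-- The product as a sum over all permutations instead of shuffles. -/
lemma factorial_smul_wedge (β : A →ₗ[ℂ] B →ₗ[ℂ] C) (h : i + j = n) (α : V [⋀^Fin i]→ₗ[ℂ] A)
    (b : V [⋀^Fin j]→ₗ[ℂ] B) (v : Fin n → V) :
    (i.factorial * j.factorial) • wedge β h α b v = ∑ σ : Equiv.Perm (Fin n),
      Equiv.Perm.sign σ • β (α fun a => v (σ (Fin.cast h (Fin.castAdd j a))))
        (b fun a => v (σ (Fin.cast h (Fin.natAdd i a)))) := by
  subst h
  have h1 := DFunLike.congr_fun (MultilinearMap.domCoprod_alternization_eq α b)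
    (fun a => v (finSumFinEquiv a))
  rw [Fintype.card_fin, Fintype.card_fin, MultilinearMap.alternatization_apply] at h1
  have h2 := congrArg (TensorProduct.lift β) h1
  rw [map_sum] at h2
  have h3 : TensorProduct.lift β (((i.factorial * j.factorial) • α.domCoprod b)
      fun a => v (finSumFinEquiv a)) =
      (i.factorial * j.factorial) • wedge β rfl α b v := by
    rw [AlternatingMap.smul_apply, map_nsmul]
    rfl
  rw [← h3, ← h2, ← Equiv.sum_comp (Equiv.permCongr finSumFinEquiv)]
  refine Finset.sum_congr rfl fun σ _ => ?_
  rw [Equiv.Perm.sign_permCongr, Units.smul_def, Units.smul_def, map_zsmul]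
  congr 1
  rw [MultilinearMap.domDomCongr_apply, MultilinearMap.domCoprod_apply,
    TensorProduct.lift.tmul]
  simp [Equiv.permCongr_apply]

/-- The expansion of an alternating sum over permutations along the value at `0`. -/
lemma sum_perm_fin_succ {M : Type*} [AddCommGroup M] (F : (Fin (n + 1) → Fin (n + 1)) → M) :
    ∑ σ : Equiv.Perm (Fin (n + 1)), Equiv.Perm.sign σ • F σ =
      ∑ p : Fin (n + 1), (-1 : ℤ) ^ (p : ℕ) • ∑ τ : Equiv.Perm (Fin n),
        Equiv.Perm.sign τ • F (Fin.cons p fun a => p.succAbove (τ a)) := by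
  rw [Finset.univ_perm_fin_succ, ← Finset.univ_product_univ, Finset.sum_map, Finset.sum_product]
  refine Finset.sum_congr rfl fun p _ => ?_
  refine Fin.cases ?_ (fun q => ?_) p
  · rw [Fin.val_zero, pow_zero, one_smul]
    refine Finset.sum_congr rfl fun τ _ => ?_
    simp only [Equiv.toEmbedding_apply, Equiv.Perm.decomposeFin.symm_sign, if_true, one_mul]
    congr 2
    funext a
    refine Fin.cases ?_ (fun a => ?_) a
    · simp
    · simp
  · rw [← Equiv.sum_comp (Equiv.mulLeft (q.cycleRange)⁻¹), Finset.smul_sum]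
    refine Finset.sum_congr rfl fun τ _ => ?_
    simp only [Equiv.toEmbedding_apply, Equiv.Perm.decomposeFin.symm_sign,
      if_neg (Fin.succ_ne_zero q), Equiv.coe_mulLeft, Equiv.Perm.sign_mul, Equiv.Perm.sign_inv,
      Fin.sign_cycleRange]
    have hF : (⇑(Equiv.Perm.decomposeFin.symm (q.succ, q.cycleRange⁻¹ * τ)) :
        Fin (n + 1) → Fin (n + 1)) = Fin.cons q.succ fun a => q.succ.succAbove (τ a) := by
      funext a
      refine Fin.cases ?_ (fun a => ?_) a
      · simp
      · rw [Equiv.Perm.decomposeFin_symm_apply_succ, ← Fin.succAbove_cycleRange]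
        simp
    rw [hF, Units.smul_def, Units.smul_def, smul_smul]
    congr 1
    simp only [Fin.val_succ, Units.val_mul, Units.val_neg, Units.val_one, Units.val_pow_eq_pow_val,
      pow_succ]
    ring

/-- Moving the slot `p` to the front does not change an alternating sum over permutations, up to the
sign of the cycle. -/
lemma sum_perm_cycleRange {M : Type*} [AddCommGroup M] (p : Fin (n + 1))
    (F : (Fin (n + 1) → Fin (n + 1)) → M) :
    ∑ σ : Equiv.Perm (Fin (n + 1)), Equiv.Perm.sign σ •
        F (Fin.cons (σ p) fun a => σ (p.succAbove a)) =
      (-1 : ℤ) ^ (p : ℕ) • ∑ σ : Equiv.Perm (Fin (n + 1)), Equiv.Perm.sign σ • F σ := by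
  rw [← Equiv.sum_comp (Equiv.mulRight p.cycleRange), Finset.smul_sum]
  refine Finset.sum_congr rfl fun σ _ => ?_
  have hF : (Fin.cons ((σ * p.cycleRange) p) fun a => (σ * p.cycleRange) (p.succAbove a) :
      Fin (n + 1) → Fin (n + 1)) = σ := by
    funext a
    refine Fin.cases ?_ (fun a => ?_) a
    · simp
    · simp
  rw [Equiv.coe_mulRight, hF, Units.smul_def, Units.smul_def, smul_smul]
  congr 1
  simp only [Equiv.Perm.sign_mul, Fin.sign_cycleRange, Units.val_mul,
    Units.val_neg, Units.val_one, Units.val_pow_eq_pow_val]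
  ring

lemma nsmul_cancel {m : ℕ} (hm : m ≠ 0) {x y : C} (h : m • x = m • y) : x = y := by
  rw [← Nat.cast_smul_eq_nsmul ℂ, ← Nat.cast_smul_eq_nsmul ℂ] at h
  exact smul_right_injective C (Nat.cast_ne_zero.2 hm) h

lemma factorial_mul_factorial_ne_zero (i j : ℕ) : i.factorial * j.factorial ≠ 0 :=
  mul_ne_zero i.factorial_ne_zero j.factorial_ne_zero

/-- The alternating sum that both sides of the compatibilities of products and alternatizations
compute. -/
lemma factorial_smul_alternatizeUncurryFin (β : A →ₗ[ℂ] B →ₗ[ℂ] C) (h : i + j = n)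
    (G : V →ₗ[ℂ] V [⋀^Fin n]→ₗ[ℂ] C) (F : V → V [⋀^Fin i]→ₗ[ℂ] A) (F' : V → V [⋀^Fin j]→ₗ[ℂ] B)
    (hG : ∀ u, G u = wedge β h (F u) (F' u)) (v : Fin (n + 1) → V) :
    (i.factorial * j.factorial) • AlternatingMap.alternatizeUncurryFin G v =
      ∑ σ : Equiv.Perm (Fin (n + 1)), Equiv.Perm.sign σ •
        β (F (v (σ 0)) fun a => v (σ (Fin.succ (Fin.cast h (Fin.castAdd j a)))))
          (F' (v (σ 0)) fun a => v (σ (Fin.succ (Fin.cast h (Fin.natAdd i a))))) := by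
  rw [AlternatingMap.alternatizeUncurryFin_apply, Finset.smul_sum,
    sum_perm_fin_succ (fun σ => β (F (v (σ 0)) fun a => v (σ (Fin.succ
      (Fin.cast h (Fin.castAdd j a))))) (F' (v (σ 0)) fun a => v (σ (Fin.succ
        (Fin.cast h (Fin.natAdd i a))))))]
  refine Finset.sum_congr rfl fun p _ => ?_
  rw [smul_comm, hG, factorial_smul_wedge]
  rfl

/-- The product with `b` of the alternatization of `u ↦ F(u)` is the alternatization of `u ↦ F(u) ∧
b`. -/
lemma wedge_alternatizeUncurryFin_left (β : A →ₗ[ℂ] B →ₗ[ℂ] C) (h : i + j = n)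
    (h' : i + 1 + j = n + 1) (F : V →ₗ[ℂ] V [⋀^Fin i]→ₗ[ℂ] A) (b : V [⋀^Fin j]→ₗ[ℂ] B) :
    wedge β h' (AlternatingMap.alternatizeUncurryFin F) b =
      AlternatingMap.alternatizeUncurryFin ((wedge β h).flip b ∘ₗ F) := by
  ext v
  refine nsmul_cancel (factorial_mul_factorial_ne_zero (i + 1) j) ?_
  rw [factorial_smul_wedge, Nat.factorial_succ, mul_assoc, mul_smul,
    factorial_smul_alternatizeUncurryFin β h _ F (fun _ => b) (fun _ => rfl)]
  simp only [AlternatingMap.alternatizeUncurryFin_apply, map_sum, LinearMap.sum_apply, map_zsmul,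
    LinearMap.smul_apply, Finset.smul_sum]
  rw [Finset.sum_comm]
  -- Every slot `p` of the alternatization contributes the same sum, after moving it to the front.
  have hp : ∀ p : Fin (i + 1), (∑ σ : Equiv.Perm (Fin (n + 1)), Equiv.Perm.sign σ •
      (-1 : ℤ) ^ (p : ℕ) • β (F (v (σ (Fin.cast h' (Fin.castAdd j p))))
        (p.removeNth fun a => v (σ (Fin.cast h' (Fin.castAdd j a)))))
          (b fun a => v (σ (Fin.cast h' (Fin.natAdd (i + 1) a))))) =
      ∑ σ : Equiv.Perm (Fin (n + 1)), Equiv.Perm.sign σ •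
        β (F (v (σ 0)) fun a => v (σ (Fin.succ (Fin.cast h (Fin.castAdd j a)))))
          (b fun a => v (σ (Fin.succ (Fin.cast h (Fin.natAdd i a))))) := by
    intro p
    have h1 := sum_perm_cycleRange (Fin.cast h' (Fin.castAdd j p)) (fun σ =>
      β (F (v (σ 0)) fun a => v (σ (Fin.succ (Fin.cast h (Fin.castAdd j a)))))
          (b fun a => v (σ (Fin.succ (Fin.cast h (Fin.natAdd i a))))))
    have h2 : ((-1 : ℤ) ^ (p : ℕ)) * (-1) ^ (p : ℕ) = 1 := by
      rw [← mul_pow]; simp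
    have h3 := congrArg (fun x => ((-1 : ℤ) ^ (p : ℕ)) • x) h1
    simp only [Fin.val_cast, Fin.val_castAdd, smul_smul, h2, one_smul] at h3
    rw [← h3, Finset.smul_sum]
    refine Finset.sum_congr rfl fun σ _ => ?_
    rw [smul_comm]
    congr 3
    · simp only [Fin.cons_zero, Fin.cons_succ]
      congr 2
      funext a
      simp only [Fin.removeNth]
      congr 2
      simp only [Fin.ext_iff, Fin.val_cast, Fin.val_castAdd, Fin.succAbove, Fin.lt_def,
        Fin.val_castSucc]
      split_ifs <;> simp
    · congr 1
      funext a
      simp only [Fin.cons_succ]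
      congr 2
      have := p.2
      simp only [Fin.ext_iff, Fin.val_cast, Fin.val_castAdd, Fin.succAbove, Fin.lt_def,
        Fin.val_castSucc, Fin.val_natAdd]
      split_ifs <;> simp <;> omega
  rw [Finset.sum_congr rfl fun p _ => hp p, Finset.sum_const, Finset.card_univ, Fintype.card_fin,
    Finset.smul_sum]

/-- The product with `α` of the alternatization of `u ↦ F(u)` is that of `u ↦ α ∧ F(u)`, up to the
sign of moving `u` past the `i` arguments of `α`. -/
lemma wedge_alternatizeUncurryFin_right (β : A →ₗ[ℂ] B →ₗ[ℂ] C) (h : i + j = n)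
    (h' : i + (j + 1) = n + 1) (α : V [⋀^Fin i]→ₗ[ℂ] A) (F : V →ₗ[ℂ] V [⋀^Fin j]→ₗ[ℂ] B) :
    wedge β h' α (AlternatingMap.alternatizeUncurryFin F) =
      (-1 : ℤ) ^ i • AlternatingMap.alternatizeUncurryFin (wedge β h α ∘ₗ F) := by
  ext v
  refine nsmul_cancel (factorial_mul_factorial_ne_zero i (j + 1)) ?_
  rw [factorial_smul_wedge, Nat.factorial_succ, mul_left_comm, mul_smul,
    AlternatingMap.smul_apply, smul_comm (i.factorial * j.factorial),
    factorial_smul_alternatizeUncurryFin β h _ (fun _ => α) F (fun _ => rfl)]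
  simp only [AlternatingMap.alternatizeUncurryFin_apply, map_sum, map_zsmul]
  simp only [Finset.smul_sum (s := (Finset.univ : Finset (Fin (j + 1))))]
  rw [Finset.sum_comm]
  -- The slot `p` of `F` is the slot `i + p` of the product, whence the additional sign `(-1)ⁱ`.
  have hp : ∀ p : Fin (j + 1), (∑ σ : Equiv.Perm (Fin (n + 1)), Equiv.Perm.sign σ •
      (-1 : ℤ) ^ (p : ℕ) • β (α fun a => v (σ (Fin.cast h' (Fin.castAdd (j + 1) a))))
        (F (v (σ (Fin.cast h' (Fin.natAdd i p))))
        (p.removeNth fun a => v (σ (Fin.cast h' (Fin.natAdd i a)))))) =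
      (-1 : ℤ) ^ i • ∑ σ : Equiv.Perm (Fin (n + 1)), Equiv.Perm.sign σ •
        β (α fun a => v (σ (Fin.succ (Fin.cast h (Fin.castAdd j a)))))
          (F (v (σ 0)) fun a => v (σ (Fin.succ (Fin.cast h (Fin.natAdd i a))))) := by
    intro p
    have h1 := sum_perm_cycleRange (Fin.cast h' (Fin.natAdd i p)) (fun σ =>
      β (α fun a => v (σ (Fin.succ (Fin.cast h (Fin.castAdd j a)))))
          (F (v (σ 0)) fun a => v (σ (Fin.succ (Fin.cast h (Fin.natAdd i a))))))
    have h2 : ((-1 : ℤ) ^ (p : ℕ)) * (-1) ^ (i + (p : ℕ)) = (-1) ^ i := by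
      rw [pow_add, mul_left_comm, ← mul_pow]; simp
    have h3 := congrArg (fun x => ((-1 : ℤ) ^ (p : ℕ)) • x) h1
    simp only [Fin.val_cast, Fin.val_natAdd, smul_smul, h2] at h3
    rw [← h3, Finset.smul_sum]
    refine Finset.sum_congr rfl fun σ _ => ?_
    rw [smul_comm]
    congr 3
    · congr 1
      simp only [Fin.cons_succ]
      congr 1
      funext a
      congr 2
      have := a.2
      simp only [Fin.ext_iff, Fin.val_cast, Fin.val_castAdd, Fin.succAbove, Fin.lt_def,
        Fin.val_castSucc, Fin.val_natAdd]
      split_ifs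
      · simp
      · omega
    · simp only [Fin.cons_zero, Fin.cons_succ]
      congr 1
      funext a
      simp only [Fin.removeNth]
      congr 2
      simp only [Fin.ext_iff, Fin.val_cast, Fin.succAbove, Fin.lt_def, Fin.val_castSucc,
        Fin.val_natAdd]
      split_ifs <;> simp <;> omega
  rw [Finset.sum_congr rfl fun p _ => hp p]
  simp

lemma wedge_compLinearMap {V' : Type*} [AddCommGroup V'] [Module ℂ V'] (g : V' →ₗ[ℂ] V)
    (β : A →ₗ[ℂ] B →ₗ[ℂ] C) (h : i + j = n) (α : V [⋀^Fin i]→ₗ[ℂ] A) (b : V [⋀^Fin j]→ₗ[ℂ] B) :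
    (wedge β h α b).compLinearMap g = wedge β h (α.compLinearMap g) (b.compLinearMap g) := by
  ext v
  refine nsmul_cancel (factorial_mul_factorial_ne_zero i j) ?_
  rw [AlternatingMap.compLinearMap_apply, factorial_smul_wedge, factorial_smul_wedge]
  rfl

/-- Naturality of the product in the bilinear map of the values. -/
lemma comp_wedge {A' B' C' : Type*} [AddCommGroup A'] [Module ℂ A'] [AddCommGroup B'] [Module ℂ B']
    [AddCommGroup C'] [Module ℂ C'] (β : A →ₗ[ℂ] B →ₗ[ℂ] C) (β' : A' →ₗ[ℂ] B' →ₗ[ℂ] C')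
    (f : A →ₗ[ℂ] A') (g : B →ₗ[ℂ] B') (γ : C →ₗ[ℂ] C') (hγ : ∀ x y, γ (β x y) = β' (f x) (g y))
    (h : i + j = n) (α : V [⋀^Fin i]→ₗ[ℂ] A) (b : V [⋀^Fin j]→ₗ[ℂ] B) :
    γ.compAlternatingMap (wedge β h α b) =
      wedge β' h (f.compAlternatingMap α) (g.compAlternatingMap b) := by
  ext v
  refine nsmul_cancel (factorial_mul_factorial_ne_zero i j) ?_
  rw [LinearMap.compAlternatingMap_apply, ← map_nsmul, factorial_smul_wedge, factorial_smul_wedge,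
    map_sum]
  refine Finset.sum_congr rfl fun σ _ => ?_
  rw [Units.smul_def, Units.smul_def, map_zsmul, hγ]
  rfl

/-- A derivation of the bilinear map of the values acts as a derivation on products. -/
lemma derivation_wedge (β : A →ₗ[ℂ] B →ₗ[ℂ] C)
    (f : A →ₗ[ℂ] A) (g : B →ₗ[ℂ] B) (γ : C →ₗ[ℂ] C) (hγ : ∀ x y, γ (β x y) = β (f x) y + β x (g y))
    (h : i + j = n) (α : V [⋀^Fin i]→ₗ[ℂ] A) (b : V [⋀^Fin j]→ₗ[ℂ] B) :
    γ.compAlternatingMap (wedge β h α b) =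
      wedge β h (f.compAlternatingMap α) b + wedge β h α (g.compAlternatingMap b) := by
  ext v
  refine nsmul_cancel (factorial_mul_factorial_ne_zero i j) ?_
  rw [LinearMap.compAlternatingMap_apply, ← map_nsmul, AlternatingMap.add_apply, smul_add,
    factorial_smul_wedge, factorial_smul_wedge, factorial_smul_wedge, map_sum,
    ← Finset.sum_add_distrib]
  refine Finset.sum_congr rfl fun σ _ => ?_
  rw [Units.smul_def, Units.smul_def, Units.smul_def, map_zsmul, hγ, smul_add]
  rfl

/-- The Leibniz rule for the Koszul differential. -/
lemma koszulDiff_wedge (β : A →ₗ[ℂ] B →ₗ[ℂ] C) (δA : V →ₗ[ℂ] Module.End ℂ A)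
    (δB : V →ₗ[ℂ] Module.End ℂ B) (δC : V →ₗ[ℂ] Module.End ℂ C)
    (hδ : ∀ u x y, δC u (β x y) = β (δA u x) y + β x (δB u y)) (h : i + j = n)
    (h₁ : i + 1 + j = n + 1) (h₂ : i + (j + 1) = n + 1)
    (α : V [⋀^Fin i]→ₗ[ℂ] A) (b : V [⋀^Fin j]→ₗ[ℂ] B) :
    koszulDiff δC (wedge β h α b) =
      wedge β h₁ (koszulDiff δA α) b + (-1 : ℤ) ^ i • wedge β h₂ α (koszulDiff δB b) := by
  have h2 : ((-1 : ℤ) ^ i) * (-1) ^ i = 1 := by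
    rw [← mul_pow]; simp
  unfold koszulDiff
  rw [wedge_alternatizeUncurryFin_left β h, wedge_alternatizeUncurryFin_right β h, smul_smul, h2,
    one_smul, ← AlternatingMap.alternatizeUncurryFin_add]
  congr 1
  ext u : 1
  exact derivation_wedge β (δA u) (δB u) (δC u) (hδ u) h α b

/-- The product `φ ∧ ω` of a linear form and an alternating form. -/
def formMul (φ : V →ₗ[ℂ] ℂ) (ω : V [⋀^Fin i]→ₗ[ℂ] A) : V [⋀^Fin (i + 1)]→ₗ[ℂ] A :=
  AlternatingMap.alternatizeUncurryFin (φ.smulRight ω)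

/-- A linear form can be moved from the left factor of a product to the right factor, up to a sign.
-/
lemma wedge_formMul (β : A →ₗ[ℂ] B →ₗ[ℂ] C) (h₁ : i + 1 + j = n + 1) (h₂ : i + (j + 1) = n + 1)
    (φ : V →ₗ[ℂ] ℂ) (α : V [⋀^Fin i]→ₗ[ℂ] A) (b : V [⋀^Fin j]→ₗ[ℂ] B) :
    wedge β h₁ (formMul φ α) b = (-1 : ℤ) ^ i • wedge β h₂ α (formMul φ b) := by
  have h : i + j = n := by omega
  have h2 : ((-1 : ℤ) ^ i) * (-1) ^ i = 1 := by
    rw [← mul_pow]; simp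
  unfold formMul
  rw [wedge_alternatizeUncurryFin_left β h, wedge_alternatizeUncurryFin_right β h, smul_smul, h2,
    one_smul]
  congr 1
  ext u : 1
  simp

/-- An alternating form of degree less than `dim V` vanishes if its products with all linear forms
do. -/
lemma eq_zero_of_formMul_eq_zero [FiniteDimensional ℂ V] (hi : i < Module.finrank ℂ V)
    (ω : V [⋀^Fin i]→ₗ[ℂ] A) (hω : ∀ φ, formMul φ ω = 0) : ω = 0 := by
  ext v
  have hlt : Submodule.span ℂ (Set.range v) < ⊤ := by
    refine lt_top_iff_ne_top.2 fun htop => ?_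
    have h1 := finrank_range_le_card (R := ℂ) v
    rw [Set.finrank, htop, finrank_top, Fintype.card_fin] at h1
    omega
  -- Evaluate `φ ∧ ω` at `(u, v)`, where `φ` vanishes on all `v a` but not on `u`.
  obtain ⟨u, -, hu⟩ := SetLike.exists_of_lt hlt
  obtain ⟨φ, hφu, hφ⟩ := Submodule.exists_le_ker_of_notMem hu
  have h2 := DFunLike.congr_fun (hω φ) (Fin.cons u v)
  rw [formMul, AlternatingMap.alternatizeUncurryFin_apply, Fin.sum_univ_succ,
    Finset.sum_eq_zero] at h2
  · simpa [hφu] using h2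
  · intro a _
    have : φ (v a) = 0 := hφ (Submodule.subset_span ⟨a, rfl⟩)
    simp [this]

lemma sign_smul_sign_smul {M : Type*} [AddCommGroup M] (σ : Equiv.Perm (Fin n)) (x : M) :
    Equiv.Perm.sign σ • Equiv.Perm.sign σ • x = x := by
  rw [smul_smul, Int.units_mul_self, one_smul]

lemma wedge_degree_zero_right (β : A →ₗ[ℂ] B →ₗ[ℂ] C) (h : n + 0 = n) (α : V [⋀^Fin n]→ₗ[ℂ] A)
    (b : V [⋀^Fin 0]→ₗ[ℂ] B) (v : Fin n → V) : wedge β h α b v = β (α v) (b ![]) := by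
  refine nsmul_cancel (factorial_mul_factorial_ne_zero n 0) ?_
  have h2 : ∀ σ : Equiv.Perm (Fin n), Equiv.Perm.sign σ • β (α fun a => v (σ (Fin.cast h
      (Fin.castAdd 0 a)))) (b fun a => v (σ (Fin.cast h (Fin.natAdd n a)))) =
      β (α v) (b ![]) := by
    intro σ
    have h3 : (α fun a => v (σ (Fin.cast h (Fin.castAdd 0 a)))) = Equiv.Perm.sign σ • α v :=
      α.map_perm v σ
    have h4 := sign_smul_sign_smul σ (β (α v) (b ![]))
    rw [h3, Subsingleton.elim (fun a => v (σ (Fin.cast h (Fin.natAdd n a)))) ![]]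
    rw [Units.smul_def, Units.smul_def] at h4 ⊢
    rwa [map_zsmul, LinearMap.smul_apply]
  rw [factorial_smul_wedge, Finset.sum_congr rfl fun σ _ => h2 σ, Finset.sum_const,
    Finset.card_univ, Fintype.card_perm, Fintype.card_fin, Nat.factorial_zero, mul_one]

lemma wedge_degree_zero_left (β : A →ₗ[ℂ] B →ₗ[ℂ] C) (h : 0 + n = n) (α : V [⋀^Fin 0]→ₗ[ℂ] A)
    (b : V [⋀^Fin n]→ₗ[ℂ] B) (v : Fin n → V) : wedge β h α b v = β (α ![]) (b v) := by
  refine nsmul_cancel (factorial_mul_factorial_ne_zero 0 n) ?_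
  have h2 : ∀ σ : Equiv.Perm (Fin n), Equiv.Perm.sign σ • β (α fun a => v (σ (Fin.cast h
      (Fin.castAdd n a)))) (b fun a => v (σ (Fin.cast h (Fin.natAdd 0 a)))) =
      β (α ![]) (b v) := by
    intro σ
    have h0 : (fun a => v (σ (Fin.cast h (Fin.natAdd 0 a)))) = fun a => v (σ a) := by
      funext a
      congr 2
      simp
    have h3 : (b fun a => v (σ (Fin.cast h (Fin.natAdd 0 a)))) = Equiv.Perm.sign σ • b v := by
      rw [h0]
      exact b.map_perm v σ
    have h4 := sign_smul_sign_smul σ (β (α ![]) (b v))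
    rw [h3, Subsingleton.elim (fun a => v (σ (Fin.cast h (Fin.castAdd n a)))) ![]]
    rw [Units.smul_def, Units.smul_def] at h4 ⊢
    rwa [map_zsmul]
  rw [factorial_smul_wedge, Finset.sum_congr rfl fun σ _ => h2 σ, Finset.sum_const,
    Finset.card_univ, Fintype.card_perm, Fintype.card_fin, Nat.factorial_zero, one_mul]

/-- If `β` is non-degenerate, then so is the product of forms whose degrees add up to `dim V`:
linear forms are moved from the right factor to the left one until the right one has degree
zero. -/
lemma eq_zero_of_wedge_left [FiniteDimensional ℂ V] (β : A →ₗ[ℂ] B →ₗ[ℂ] C)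
    (hβ : ∀ x, (∀ y, β x y = 0) → x = 0) (h : i + j = n) (hn : Module.finrank ℂ V = n)
    (α : V [⋀^Fin i]→ₗ[ℂ] A) (hα : ∀ b, wedge β h α b = 0) : α = 0 := by
  induction j generalizing i with
  | zero =>
    obtain rfl : i = n := by omega
    ext v
    refine hβ _ fun y => ?_
    have h1 := wedge_degree_zero_right β h α (AlternatingMap.constOfIsEmpty ℂ V (Fin 0) y) v
    rw [hα] at h1
    exact h1.symm
  | succ j ih =>
    refine eq_zero_of_formMul_eq_zero (by omega) α fun φ => ih (by omega) _ fun b => ?_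
    obtain ⟨m, rfl⟩ : ∃ m, n = m + 1 := ⟨n - 1, by omega⟩
    rw [wedge_formMul β _ h, hα, smul_zero]

lemma eq_zero_of_wedge_right [FiniteDimensional ℂ V] (β : A →ₗ[ℂ] B →ₗ[ℂ] C)
    (hβ : ∀ y, (∀ x, β x y = 0) → y = 0) (h : i + j = n) (hn : Module.finrank ℂ V = n)
    (b : V [⋀^Fin j]→ₗ[ℂ] B) (hb : ∀ α, wedge β h α b = 0) : b = 0 := by
  induction i generalizing j with
  | zero =>
    obtain rfl : j = n := by omega
    ext v
    refine hβ _ fun x => ?_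
    have h1 := wedge_degree_zero_left β h (AlternatingMap.constOfIsEmpty ℂ V (Fin 0) x) b v
    rw [hb] at h1
    exact h1.symm
  | succ i ih =>
    refine eq_zero_of_formMul_eq_zero (by omega) b fun φ => ih (by omega) _ fun α => ?_
    obtain ⟨m, rfl⟩ : ∃ m, n = m + 1 := ⟨n - 1, by omega⟩
    have h1 := wedge_formMul β h (by omega) φ α b
    rw [hb] at h1
    have h2 : ((-1 : ℤ) ^ i) * (-1) ^ i = 1 := by
      rw [← mul_pow]; simp
    have h3 := congrArg (fun x => ((-1 : ℤ) ^ i) • x) h1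
    simpa only [smul_smul, h2, one_smul, smul_zero] using h3.symm

end Wedge

namespace HeckeDatum

variable {ι V₀ N : Type u} [AddCommGroup V₀] [Module ℝ V₀] [AddCommGroup N] [Module ℝ N]
  {D : HeckeDatum ι V₀ N}

/-! ### Products of cochains -/

variable {i j n : ℕ} {X Y Z : ModuleCat.{u} D.H}

variable (X Y Z) in
/-- The composition of linear maps, with the map that is applied first as its first argument. -/
def compB : (X →ₗ[ℂ] Y) →ₗ[ℂ] (Y →ₗ[ℂ] Z) →ₗ[ℂ] (X →ₗ[ℂ] Z) := (LinearMap.llcomp ℂ X Y Z).flip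

lemma compB_apply (S : X →ₗ[ℂ] Y) (T : Y →ₗ[ℂ] Z) : compB X Y Z S T = T ∘ₗ S := rfl

/-- The product of the cochains `η` on `X` with values in `Y` and `θ` on `Y` with values in `Z`,
`∑ ± θ(η(x; v_L); v_{L^c})`. -/
def cup (h : i + j = n) : D.Cochain i X Y →ₗ[ℂ] D.Cochain j Y Z →ₗ[ℂ] D.Cochain n X Z :=
  ((wedge (compB X Y Z) h).compl₁₂ flat.toLinearMap flat.toLinearMap).compr₂ flat.symm.toLinearMap

lemma flat_cup (h : i + j = n) (η : D.Cochain i X Y) (θ : D.Cochain j Y Z) :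
    flat (cup h η θ) = wedge (compB X Y Z) h (flat η) (flat θ) := rfl

lemma flat_dF (F : D.VC →ₗ[ℂ] D.H) (η : D.Cochain i X Y) :
    flat (dF F η) = koszulDiff (commOp F X Y) (flat η) := rfl

/-- The Leibniz rule for the product of cochains. -/
lemma dF_cup (F : D.VC →ₗ[ℂ] D.H) (h : i + j = n) (h₁ : i + 1 + j = n + 1)
    (h₂ : i + (j + 1) = n + 1) (η : D.Cochain i X Y) (θ : D.Cochain j Y Z) :
    dF F (cup h η θ) = cup h₁ (dF F η) θ + (-1 : ℤ) ^ i • cup h₂ η (dF F θ) := by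
  apply flat.injective
  rw [map_add, map_zsmul, flat_dF, flat_cup, flat_cup, flat_cup, flat_dF, flat_dF]
  refine koszulDiff_wedge _ _ _ _ (fun u S T => ?_) h h₁ h₂ _ _
  ext x
  simp only [compB_apply, commOp_apply, LinearMap.comp_apply, LinearMap.add_apply, map_sub]
  abel

/-- Conjugation by `t_w`, on linear maps. -/
def conjOp (w : D.W) (X Y : ModuleCat.{u} D.H) : (X →ₗ[ℂ] Y) →ₗ[ℂ] (X →ₗ[ℂ] Y) :=
  (LinearMap.llcomp ℂ X Y Y (op (D.t w) Y)) ∘ₗ compB X X Y (op (D.t w⁻¹) X)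

lemma flat_conjC (w : D.W) (η : D.Cochain i X Y) :
    flat (conjC w η) =
      (conjOp w X Y).compAlternatingMap ((flat η).compLinearMap (D.act w⁻¹)) := rfl

lemma conjC_cup (w : D.W) (h : i + j = n) (η : D.Cochain i X Y) (θ : D.Cochain j Y Z) :
    conjC w (cup h η θ) = cup h (conjC w η) (conjC w θ) := by
  apply flat.injective
  rw [flat_conjC, flat_cup, flat_cup, wedge_compLinearMap, flat_conjC, flat_conjC]
  refine comp_wedge _ _ _ _ _ (fun S T => ?_) h _ _
  ext x
  change D.t w • T (S (D.t w⁻¹ • x)) = D.t w • T (D.t w⁻¹ • D.t w • S (D.t w⁻¹ • x))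
  rw [t_inv_smul_t_smul]

lemma IsEquivariant.cup {η : D.Cochain i X Y} {θ : D.Cochain j Y Z} (hη : IsEquivariant η)
    (hθ : IsEquivariant θ) (h : i + j = n) : IsEquivariant (cup h η θ) := by
  rw [isEquivariant_iff_conjC] at hη hθ ⊢
  intro w
  rw [conjC_cup, hη, hθ]

lemma postComp_cup {Z' : ModuleCat.{u} D.H} (φ : Z →ₗ[ℂ] Z') (h : i + j = n) (η : D.Cochain i X Y)
    (θ : D.Cochain j Y Z) : postComp φ (cup h η θ) = cup h η (postComp φ θ) := by
  apply flat.injective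
  exact comp_wedge (compB X Y Z) (compB X Y Z') LinearMap.id (LinearMap.llcomp ℂ Y Z Z' φ)
    (LinearMap.llcomp ℂ X Z Z' φ) (fun S T => rfl) h (flat η) (flat θ)

lemma cup_ofLinear (h : n + 0 = n) (η : D.Cochain n X Y) (φ : Y →ₗ[ℂ] Z) :
    cup h η (ofLinear φ) = postComp φ η := by
  ext x v
  exact LinearMap.congr_fun (wedge_degree_zero_right (compB X Y Z) h (flat η)
    (flat (ofLinear φ)) v) x

lemma isCocycle_cup {η : D.Cochain i X Y} {θ : D.Cochain j Y Z} (hη : IsCocycle η)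
    (hθ : IsCocycle θ) (h : i + j = n) : IsCocycle (cup h η θ) := by
  rw [isCocycle_iff] at hη hθ ⊢
  refine ⟨hη.1.cup hθ.1 h, ?_⟩
  rw [dF_cup D.f h (by omega) (by omega), hη.2, hθ.2, map_zero, map_zero, LinearMap.zero_apply,
    smul_zero, add_zero]

variable [FiniteDimensional ℝ V₀] [Fintype ι]

/-- The Yoneda product is induced by the product of cochains. -/
lemma koszulCls_comp_koszulCls {η : D.Cochain i X Y} {θ : D.Cochain j Y Z} (hη : IsCocycle η)
    (hθ : IsCocycle θ) (h : i + j = n) :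
    (koszulCls η hη).comp (koszulCls θ hθ) h = koszulCls (cup h η θ) (isCocycle_cup hη hθ h) := by
  -- The products of `η` with the universal cochains of `Y` lift `η` to a chain map.
  have h1 := koszulCls_comp hη hθ h (fun a b h => cup h η (koszulU b Y))
    (fun a b h => hη.equivariant.cup isEquivariant_koszulU h)
    (fun x v => by
      have h2 : postComp ((koszulAug Y).restrictScalars ℂ) (koszulU 0 Y) =
          ofLinear LinearMap.id := by
        ext y v
        exact koszulAug_univ y v
      have h3 := postComp_cup ((koszulAug Y).restrictScalars ℂ) rfl η (koszulU 0 Y)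
      rw [h2, cup_ofLinear] at h3
      exact DFunLike.congr_fun (LinearMap.congr_fun h3 x) v)
    (fun a b h => by
      have h2 : postComp (((koszulRes Y).complex.d (b + 1) b).hom.restrictScalars ℂ)
          (koszulU (b + 1) Y) = dF D.f (koszulU b Y) := by
        ext y v
        exact koszulRes_d_univ y v
      have h4 : ((-1 : ℤ) ^ i) * (-1) ^ i = 1 := by
        rw [← mul_pow]; simp
      rw [postComp_cup, h2, dF_cup D.f h (by omega) (by omega), (isCocycle_iff.1 hη).2, map_zero,
        LinearMap.zero_apply, zero_add, smul_smul, h4, one_smul])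
    (by
      rw [postComp_cup, postComp_koszulHom]
      exact isCocycle_cup hη hθ h)
  rw [h1]
  congr 1
  rw [postComp_cup, postComp_koszulHom]

end HeckeDatum

/-! ### Linear algebra of dualities -/

section Generic

/-- The Koszul differential is natural for maps of values which commute with the operators. -/
lemma koszulDiff_compAlternatingMap {R V A B : Type*} [CommRing R] [AddCommGroup V] [Module R V]
    [AddCommGroup A] [Module R A] [AddCommGroup B] [Module R B] (δ : V →ₗ[R] Module.End R A)
    (δ' : V →ₗ[R] Module.End R B) (g : A →ₗ[R] B) (hg : ∀ u x, g (δ u x) = δ' u (g x)) {i : ℕ}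
    (ω : V [⋀^Fin i]→ₗ[R] A) :
    koszulDiff δ' (g.compAlternatingMap ω) = g.compAlternatingMap (koszulDiff δ ω) := by
  ext v
  simp only [koszulDiff_apply, LinearMap.compAlternatingMap_apply, map_sum, map_zsmul, hg]

/-- A basis and its dual basis are moved in the same way by an endomorphism. -/
lemma sum_basis_coord_comp {κ X M : Type*} [Fintype κ] [AddCommGroup X] [Module ℂ X]
    [AddCommGroup M] [Module ℂ M] (b : Module.Basis κ ℂ X) (G : X →ₗ[ℂ] (X →ₗ[ℂ] ℂ) →ₗ[ℂ] M)
    (A : X →ₗ[ℂ] X) :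
    ∑ r, G (A (b r)) (b.coord r) = ∑ r, G (b r) (b.coord r ∘ₗ A) := by
  have h1 : ∀ r, A (b r) = ∑ s, b.coord s (A (b r)) • b s := fun r => (b.sum_repr _).symm
  have h2 : ∀ r, b.coord r ∘ₗ A = ∑ s, b.coord r (A (b s)) • b.coord s := by
    intro r
    refine b.ext fun s => ?_
    rw [LinearMap.sum_apply, Finset.sum_eq_single s]
    · simp
    · intro t _ hts
      simp [hts.symm]
    · simp
  have h3 : ∀ r, G (A (b r)) (b.coord r) =
      ∑ s, b.coord s (A (b r)) • G (b s) (b.coord r) := by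
    intro r
    conv_lhs => rw [h1 r]
    simp only [map_sum, map_smul, LinearMap.sum_apply, LinearMap.smul_apply]
  have h4 : ∀ r, G (b r) (b.coord r ∘ₗ A) =
      ∑ s, b.coord r (A (b s)) • G (b r) (b.coord s) := by
    intro r
    rw [h2]
    simp only [map_sum, map_smul]
  rw [Finset.sum_congr rfl fun r _ => h3 r, Finset.sum_congr rfl fun r _ => h4 r, Finset.sum_comm]

/-- Poincaré duality in linear algebra: if `dA` and `dB` are adjoint up to a scalar, then the
elements that are orthogonal to the kernel of `dB` lie in the image of `dA`. -/
lemma exists_eq_of_adjoint {A A' B B' : Type*} [AddCommGroup A] [Module ℂ A] [AddCommGroup A']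
    [Module ℂ A'] [AddCommGroup B] [Module ℂ B] [AddCommGroup B'] [Module ℂ B']
    [FiniteDimensional ℂ B'] (P : A →ₗ[ℂ] B →ₗ[ℂ] ℂ) (P' : A' →ₗ[ℂ] B' →ₗ[ℂ] ℂ)
    (hP : ∀ a, (∀ b, P a b = 0) → a = 0) (hP' : ∀ b, (∀ a, P' a b = 0) → b = 0)
    (dA : A' →ₗ[ℂ] A) (dB : B →ₗ[ℂ] B') (c : ℂ)
    (hadj : ∀ a b, P' a (dB b) = c * P (dA a) b) (a : A) (ha : ∀ b, dB b = 0 → P a b = 0) :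
    ∃ a', dA a' = a := by
  -- The functional `P a` vanishes on the kernel of `dB`, so it factors through `dB`; the factor is
  -- represented by an element `a'`, as `P'` is perfect in its finite-dimensional argument.
  have h1 : P a ∈ (LinearMap.ker dB).dualAnnihilator :=
    (Submodule.mem_dualAnnihilator _).2 fun b hb => ha b hb
  rw [← LinearMap.range_dualMap_eq_dualAnnihilator_ker] at h1
  obtain ⟨m, hm⟩ := h1
  have hinj : Function.Injective P'.flip := by
    rw [injective_iff_map_eq_zero]
    exact fun b hb => hP' b fun a => LinearMap.congr_fun hb a
  obtain ⟨a', ha'⟩ := LinearMap.flip_surjective_iff₁.2 hinj m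
  refine ⟨c • a', ?_⟩
  rw [← sub_eq_zero]
  refine hP _ fun b => ?_
  have h2 := LinearMap.congr_fun hm b
  rw [LinearMap.dualMap_apply, ← ha'] at h2
  have h3 : P' a' (dB b) = P a b := h2
  rw [map_sub, LinearMap.sub_apply, map_smul, map_smul, LinearMap.smul_apply, smul_eq_mul,
    ← hadj, h3, sub_self]

/-- The interchange of the arguments of bilinear maps. -/
def flipEquiv (A B C : Type*) [AddCommGroup A] [Module ℂ A] [AddCommGroup B] [Module ℂ B]
    [AddCommGroup C] [Module ℂ C] : (A →ₗ[ℂ] B →ₗ[ℂ] C) ≃ₗ[ℂ] (B →ₗ[ℂ] A →ₗ[ℂ] C) where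
  toFun := LinearMap.flip
  invFun := LinearMap.flip
  left_inv _ := rfl
  right_inv _ := rfl
  map_add' _ _ := rfl
  map_smul' _ _ := rfl

/-- An isomorphism of the sources of two surjective maps which matches their kernels induces an
isomorphism of the targets. -/
lemma exists_linearEquiv_of_ker {Z Z' E E' : Type*} [AddCommGroup Z] [Module ℂ Z] [AddCommGroup Z']
    [Module ℂ Z'] [AddCommGroup E] [Module ℂ E] [AddCommGroup E'] [Module ℂ E'] (c : Z →ₗ[ℂ] E)
    (c' : Z' →ₗ[ℂ] E') (hc : Function.Surjective c) (hc' : Function.Surjective c') (τ : Z ≃ₗ[ℂ] Z')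
    (h : ∀ z, c' (τ z) = 0 ↔ c z = 0) : ∃ T : E ≃ₗ[ℂ] E', ∀ z, T (c z) = c' (τ z) := by
  obtain ⟨s, hs⟩ := c.exists_rightInverse_of_surjective (LinearMap.range_eq_top.2 hc)
  have hs' : ∀ x, c (s x) = x := fun x => LinearMap.congr_fun hs x
  have key : ∀ z, c' (τ (s (c z))) = c' (τ z) := by
    intro z
    rw [← sub_eq_zero, ← map_sub, ← map_sub, h, map_sub, hs', sub_self]
  refine ⟨LinearEquiv.ofBijective (c' ∘ₗ τ.toLinearMap ∘ₗ s) ⟨?_, ?_⟩, key⟩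
  · rw [injective_iff_map_eq_zero]
    intro x hx
    have h1 := (h (s x)).1 hx
    rwa [hs'] at h1
  · intro y
    obtain ⟨z, rfl⟩ := hc' y
    refine ⟨c (τ.symm z), ?_⟩
    have h1 := key (τ.symm z)
    rw [LinearEquiv.apply_symm_apply] at h1
    exact h1

end Generic

namespace HeckeDatum

variable {ι V₀ N : Type u} [AddCommGroup V₀] [Module ℝ V₀] [AddCommGroup N] [Module ℝ N]
  {D : HeckeDatum ι V₀ N}

/-! ### The dualizing module -/

/-- Evaluation identifies the twisted dual with the space of linear functionals. -/
def evEquiv (φ : D.H →ₐ[ℂ] D.Hᵐᵒᵖ) (X : ModuleCat.{u} D.H) : D.dual φ X ≃ₗ[ℂ] (X →ₗ[ℂ] ℂ) where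
  __ := D.ev φ X
  invFun := D.ofFunctional φ X
  left_inv _ := rfl
  right_inv _ := rfl

section Fin
variable [Fintype ι]

/-- A linear functional on `X`, as an element of `X^*`. -/
def starFunctional (X : ModuleCat.{u} D.H) (p : X →ₗ[ℂ] ℂ) : D.starDual X :=
  D.ofFunctional D.star X p

/-- On `X^*` the Drinfeld generator `ṽ` acts by the negative transpose of its action on `X`. -/
lemma starDual_ftil_smul {X : ModuleCat.{u} D.H} (v : D.VC) (p : X →ₗ[ℂ] ℂ) :
    D.ftil v • starFunctional X p =
      starFunctional X (-(p ∘ₗ op (D.ftil v) X)) := by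
  apply (evEquiv D.star X).injective
  ext x
  change p (MulOpposite.unop (D.star (D.ftil v)) • x) = -p (D.ftil v • x)
  rw [star_ftil, MulOpposite.unop_neg, MulOpposite.unop_op, neg_smul, map_neg]

lemma starDual_t_smul {X : ModuleCat.{u} D.H} (w : D.W) (p : X →ₗ[ℂ] ℂ) :
    D.t w • starFunctional X p =
      starFunctional X (p ∘ₗ op (D.t w⁻¹) X) := by
  apply (evEquiv D.star X).injective
  ext x
  change p (MulOpposite.unop (D.star (D.t w)) • x) = p (D.t w⁻¹ • x)
  rw [star_t, MulOpposite.unop_op]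

end Fin

variable [FiniteDimensional ℝ V₀]

/-- The identity map, as a linear equivalence from `X` to its twist. -/
def twistEquiv (X : ModuleCat.{u} D.H) : X ≃ₗ[ℂ] D.twist X where
  __ := D.toTwist X
  invFun x := show X from x
  left_inv _ := rfl
  right_inv _ := rfl

/-- The elements of `ι(Y)^•` as linear functionals on `Y`. -/
def contractEquiv (Y : ModuleCat.{u} D.H) : D.bulletDual (D.twist Y) ≃ₗ[ℂ] (Y →ₗ[ℂ] ℂ) :=
  evEquiv D.bullet (D.twist Y) ≪≫ₗ (twistEquiv Y).symm.arrowCongr (LinearEquiv.refl ℂ ℂ)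

lemma contract_t_smul {Y : ModuleCat.{u} D.H} (w : D.W) (y : Y)
    (g : D.bulletDual (D.twist Y)) :
    D.contract Y y (D.t w • g) = D.sgn w⁻¹ * D.contract Y (D.t w⁻¹ • y) g := by
  change D.contract Y (D.imInv (MulOpposite.unop (D.bullet (D.t w))) • y) g = _
  rw [bullet_t, MulOpposite.unop_op, imInv_t, smul_assoc, map_smul, LinearMap.smul_apply,
    smul_eq_mul]

section Fin
variable [Fintype ι]

/-- The elements of `𝔻(X)` as linear functionals on the space of linear functionals on `X`. -/
def dualizingEquiv (X : ModuleCat.{u} D.H) : D.dualizing X ≃ₗ[ℂ] ((X →ₗ[ℂ] ℂ) →ₗ[ℂ] ℂ) :=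
  evEquiv D.star (D.twist (D.bulletDual X)) ≪≫ₗ
    ((twistEquiv (D.bulletDual X)).symm ≪≫ₗ evEquiv D.bullet X).arrowCongr (LinearEquiv.refl ℂ ℂ)

lemma dualizingEquiv_smul {X : ModuleCat.{u} D.H} (h : D.H) (q : D.dualizing X) (p : X →ₗ[ℂ] ℂ) :
    dualizingEquiv X (h • q) p = dualizingEquiv X q (p ∘ₗ op (MulOpposite.unop
      (D.bullet (D.imInv (MulOpposite.unop (D.star h))))) X) := rfl

/-- On `𝔻(X)` the Drinfeld generator `ṽ` acts as on the bidual of `X`. -/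
lemma dualizingEquiv_ftil_smul {X : ModuleCat.{u} D.H} (v : D.VC) (q : D.dualizing X)
    (p : X →ₗ[ℂ] ℂ) :
    dualizingEquiv X (D.ftil v • q) p = dualizingEquiv X q (p ∘ₗ op (D.ftil v) X) := by
  rw [dualizingEquiv_smul, star_ftil]
  simp only [MulOpposite.unop_neg, MulOpposite.unop_op, map_neg, imInv_ftil, bullet_ftil, neg_neg]

/-- On `𝔻(X)` the group `W` acts as on the bidual of `X`, up to the sign character. -/
lemma dualizingEquiv_t_smul {X : ModuleCat.{u} D.H} (w : D.W) (q : D.dualizing X)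
    (p : X →ₗ[ℂ] ℂ) :
    dualizingEquiv X (D.t w • q) p =
      D.sgn w⁻¹ * dualizingEquiv X q (p ∘ₗ op (D.t w) X) := by
  rw [dualizingEquiv_smul, star_t, MulOpposite.unop_op, imInv_t, map_smul, bullet_t, inv_inv,
    ← smul_eq_mul, ← map_smul]
  congr 1
  ext x
  simp [op_apply]

/-- On `ι(Y)^•` the Drinfeld generator `ṽ` acts by the negative transpose of its action on `Y`. -/
lemma contract_ftil_smul {Y : ModuleCat.{u} D.H} (v : D.VC) (y : Y)
    (g : D.bulletDual (D.twist Y)) :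
    D.contract Y y (D.ftil v • g) = - D.contract Y (D.ftil v • y) g := by
  change D.contract Y (D.imInv (MulOpposite.unop (D.bullet (D.ftil v))) • y) g = _
  rw [bullet_ftil, MulOpposite.unop_op, imInv_ftil, neg_smul, map_neg, LinearMap.neg_apply]

/-! ### Transposition of cochains -/

variable {i j n : ℕ} {X Y : ModuleCat.{u} D.H}

variable (X Y) in
/-- Transposition identifies linear maps `Y → 𝔻(X)` with linear maps `X^* → ι(Y)^•`. -/
def transE : (Y →ₗ[ℂ] D.dualizing X) ≃ₗ[ℂ]
    (D.starDual X →ₗ[ℂ] D.bulletDual (D.twist Y)) :=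
  (LinearEquiv.refl ℂ Y).arrowCongr (dualizingEquiv X) ≪≫ₗ
    flipEquiv Y (X →ₗ[ℂ] ℂ) ℂ ≪≫ₗ
    (evEquiv D.star X).symm.arrowCongr (contractEquiv Y).symm

lemma contract_transE (S : Y →ₗ[ℂ] D.dualizing X) (y : Y) (p : X →ₗ[ℂ] ℂ) :
    D.contract Y y (transE X Y S (starFunctional X p)) = dualizingEquiv X (S y) p := rfl

lemma starDual_hom_ext {S S' : D.starDual X →ₗ[ℂ] D.bulletDual (D.twist Y)}
    (h : ∀ p y, D.contract Y y (S (starFunctional X p)) =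
      D.contract Y y (S' (starFunctional X p))) : S = S' := by
  ext p
  apply (contractEquiv Y).injective
  ext y
  exact h (D.ev D.star X p) y

/-- Transposition intertwines the commutators with `ṽ`; this fails for `v` in place of `ṽ`. -/
lemma transE_commOp (v : D.VC) (S : Y →ₗ[ℂ] D.dualizing X) :
    transE X Y (commOp D.ftil Y (D.dualizing X) v S) =
      commOp D.ftil (D.starDual X) (D.bulletDual (D.twist Y)) v (transE X Y S) := by
  refine starDual_hom_ext fun p y => ?_
  rw [contract_transE, commOp_apply, commOp_apply, map_sub, map_sub, starDual_ftil_smul,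
    contract_ftil_smul, contract_transE, contract_transE, LinearMap.sub_apply,
    dualizingEquiv_ftil_smul, map_neg]
  ring

lemma transE_conjOp (w : D.W) (S : Y →ₗ[ℂ] D.dualizing X) :
    transE X Y (conjOp w Y (D.dualizing X) S) =
      conjOp w (D.starDual X) (D.bulletDual (D.twist Y)) (transE X Y S) := by
  refine starDual_hom_ext fun p y => ?_
  rw [contract_transE]
  change dualizingEquiv X (D.t w • S (D.t w⁻¹ • y)) p = D.contract Y y
    (D.t w • transE X Y S (D.t w⁻¹ • starFunctional X p))
  rw [starDual_t_smul, contract_t_smul, contract_transE, dualizingEquiv_t_smul, inv_inv]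

/-- The transposition of cochains, `η'(p; v)(y) = η(y; v)(p)`. -/
def transposeC : D.Cochain j Y (D.dualizing X) ≃ₗ[ℂ]
    D.Cochain j (D.starDual X) (D.bulletDual (D.twist Y)) where
  toFun η := flat.symm ((transE X Y).toLinearMap.compAlternatingMap (flat η))
  invFun η := flat.symm ((transE X Y).symm.toLinearMap.compAlternatingMap (flat η))
  left_inv η := rfl
  right_inv η := rfl
  map_add' η θ := by
    rw [← map_add]; congr 1
  map_smul' c η := by
    rw [RingHom.id_apply, ← map_smul]; congr 1; ext v; simp

lemma flat_transposeC (η : D.Cochain j Y (D.dualizing X)) :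
    flat (transposeC η) = (transE X Y).toLinearMap.compAlternatingMap (flat η) := rfl

lemma isTranspose_iff {η : D.Cochain j Y (D.dualizing X)}
    {η' : D.Cochain j (D.starDual X) (D.bulletDual (D.twist Y))} :
    IsTranspose η η' ↔ transposeC η = η' := by
  constructor
  · intro h
    apply flat.injective
    ext v : 1
    exact starDual_hom_ext fun p y => (h y p v).symm
  · rintro rfl y p v
    rfl

lemma dF_transposeC (η : D.Cochain j Y (D.dualizing X)) :
    dF D.ftil (transposeC η) = transposeC (dF D.ftil η) := by
  apply flat.injective
  rw [flat_dF, flat_transposeC, flat_transposeC, flat_dF]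
  exact koszulDiff_compAlternatingMap _ _ _ transE_commOp _

lemma conjC_transposeC (w : D.W) (η : D.Cochain j Y (D.dualizing X)) :
    conjC w (transposeC η) = transposeC (conjC w η) := by
  apply flat.injective
  rw [flat_conjC, flat_transposeC, flat_transposeC, flat_conjC]
  ext v : 1
  exact (transE_conjOp w _).symm

lemma isEquivariant_transposeC {η : D.Cochain j Y (D.dualizing X)} :
    IsEquivariant (transposeC η) ↔ IsEquivariant η := by
  simp only [isEquivariant_iff_conjC, conjC_transposeC, EmbeddingLike.apply_eq_iff_eq]

/-- Transposition is compatible with the differential of equivariant cochains, as this may be formed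
with the Drinfeld generators. -/
lemma dF_f_transposeC {η : D.Cochain j Y (D.dualizing X)} (hη : IsEquivariant η) :
    dF D.f (transposeC η) = transposeC (dF D.f η) := by
  rw [dF_f_eq_dF_ftil hη, dF_f_eq_dF_ftil (isEquivariant_transposeC.2 hη), dF_transposeC]

lemma isCocycle_transposeC {η : D.Cochain j Y (D.dualizing X)} :
    IsCocycle (transposeC η) ↔ IsCocycle η := by
  rw [isCocycle_iff, isCocycle_iff, isEquivariant_transposeC]
  refine and_congr_right fun h => ?_
  rw [dF_f_transposeC h, EmbeddingLike.map_eq_zero_iff]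

/-- The transposition of cocycles. -/
def transposeZ : cocycles j Y (D.dualizing X) ≃ₗ[ℂ]
    cocycles j (D.starDual X) (D.bulletDual (D.twist Y)) :=
  transposeC.ofSubmodules _ _ (by
    ext η
    obtain ⟨η, rfl⟩ := transposeC.surjective η
    refine ⟨?_, fun h => ⟨η, isCocycle_transposeC.1 h, rfl⟩⟩
    rintro ⟨θ, hθ, h⟩
    rw [← h]
    exact isCocycle_transposeC.2 hθ)

lemma coe_transposeZ (η : cocycles j Y (D.dualizing X)) :
    (transposeZ η).1 = transposeC η.1 := rfl

lemma cls_transposeZ_eq_zero_iff (η : cocycles j Y (D.dualizing X)) :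
    cls j _ _ (transposeZ η) = 0 ↔ cls j _ _ η = 0 := by
  cases j with
  | zero =>
    rw [cls_zero_eq_zero_iff, cls_zero_eq_zero_iff, coe_transposeZ, EmbeddingLike.map_eq_zero_iff]
  | succ j =>
    rw [cls_succ_eq_zero_iff, cls_succ_eq_zero_iff, coe_transposeZ]
    constructor
    · rintro ⟨θ, hθ, h⟩
      obtain ⟨θ, rfl⟩ := transposeC.surjective θ
      have hθ := isEquivariant_transposeC.1 hθ
      rw [dF_f_transposeC hθ] at h
      exact ⟨θ, hθ, transposeC.injective h⟩
    · rintro ⟨θ, hθ, h⟩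
      exact ⟨transposeC θ, isEquivariant_transposeC.2 hθ, by rw [dF_f_transposeC hθ, h]⟩

/-- An isomorphism of spaces of cocycles that matches the coboundaries induces an isomorphism of
`Ext` groups. -/
lemma exists_ext_equiv {A B A' B' : ModuleCat.{u} D.H} (τ : cocycles j A B ≃ₗ[ℂ] cocycles j A' B')
    (h : ∀ η, cls j A' B' (τ η) = 0 ↔ cls j A B η = 0) :
    ∃ T : Abelian.Ext A B j ≃ₗ[ℂ] Abelian.Ext A' B' j, ∀ η, T (cls j A B η) = cls j A' B' (τ η) :=
  exists_linearEquiv_of_ker (Z := cocycles j A B) (Z' := cocycles j A' B') _ _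
    (cls_surjective j A B) (cls_surjective j A' B') τ h

variable (j X Y) in
lemma exists_extTranspose : ∃ T : Abelian.Ext Y (D.dualizing X) j ≃ₗ[ℂ]
    Abelian.Ext (D.starDual X) (D.bulletDual (D.twist Y)) j,
    ∀ η, T (cls j Y (D.dualizing X) η) =
      cls j (D.starDual X) (D.bulletDual (D.twist Y)) (transposeZ η) :=
  exists_ext_equiv transposeZ cls_transposeZ_eq_zero_iff

variable (j X Y) in
/-- The isomorphism of `Ext` groups induced by the transposition of cocycles. -/
def extTranspose : Abelian.Ext Y (D.dualizing X) j ≃ₗ[ℂ]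
    Abelian.Ext (D.starDual X) (D.bulletDual (D.twist Y)) j :=
  (exists_extTranspose j X Y).choose

lemma extTranspose_cls (η : cocycles j Y (D.dualizing X)) :
    extTranspose j X Y (cls j Y (D.dualizing X) η) =
      cls j (D.starDual X) (D.bulletDual (D.twist Y)) (transposeZ η) :=
  (exists_extTranspose j X Y).choose_spec η

lemma isDualIdentification_extTranspose : IsDualIdentification (extTranspose j X Y) where
  exists_transpose b := by
    obtain ⟨η, rfl⟩ := cls_surjective j _ _ b
    exact ⟨η.1, transposeC η.1, represents_cls η, isTranspose_iff.2 rfl⟩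
  represents b η η' hη h := by
    obtain ⟨hc, rfl⟩ := represents_iff.1 hη
    rw [← isTranspose_iff.1 h]
    have h1 := extTranspose_cls (⟨η, hc⟩ : cocycles j Y (D.dualizing X))
    rw [cls_apply] at h1
    rw [h1]
    exact represents_cls (transposeZ ⟨η, hc⟩)

end Fin

end HeckeDatum

namespace HeckeDatum

variable {ι V₀ N : Type u} [AddCommGroup V₀] [Module ℝ V₀] [AddCommGroup N] [Module ℝ N]
  {D : HeckeDatum ι V₀ N}

/-! ### The complex of equivariant cochains -/

section Equivariants

variable [Fintype ι] {i : ℕ} {X Y : ModuleCat.{u} D.H}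

variable (i) in
/-- The differential of equivariant cochains. -/
def dEquiv (X Y : ModuleCat.{u} D.H) : equivariants i X Y →ₗ[ℂ] equivariants (i + 1) X Y :=
  (dF D.f).restrict fun _ hη => hη.dF_f

lemma coe_dEquiv (η : equivariants i X Y) : (dEquiv i X Y η).1 = dF D.f η.1 := rfl

end Equivariants

/-! ### The trace form -/

variable [FiniteDimensional ℝ V₀]

lemma det_act (w : D.W) : LinearMap.det (D.act w) = D.sgn w := by
  rw [act, LinearMap.det_baseChange]
  rfl

variable [Fintype ι] {i j n : ℕ} {X Y : ModuleCat.{u} D.H}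

variable (X) in
/-- The trace of a linear map `X → 𝔻(X)`, where `𝔻(X)` is identified with the bidual of `X`. -/
def trD [FiniteDimensional ℂ X] : (X →ₗ[ℂ] D.dualizing X) →ₗ[ℂ] ℂ where
  toFun S := ∑ r, dualizingEquiv X (S (Module.finBasis ℂ X r)) ((Module.finBasis ℂ X).coord r)
  map_add' S T := by simp [Finset.sum_add_distrib]
  map_smul' c S := by simp [Finset.mul_sum]

variable [FiniteDimensional ℂ X]

lemma trD_apply (S : X →ₗ[ℂ] D.dualizing X) : trD X S =
    ∑ r, dualizingEquiv X (S (Module.finBasis ℂ X r)) ((Module.finBasis ℂ X).coord r) := rfl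

lemma trD_comp (S : X →ₗ[ℂ] D.dualizing X) (A : X →ₗ[ℂ] X) : trD X (S ∘ₗ A) =
    ∑ r, dualizingEquiv X (S (Module.finBasis ℂ X r)) ((Module.finBasis ℂ X).coord r ∘ₗ A) :=
  sum_basis_coord_comp (Module.finBasis ℂ X) ((dualizingEquiv X).toLinearMap ∘ₗ S) A

/-- The trace of a commutator with `ṽ` vanishes, since `ṽ` acts on `𝔻(X)` as on the bidual of `X`.
-/
lemma trD_commOp (v : D.VC) (S : X →ₗ[ℂ] D.dualizing X) :
    trD X (commOp D.ftil X (D.dualizing X) v S) = 0 := by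
  have h : trD X (commOp D.ftil X (D.dualizing X) v S) =
      trD X (op (D.ftil v) (D.dualizing X) ∘ₗ S) - trD X (S ∘ₗ op (D.ftil v) X) :=
    map_sub (trD X) _ _
  rw [h, trD_comp, trD_apply, sub_eq_zero]
  refine Finset.sum_congr rfl fun r _ => ?_
  exact dualizingEquiv_ftil_smul v _ _

/-- Under conjugation by `t_w` the trace picks up the sign by which `𝔻(X)` differs from the bidual.
-/
lemma trD_conjOp (w : D.W) (S : X →ₗ[ℂ] D.dualizing X) :
    trD X (conjOp w X (D.dualizing X) S) = D.sgn w⁻¹ * trD X S := by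
  have h : conjOp w X (D.dualizing X) S =
      (op (D.t w) (D.dualizing X) ∘ₗ S) ∘ₗ op (D.t w⁻¹) X := rfl
  rw [h, trD_comp, trD_apply, Finset.mul_sum]
  refine Finset.sum_congr rfl fun r _ => ?_
  rw [LinearMap.comp_apply, op_apply, dualizingEquiv_t_smul]
  congr 2
  ext x
  simp only [LinearMap.comp_apply, op_apply, t_inv_smul_t_smul]

/-- The trace form is non-degenerate in its first argument, as maps of rank one show. -/
lemma trD_comp_left_eq_zero {S : X →ₗ[ℂ] Y}
    (h : ∀ T : Y →ₗ[ℂ] D.dualizing X, trD X (T ∘ₗ S) = 0) : S = 0 := by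
  ext x
  rw [LinearMap.zero_apply, ← Module.forall_dual_apply_eq_zero_iff ℂ]
  intro ψ
  -- The map of rank one `y ↦ ψ(y) ev_x`.
  have h1 := h (ψ.smulRight ((dualizingEquiv X).symm (Module.Dual.eval ℂ X x)))
  rw [trD_apply] at h1
  simp only [LinearMap.comp_apply, LinearMap.smulRight_apply, map_smul,
    LinearEquiv.apply_symm_apply, LinearMap.smul_apply, Module.Dual.eval_apply, smul_eq_mul] at h1
  have h2 : ψ (S x) = ∑ r, ψ (S (Module.finBasis ℂ X r)) * (Module.finBasis ℂ X).coord r x := by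
    conv_lhs => rw [← (Module.finBasis ℂ X).sum_repr x]
    simp only [map_sum, map_smul, smul_eq_mul, Module.Basis.coord_apply]
    exact Finset.sum_congr rfl fun r _ => mul_comm _ _
  exact h2.trans h1

/-- The trace form is non-degenerate in its second argument, as maps of rank one show. -/
lemma trD_comp_right_eq_zero {T : Y →ₗ[ℂ] D.dualizing X}
    (h : ∀ S : X →ₗ[ℂ] Y, trD X (T ∘ₗ S) = 0) : T = 0 := by
  ext y
  apply (dualizingEquiv X).injective
  ext p
  have h1 := h (p.smulRight y)
  rw [trD_apply] at h1
  simp only [LinearMap.comp_apply, LinearMap.smulRight_apply, map_smul,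
    LinearMap.smul_apply, smul_eq_mul] at h1
  have h2 : p = ∑ r, p (Module.finBasis ℂ X r) • (Module.finBasis ℂ X).coord r := by
    refine (Module.finBasis ℂ X).ext fun s => ?_
    rw [LinearMap.sum_apply, Finset.sum_eq_single s]
    · simp
    · intro t _ hts
      simp [hts.symm]
    · simp
  rw [LinearMap.zero_apply, map_zero, LinearMap.zero_apply, ← h1]
  conv_lhs => rw [h2]
  simp only [map_sum, map_smul, smul_eq_mul]

/-- The fundamental class: the trace of the value of a cochain of top degree at a basis. -/
def fund (e : Fin n → D.VC) : D.Cochain n X (D.dualizing X) →ₗ[ℂ] ℂ where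
  toFun ω := trD X (flat ω e)
  map_add' ω ω' := by rw [map_add, AlternatingMap.add_apply, map_add]
  map_smul' c ω := by rw [map_smul, AlternatingMap.smul_apply, map_smul, RingHom.id_apply]

lemma fund_apply (e : Fin n → D.VC) (ω : D.Cochain n X (D.dualizing X)) :
    fund e ω = trD X (flat ω e) := rfl

/-- Stokes' theorem: the fundamental class vanishes on differentials. -/
lemma fund_dF (e : Fin (n + 1) → D.VC) (ω : D.Cochain n X (D.dualizing X)) :
    fund e (dF D.ftil ω) = 0 := by
  rw [fund_apply, flat_dF, koszulDiff_apply, map_sum]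
  refine Finset.sum_eq_zero fun a _ => ?_
  rw [map_zsmul, trD_commOp, smul_zero]

/-- The fundamental class is `W`-invariant: the sign of `w` on the trace and its determinant on top
forms cancel. -/
lemma fund_conjC (e : Module.Basis (Fin n) ℂ D.VC) (w : D.W)
    (ω : D.Cochain n X (D.dualizing X)) : fund e (conjC w ω) = fund e ω := by
  have h := AlternatingMap.eq_smul_basis_det e ((trD X).compAlternatingMap (flat ω))
  have h1 := DFunLike.congr_fun h (D.act w⁻¹ ∘ e)
  have h2 : e.det (D.act w⁻¹ ∘ e) = D.sgn w⁻¹ := by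
    have h5 := Module.Basis.det_comp e (D.act w⁻¹) e
    rwa [Module.Basis.det_self, mul_one, det_act] at h5
  rw [AlternatingMap.smul_apply, h2] at h1
  have h3 : fund e (conjC w ω) =
      D.sgn w⁻¹ * trD X (flat ω (D.act w⁻¹ ∘ e)) := by
    rw [fund_apply, flat_conjC]
    exact trD_conjOp w _
  have h4 : trD X (flat ω (D.act w⁻¹ ∘ e)) = fund e ω * D.sgn w⁻¹ := h1
  rw [h3, h4, mul_left_comm, sgn_mul_self, mul_one]

/-- The pairing `(η, θ) ↦ tr((η θ)(e₁, …, eₙ))` of cochains of complementary degrees. -/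
def cochainPair (h : i + j = n) (e : Fin n → D.VC) (X Y : ModuleCat.{u} D.H)
    [FiniteDimensional ℂ X] :
    D.Cochain i X Y →ₗ[ℂ] D.Cochain j Y (D.dualizing X) →ₗ[ℂ] ℂ :=
  (cup h).compr₂ (fund e)

lemma cochainPair_apply (h : i + j = n) (e : Fin n → D.VC) (η : D.Cochain i X Y)
    (θ : D.Cochain j Y (D.dualizing X)) :
    cochainPair h e X Y η θ = fund e (cup h η θ) := rfl

/-- Up to transposition, the duality pairing of cochains is the product of cochains followed by the
fundamental class. -/
lemma cochainPairing_transposeC (h : i + j = n) (e : Fin n → D.VC) (η : D.Cochain i X Y)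
    (θ : D.Cochain j Y (D.dualizing X)) :
    cochainPairing h e η (transposeC θ) = cochainPair h e X Y η θ := by
  rw [cochainPair_apply, fund_apply, trD_apply, flat_cup]
  refine Finset.sum_congr rfl fun r _ => ?_
  have h1 := comp_wedge (compB X Y (D.dualizing X)) (D.contract Y)
    (LinearMap.applyₗ (Module.finBasis ℂ X r))
    (LinearMap.applyₗ (starFunctional X ((Module.finBasis ℂ X).coord r)) ∘ₗ
      (transE X Y).toLinearMap)
    (LinearMap.applyₗ ((Module.finBasis ℂ X).coord r) ∘ₗ (dualizingEquiv X).toLinearMap ∘ₗ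
      LinearMap.applyₗ (Module.finBasis ℂ X r)) (fun _ _ => rfl) h (flat η) (flat θ)
  exact (DFunLike.congr_fun h1 e).symm

variable (X Y) in
/-- The trace form `(S, T) ↦ tr(T ∘ S)`. -/
def trB : (X →ₗ[ℂ] Y) →ₗ[ℂ] (Y →ₗ[ℂ] D.dualizing X) →ₗ[ℂ] ℂ :=
  (compB X Y (D.dualizing X)).compr₂ (trD X)

lemma cochainPair_eq_wedge (h : i + j = n) (e : Fin n → D.VC) (η : D.Cochain i X Y)
    (θ : D.Cochain j Y (D.dualizing X)) :
    cochainPair h e X Y η θ = wedge (trB X Y) h (flat η) (flat θ) e :=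
  DFunLike.congr_fun (comp_wedge (compB X Y (D.dualizing X)) (trB X Y) LinearMap.id LinearMap.id
    (trD X) (fun _ _ => rfl) h (flat η) (flat θ)) e

lemma wedge_trB_eq_zero (h : i + j = n) (e : Module.Basis (Fin n) ℂ D.VC) {η : D.Cochain i X Y}
    {θ : D.Cochain j Y (D.dualizing X)} (h0 : cochainPair h e X Y η θ = 0) :
    wedge (trB X Y) h (flat η) (flat θ) = 0 := by
  rw [AlternatingMap.eq_smul_basis_det e (wedge (trB X Y) h (flat η) (flat θ)),
    ← cochainPair_eq_wedge, h0, zero_smul]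

lemma eq_zero_of_cochainPair_left (h : i + j = n) (e : Module.Basis (Fin n) ℂ D.VC)
    {η : D.Cochain i X Y} (hη : ∀ θ, cochainPair h e X Y η θ = 0) : η = 0 := by
  have := Module.Finite.of_basis e
  apply flat.injective
  rw [map_zero]
  refine eq_zero_of_wedge_left (trB X Y) (fun S hS => trD_comp_left_eq_zero hS) h
    (by rw [Module.finrank_eq_card_basis e, Fintype.card_fin]) _ fun b => ?_
  obtain ⟨θ, rfl⟩ := flat.surjective b
  exact wedge_trB_eq_zero h e (hη θ)

lemma eq_zero_of_cochainPair_right (h : i + j = n) (e : Module.Basis (Fin n) ℂ D.VC)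
    {θ : D.Cochain j Y (D.dualizing X)} (hθ : ∀ η, cochainPair h e X Y η θ = 0) : θ = 0 := by
  have := Module.Finite.of_basis e
  apply flat.injective
  rw [map_zero]
  refine eq_zero_of_wedge_right (trB X Y) (fun S hS => trD_comp_right_eq_zero hS) h
    (by rw [Module.finrank_eq_card_basis e, Fintype.card_fin]) _ fun b => ?_
  obtain ⟨η, rfl⟩ := flat.surjective b
  exact wedge_trB_eq_zero h e (hθ η)

lemma cochainPair_conjC (h : i + j = n) (e : Module.Basis (Fin n) ℂ D.VC) (w : D.W)
    (η : D.Cochain i X Y) (θ : D.Cochain j Y (D.dualizing X)) :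
    cochainPair h e X Y (conjC w η) (conjC w θ) = cochainPair h e X Y η θ := by
  rw [cochainPair_apply, ← conjC_cup, fund_conjC, cochainPair_apply]

/-- An equivariant cochain has the same pairing with a cochain and with its average. -/
lemma cochainPair_average_right (h : i + j = n) (e : Module.Basis (Fin n) ℂ D.VC)
    {η : D.Cochain i X Y} (hη : IsEquivariant η) (θ : D.Cochain j Y (D.dualizing X)) :
    cochainPair h e X Y η (average θ) = cochainPair h e X Y η θ := by
  have h1 : ∀ w, cochainPair h e X Y η (conjC w θ) = cochainPair h e X Y η θ := by
    intro w
    have h2 := cochainPair_conjC h e w η θ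
    rwa [isEquivariant_iff_conjC.1 hη w] at h2
  rw [average_apply, map_smul, map_sum, Finset.sum_congr rfl fun w _ => h1 w]
  exact average_const_smul (D := D) _

lemma cochainPair_average_left (h : i + j = n) (e : Module.Basis (Fin n) ℂ D.VC)
    (η : D.Cochain i X Y) {θ : D.Cochain j Y (D.dualizing X)} (hθ : IsEquivariant θ) :
    cochainPair h e X Y (average η) θ = cochainPair h e X Y η θ := by
  have h1 : ∀ w, cochainPair h e X Y (conjC w η) θ = cochainPair h e X Y η θ := by
    intro w
    have h2 := cochainPair_conjC h e w η θ
    rwa [isEquivariant_iff_conjC.1 hθ w] at h2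
  rw [average_apply, map_smul, map_sum, LinearMap.smul_apply, LinearMap.sum_apply,
    Finset.sum_congr rfl fun w _ => h1 w]
  exact average_const_smul (D := D) _

/-- The pairing of equivariant cochains. -/
def equivPair (h : i + j = n) (e : Fin n → D.VC) (X Y : ModuleCat.{u} D.H)
    [FiniteDimensional ℂ X] :
    equivariants i X Y →ₗ[ℂ] equivariants j Y (D.dualizing X) →ₗ[ℂ] ℂ :=
  (cochainPair h e X Y).compl₁₂ (Submodule.subtype _) (Submodule.subtype _)

lemma equivPair_apply (h : i + j = n) (e : Fin n → D.VC) (η : equivariants i X Y)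
    (θ : equivariants j Y (D.dualizing X)) :
    equivPair h e X Y η θ = cochainPair h e X Y η.1 θ.1 := rfl

lemma eq_zero_of_equivPair_left (h : i + j = n) (e : Module.Basis (Fin n) ℂ D.VC)
    (η : equivariants i X Y) (hη : ∀ θ, equivPair h e X Y η θ = 0) : η = 0 :=
  Subtype.ext <| eq_zero_of_cochainPair_left h e fun θ => by
    rw [← cochainPair_average_right h e η.2]
    exact hη ⟨_, isEquivariant_average θ⟩

lemma eq_zero_of_equivPair_right (h : i + j = n) (e : Module.Basis (Fin n) ℂ D.VC)
    (θ : equivariants j Y (D.dualizing X)) (hθ : ∀ η, equivPair h e X Y η θ = 0) : θ = 0 :=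
  Subtype.ext <| eq_zero_of_cochainPair_right h e fun η => by
    rw [← cochainPair_average_left h e η θ.2]
    exact hθ ⟨_, isEquivariant_average η⟩

/-- The differentials are adjoint up to a sign: the Leibniz rule and Stokes' theorem. -/
lemma equivPair_dEquiv (h : i + (j + 1) = n) (h' : i + 1 + j = n) (e : Fin n → D.VC)
    (η : equivariants i X Y) (θ : equivariants j Y (D.dualizing X)) :
    equivPair h e X Y η (dEquiv j _ _ θ) =
      (-1) ^ (i + 1) * equivPair h' e X Y (dEquiv i _ _ η) θ := by
  obtain ⟨m, rfl⟩ : ∃ m, n = m + 1 := ⟨n - 1, by omega⟩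
  have h1 := fund_dF e (cup (by omega : i + j = m) η.1 θ.1)
  rw [dF_cup _ _ h' h, map_add, map_zsmul] at h1
  have h2 : ((-1 : ℂ) ^ i) * (-1) ^ i = 1 := by
    rw [← mul_pow]; simp
  rw [equivPair_apply, equivPair_apply, coe_dEquiv, coe_dEquiv, dF_f_eq_dF_ftil η.2,
    dF_f_eq_dF_ftil θ.2, cochainPair_apply, cochainPair_apply]
  rw [zsmul_eq_mul] at h1
  push_cast at h1
  linear_combination (-1) ^ i * h1 - fund e (cup h η.1 (dF D.ftil θ.1)) * h2

end HeckeDatum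

namespace HeckeDatum

variable {ι V₀ N : Type u} [AddCommGroup V₀] [Module ℝ V₀] [AddCommGroup N] [Module ℝ N]
  {D : HeckeDatum ι V₀ N}

/-! ### Duality on cohomology -/

variable {i j n : ℕ} {X Y : ModuleCat.{u} D.H}

lemma cochain_eq_zero (e : Module.Basis (Fin n) ℂ D.VC) (hi : n < i) (η : D.Cochain i X Y) :
    η = 0 := by
  have := Module.Finite.of_basis e
  ext x v
  refine (η x).map_linearDependent v fun hv => ?_
  have h1 := hv.fintype_card_le_finrank
  rw [Module.finrank_eq_card_basis e, Fintype.card_fin, Fintype.card_fin] at h1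
  omega

lemma finite_cochain [FiniteDimensional ℝ V₀] [FiniteDimensional ℂ X] [FiniteDimensional ℂ Y] :
    FiniteDimensional ℂ (D.Cochain i X Y) := by
  have : FiniteDimensional ℂ (D.VC [⋀^Fin i]→ₗ[ℂ] Y) :=
    FiniteDimensional.of_injective
      (AlternatingMap.toMultilinearMapLM : (D.VC [⋀^Fin i]→ₗ[ℂ] Y) →ₗ[ℂ] _)
      AlternatingMap.coe_multilinearMap_injective
  exact Module.Finite.linearMap ℂ ℂ X (D.VC [⋀^Fin i]→ₗ[ℂ] Y)

variable [FiniteDimensional ℝ V₀] [Fintype ι]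

variable (X Y) in
/-- The pairing of `Ext` groups that is defined by a linear functional `𝒟` on the top `Ext` group,
the Yoneda product and the transposition of cocycles. -/
def poincareForm (𝒟 : Abelian.Ext X (D.dualizing X) n →ₗ[ℂ] ℂ) (hij : i + j = n) :
    Abelian.Ext X Y i →ₗ[ℂ] Abelian.Ext (D.starDual X) (D.bulletDual (D.twist Y)) j →ₗ[ℂ] ℂ :=
  ((Abelian.Ext.bilinearCompOfLinear ℂ X Y (D.dualizing X) i j n hij).compr₂ 𝒟).compl₂
    (extTranspose j X Y).symm.toLinearMap

lemma poincareForm_extTranspose (𝒟 : Abelian.Ext X (D.dualizing X) n →ₗ[ℂ] ℂ) (hij : i + j = n)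
    (a : Abelian.Ext X Y i) (b : Abelian.Ext Y (D.dualizing X) j) :
    poincareForm X Y 𝒟 hij a (extTranspose j X Y b) = 𝒟 (a.comp b hij) := by
  change 𝒟 (a.comp ((extTranspose j X Y).symm (extTranspose j X Y b)) hij) = _
  rw [LinearEquiv.symm_apply_apply]

variable [FiniteDimensional ℂ X]

lemma finite_dualizing : FiniteDimensional ℂ (D.dualizing X) :=
  Module.Finite.equiv (dualizingEquiv X).symm

/-- A cocycle on `X` that is orthogonal to all cocycles of complementary degree with values in
`𝔻(X)` is a coboundary. -/
lemma cls_eq_zero_of_left [FiniteDimensional ℂ Y] (h : i + j = n) (e : Module.Basis (Fin n) ℂ D.VC)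
    (η : cocycles i X Y)
    (hη : ∀ θ : cocycles j Y (D.dualizing X), cochainPair h e X Y η.1 θ.1 = 0) :
    cls i X Y η = 0 := by
  cases i with
  | zero =>
    rw [cls_zero_eq_zero_iff]
    refine congrArg Subtype.val (eq_zero_of_equivPair_left h e
      ⟨η.1, (mem_cocycles.1 η.2).equivariant⟩ fun θ => ?_)
    exact hη ⟨θ.1, isCocycle_iff.2 ⟨θ.2, cochain_eq_zero e (by omega) _⟩⟩
  | succ i =>
    rw [cls_succ_eq_zero_iff]
    have h0 := finite_dualizing (X := X)
    have h1 : FiniteDimensional ℂ (D.Cochain (j + 1) Y (D.dualizing X)) := finite_cochain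
    obtain ⟨ζ, hζ⟩ := exists_eq_of_adjoint (A := equivariants (i + 1) X Y)
      (A' := equivariants i X Y) (B := equivariants j Y (D.dualizing X))
      (B' := equivariants (j + 1) Y (D.dualizing X)) (equivPair h e X Y)
      (equivPair (by omega : i + (j + 1) = n) e X Y) (eq_zero_of_equivPair_left h e)
      (eq_zero_of_equivPair_right _ e) (dEquiv i X Y) (dEquiv j Y (D.dualizing X)) _
      (equivPair_dEquiv _ h e) ⟨η.1, (mem_cocycles.1 η.2).equivariant⟩
      (fun θ hθ => hη ⟨θ.1, isCocycle_iff.2 ⟨θ.2, congrArg Subtype.val hθ⟩⟩)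
    exact ⟨ζ.1, ζ.2, congrArg Subtype.val hζ⟩

/-- A cocycle with values in `𝔻(X)` that is orthogonal to all cocycles on `X` of complementary
degree is a coboundary. -/
lemma cls_eq_zero_of_right [FiniteDimensional ℂ Y] (h : i + j = n)
    (e : Module.Basis (Fin n) ℂ D.VC) (θ : cocycles j Y (D.dualizing X))
    (hθ : ∀ η : cocycles i X Y, cochainPair h e X Y η.1 θ.1 = 0) :
    cls j Y (D.dualizing X) θ = 0 := by
  cases j with
  | zero =>
    rw [cls_zero_eq_zero_iff]
    refine congrArg Subtype.val (eq_zero_of_equivPair_right h e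
      ⟨θ.1, (mem_cocycles.1 θ.2).equivariant⟩ fun η => ?_)
    exact hθ ⟨η.1, isCocycle_iff.2 ⟨η.2, cochain_eq_zero e (by omega) _⟩⟩
  | succ j =>
    rw [cls_succ_eq_zero_iff]
    have h1 : FiniteDimensional ℂ (D.Cochain (i + 1) X Y) := finite_cochain
    have h2 : ((-1 : ℂ) ^ (i + 1)) * (-1) ^ (i + 1) = 1 := by
      rw [← mul_pow]; simp
    obtain ⟨ζ, hζ⟩ := exists_eq_of_adjoint (A := equivariants (j + 1) Y (D.dualizing X))
      (A' := equivariants j Y (D.dualizing X)) (B := equivariants i X Y)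
      (B' := equivariants (i + 1) X Y) (equivPair h e X Y).flip
      (equivPair (by omega : i + 1 + j = n) e X Y).flip (eq_zero_of_equivPair_right h e)
      (eq_zero_of_equivPair_left _ e) (dEquiv j Y (D.dualizing X)) (dEquiv i X Y)
      ((-1) ^ (i + 1))
      (fun a b => by
        rw [LinearMap.flip_apply, LinearMap.flip_apply, equivPair_dEquiv h (by omega) e b a,
          ← mul_assoc, h2, one_mul])
      ⟨θ.1, (mem_cocycles.1 θ.2).equivariant⟩
      (fun η hη => hθ ⟨η.1, isCocycle_iff.2 ⟨η.2, congrArg Subtype.val hη⟩⟩)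
    exact ⟨ζ.1, ζ.2, congrArg Subtype.val hζ⟩

lemma fund_eq_zero_of_cls (e : Fin n → D.VC) (ω : cocycles n X (D.dualizing X))
    (hω : cls n X (D.dualizing X) ω = 0) : fund e ω.1 = 0 := by
  cases n with
  | zero => rw [(cls_zero_eq_zero_iff ω).1 hω, map_zero]
  | succ n =>
    obtain ⟨θ, hθ, h⟩ := (cls_succ_eq_zero_iff ω).1 hω
    rw [← h, dF_f_eq_dF_ftil hθ, fund_dF]

/-- The fundamental class descends to the top `Ext` group. -/
lemma exists_fund_cls (e : Fin n → D.VC) : ∃ 𝒟 : Abelian.Ext X (D.dualizing X) n →ₗ[ℂ] ℂ,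
    ∀ ω : cocycles n X (D.dualizing X), 𝒟 (cls n X (D.dualizing X) ω) = fund e ω.1 := by
  obtain ⟨s, hs⟩ := (cls n X (D.dualizing X)).exists_rightInverse_of_surjective
    (LinearMap.range_eq_top.2 (cls_surjective n X (D.dualizing X)))
  refine ⟨fund e ∘ₗ Submodule.subtype _ ∘ₗ s, fun ω => ?_⟩
  rw [← sub_eq_zero]
  refine Eq.trans ?_ (fund_eq_zero_of_cls e (s (cls n X (D.dualizing X) ω) - ω) ?_)
  · exact (map_sub (fund e) _ _).symm
  · refine ((cls n X (D.dualizing X)).map_sub (s (cls n X (D.dualizing X) ω)) ω).trans ?_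
    exact sub_eq_zero.2 (LinearMap.congr_fun hs _)

/-- On classes of cocycles, the form is the pairing of the cocycles. -/
lemma poincareForm_cls {e : Fin n → D.VC} {𝒟 : Abelian.Ext X (D.dualizing X) n →ₗ[ℂ] ℂ}
    (h𝒟 : ∀ ω : cocycles n X (D.dualizing X), 𝒟 (cls n X (D.dualizing X) ω) = fund e ω.1)
    (hij : i + j = n) (η : cocycles i X Y) (θ : cocycles j Y (D.dualizing X)) :
    poincareForm X Y 𝒟 hij (cls i X Y η) (cls j _ _ (transposeZ θ)) =
      cochainPair hij e X Y η.1 θ.1 := by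
  rw [← extTranspose_cls, poincareForm_extTranspose, cls_apply, cls_apply, koszulCls_comp_koszulCls]
  exact h𝒟 ⟨cup hij η.1 θ.1, isCocycle_cup η.2 θ.2 hij⟩

/-- The form defined by the Yoneda product and the fundamental class is the duality pairing. -/
lemma isPoincarePairing_of_fund [FiniteDimensional ℂ Y] (e : Module.Basis (Fin n) ℂ D.VC)
    {𝒟 : Abelian.Ext X (D.dualizing X) n →ₗ[ℂ] ℂ}
    (h𝒟 : ∀ ω : cocycles n X (D.dualizing X), 𝒟 (cls n X (D.dualizing X) ω) = fund e ω.1)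
    (hij : i + j = n) : IsPoincarePairing hij e (poincareForm X Y 𝒟 hij) where
  exists_left a := by
    obtain ⟨η, rfl⟩ := cls_surjective i X Y a
    exact ⟨η.1, represents_cls η⟩
  exists_right b := by
    obtain ⟨η, rfl⟩ := cls_surjective j _ _ b
    exact ⟨η.1, represents_cls η⟩
  apply_eq a b η η' ha hb := by
    obtain ⟨hη, rfl⟩ := represents_iff.1 ha
    obtain ⟨hη', rfl⟩ := represents_iff.1 hb
    obtain ⟨θ, rfl⟩ := transposeC.surjective η'
    have hθ := isCocycle_transposeC.1 hη'
    rw [cochainPairing_transposeC]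
    exact poincareForm_cls h𝒟 hij ⟨η, hη⟩ ⟨θ, hθ⟩
  nondegenerate := by
    refine ⟨fun a ha => ?_, fun b hb => ?_⟩
    · obtain ⟨η, rfl⟩ := cls_surjective i X Y a
      refine cls_eq_zero_of_left hij e η fun θ => ?_
      rw [← poincareForm_cls h𝒟 hij η θ]
      exact ha _
    · obtain ⟨b, rfl⟩ := (extTranspose j X Y).surjective b
      obtain ⟨θ, rfl⟩ := cls_surjective j Y (D.dualizing X) b
      rw [cls_eq_zero_of_right hij e θ fun η => ?_, map_zero]
      rw [← poincareForm_cls h𝒟 hij η θ, ← extTranspose_cls]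
      exact hb _

end HeckeDatum
end

theorem mainTheorem2 {ι V₀ N : Type u} [AddCommGroup V₀] [Module ℝ V₀] [AddCommGroup N]
    [Module ℝ N] [Finite ι] [FiniteDimensional ℝ V₀] (D : HeckeDatum ι V₀ N) (n : ℕ)
    (hn : Module.finrank ℂ D.VC = n) (X : ModuleCat.{u} D.H) [FiniteDimensional ℂ X] :
    (Nontrivial X → Nontrivial (Abelian.Ext X (D.dualizing X) n)) ∧
    (∀ (Y : ModuleCat.{u} D.H) [FiniteDimensional ℂ Y] (i j : ℕ) (hij : i + j = n),
      (Abelian.Ext.bilinearCompOfLinear ℂ X Y (D.dualizing X) i j n hij).Nondegenerate) ∧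
    (∀ e : Module.Basis (Fin n) ℂ D.VC,
      ∃ 𝒟 : Abelian.Ext X (D.dualizing X) n →ₗ[ℂ] ℂ,
        ∀ (Y : ModuleCat.{u} D.H) [FiniteDimensional ℂ Y] (i j : ℕ) (hij : i + j = n),
          ∃ (B : Abelian.Ext X Y i →ₗ[ℂ]
                Abelian.Ext (D.starDual X) (D.bulletDual (D.twist Y)) j →ₗ[ℂ] ℂ)
            (T : Abelian.Ext Y (D.dualizing X) j ≃ₗ[ℂ]
                Abelian.Ext (D.starDual X) (D.bulletDual (D.twist Y)) j),
            HeckeDatum.IsPoincarePairing hij e B ∧ HeckeDatum.IsDualIdentification T ∧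
              ∀ (a : Abelian.Ext X Y i) (b : Abelian.Ext Y (D.dualizing X) j),
                𝒟 (a.comp b hij) = B a (T b)) := by
  have := Fintype.ofFinite ι
  have key : ∀ e : Module.Basis (Fin n) ℂ D.VC,
      ∃ 𝒟 : Abelian.Ext X (D.dualizing X) n →ₗ[ℂ] ℂ,
        ∀ (Y : ModuleCat.{u} D.H) [FiniteDimensional ℂ Y] (i j : ℕ) (hij : i + j = n),
          ∃ (B : Abelian.Ext X Y i →ₗ[ℂ]
                Abelian.Ext (D.starDual X) (D.bulletDual (D.twist Y)) j →ₗ[ℂ] ℂ)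
            (T : Abelian.Ext Y (D.dualizing X) j ≃ₗ[ℂ]
                Abelian.Ext (D.starDual X) (D.bulletDual (D.twist Y)) j),
            HeckeDatum.IsPoincarePairing hij e B ∧ HeckeDatum.IsDualIdentification T ∧
              ∀ (a : Abelian.Ext X Y i) (b : Abelian.Ext Y (D.dualizing X) j),
                𝒟 (a.comp b hij) = B a (T b) := by
    intro e
    obtain ⟨𝒟, h𝒟⟩ := HeckeDatum.exists_fund_cls (X := X) e
    refine ⟨𝒟, fun Y _ i j hij => ⟨_, HeckeDatum.extTranspose j X Y,
      HeckeDatum.isPoincarePairing_of_fund e h𝒟 hij,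
      HeckeDatum.isDualIdentification_extTranspose, fun a b => ?_⟩⟩
    rw [HeckeDatum.poincareForm_extTranspose]
  have e₀ : Module.Basis (Fin n) ℂ D.VC := Module.finBasisOfFinrankEq ℂ D.VC hn
  have nondeg : ∀ (Y : ModuleCat.{u} D.H) [FiniteDimensional ℂ Y] (i j : ℕ) (hij : i + j = n),
      (Abelian.Ext.bilinearCompOfLinear ℂ X Y (D.dualizing X) i j n hij).Nondegenerate := by
    intro Y _ i j hij
    obtain ⟨𝒟, h𝒟⟩ := key e₀
    obtain ⟨B, T, hB, -, h⟩ := h𝒟 Y i j hij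
    refine ⟨fun a ha => hB.nondegenerate.1 a fun b' => ?_, fun b hb => ?_⟩
    · obtain ⟨b, rfl⟩ := T.surjective b'
      rw [← h]
      exact (congrArg 𝒟 (ha b)).trans (map_zero 𝒟)
    · refine (map_eq_zero_iff T T.injective).1 (hB.nondegenerate.2 _ fun a => ?_)
      rw [← h]
      exact (congrArg 𝒟 (hb a)).trans (map_zero 𝒟)
  refine ⟨fun hX => ?_, nondeg, key⟩
  -- For `Y = X` and `i = 0`, the class of the identity is orthogonal to everything if the top `Ext`
  -- group vanishes.
  by_contra hcon
  rw [not_nontrivial_iff_subsingleton] at hcon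
  have h1 : Abelian.Ext.mk₀ (𝟙 X) = 0 :=
    (nondeg X 0 n (zero_add n)).1 _ fun b => Subsingleton.elim _ _
  have h2 : 𝟙 X = 0 := by
    rwa [Abelian.Ext.mk₀_eq_zero_iff] at h1
  obtain ⟨x, hx⟩ := exists_ne (0 : X)
  exact hx (congrArg (fun φ : X ⟶ X => φ x) h2)
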